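/- Conventions. A tracial $\mathrm{W}^*$-algebra is a von Neumann algebra $\mathcal M$ with a faithful normal tracial state $\tau$; $\|x\|_2=\tau(x^*x)^{1/2}$. Subalgebras $\mathcal N\le\mathcal M$ are unital von Neumann subalgebras with the restricted trace. $M_n(\mathbb C)$ carries the normalized trace $\tau_n=\frac1n\mathrm{Tr}$ and its $2$-norm; $\|\cdot\|$ is the operator norm, and $M_n(\mathbb C)_{sa}$ is the set of self-adjoint matrices. $\mathbb C\langle t_i:i\in I\rangle$ is the algebra of non-commutative polynomials; the law of a self-adjoint tuple $\mathbf x$ is the functional $\lambda_{\mathbf x}(p)=\tau(p(\mathbf x))$, and laws carry the topology of pointwise convergence. A von Neumann algebra is diffuse if it has no minimal projections; a self-adjoint operator has diffuse spectrum if its spectral measure has no atoms. For $F\subseteq I$ finite, $\varepsilon>0$ and $\Omega\subseteq M_n(\mathbb C)_{sa}^I$, let $N_{F,\varepsilon}(\Omega)$ be the set of $\mathbf B\in M_n(\mathbb C)_{sa}^I$ such that some $\mathbf A\in\Omega$ satisfies $\|A_i-B_i\|_2<\varepsilon$ for all $i\in F$, and let $K_{F,\varepsilon}(\Omega)$ be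 the least cardinality of a set $\Omega_0\subseteq\Omega$ with $\Omega\subseteq N_{F,\varepsilon}(\Omega_0)$. Exponential concentration. Given $n(k)\to\infty$, probability measures $\mu^{(k)}$ on $M_{n(k)}(\mathbb C)_{sa}^I$ have exponential concentration at the scale $n(k)^2$ if for all finite $F\subseteq I$ and all $\varepsilon>0$ $$\limsup_{k\to\infty}\frac1{n(k)^2}\log\,\sup\{\mu^{(k)}(N_{F,\varepsilon}(\Omega)^c):\Omega\text{ measurable},\ \mu^{(k)}(\Omega)\ge 1/2\}<0 .$$ $1$-bounded entropy. Let $\mathcal N\le\mathcal M$ with $\mathcal N$ diffuse. Choose self-adjoint tuples $\mathbf x'=(x'_i)_{i\in I'}$ generating $\mathcal M$ and $\mathbf y=(y_j)_{j\in J}$ generating $\mathcal N$, a self-adjoint $z\in\mathcal N$ with diffuse spectrum, numbers $R'_i>\|x'_i\|$, $R''_j>\|y_j\|$, $R_0>\|z\|$, and $C^{(n)}\in M_n(\mathbb C)_{sa}$ with $\|C^{(n)}\|\le R_0$ and $\lambda_{C^{(n)}}\to\lambda_z$. For a neighborhood $\mathcal U$ of $\lambda_{(\mathbf x',\mathbf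 y,z)}$ let $\Gamma_n(\mathcal U)$ be the set of $\mathbf B\in M_n(\mathbb C)_{sa}^J$ with $\|B_j\|\le R''_j$ for which there is $\mathbf A\in M_n(\mathbb C)_{sa}^{I'}$ with $\|A_i\|\le R'_i$ and $\lambda_{(\mathbf A,\mathbf B,C^{(n)})}\in\mathcal U$. Then $$h(\mathcal N:\mathcal M)=\sup_{F\subseteq J\text{ finite},\,\varepsilon>0}\ \inf_{\mathcal U}\ \limsup_{n\to\infty}\frac1{n^2}\log K_{F,\varepsilon}(\Gamma_n(\mathcal U)) .$$ (This value does not depend on the choices. In the theorem it may be computed with any one choice; the generators used here need not be those of the random matrix models.) Theorem B. Let $\mathcal P\subseteq\mathcal M$ be an inclusion of tracial $\mathrm{W}^*$-algebras and let $\mathbf x=(x_i)_{i\in I}$ be a (possibly infinite) tuple of self-adjoint generators of $\mathcal M$. Suppose that $n(k)\to\infty$ and that $\mathbf X^{(k)}=(X^{(k)}_i)_{i\in I}$ are tuples of random self-adjoint $n(k)\times n(k)$ matrices such that 1. for each $i$ there is $R_i$ with $\|X^{(k)}_i\|\le R_i$ almost surely for all $k$; 2. for every $p\in\mathbb C\langle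 t_i:i\in I\rangle$, $\tau_{n(k)}(p(\mathbf X^{(k)}))\to\tau(p(\mathbf x))$ in probability; 3. for every finite $F\subseteq I$, the distributions of $(X^{(k)}_i)_{i\in F}$ have exponential concentration at the scale $n(k)^2$; 4. for every $p\in\mathbb C\langle t_i:i\in I\rangle$, $\lim_{k\to\infty}\|\mathbb E[p(\mathbf X^{(k)})]\|_2=\|E_{\mathcal P}[p(\mathbf x)]\|_2$, where $E_{\mathcal P}:\mathcal M\to\mathcal P$ is the trace-preserving conditional expectation. Then every von Neumann subalgebra $\mathcal N\le\mathcal M$ with $h(\mathcal N:\mathcal M)=0$ and $\mathcal N\cap\mathcal P$ diffuse satisfies $\mathcal N\subseteq\mathcal P$. -/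

import Mathlib

open Filter Topology MeasureTheory

open scoped InnerProductSpace ComplexOrder

noncomputable section

/-! ### Non-commutative polynomials, laws and 2-norms -/

/-- The non-commutative law of a tuple `x` with respect to the functional `φ`: the map
`p ↦ φ (p(x))` on non-commutative polynomials. The function space `FreeAlgebra ℂ ι → ℂ` carries
the topology of pointwise convergence. -/
def ncLaw {A ι : Type*} [Ring A] [Algebra ℂ A] (φ : A → ℂ) (x : ι → A) :
    FreeAlgebra ℂ ι → ℂ :=
  fun p => φ (FreeAlgebra.lift ℂ x p)

/-- The 2-norm `‖a‖₂ = φ(a* a)^{1/2}`. -/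
def twoNorm {A : Type*} [Mul A] [Star A] (φ : A → ℂ) (a : A) : ℝ :=
  √(φ (star a * a)).re

/-- The concatenated tuple `(x, y, z)`. -/
def joint {A I J : Type*} (x : I → A) (y : J → A) (z : A) : I ⊕ J ⊕ Unit → A :=
  Sum.elim x (Sum.elim y fun _ => z)

/-! ### Matrices -/

/-- Complex `n × n` matrices. -/
abbrev Mat (n : ℕ) : Type := Matrix (Fin n) (Fin n) ℂ

/-- Self-adjoint complex `n × n` matrices. -/
abbrev MatSA (n : ℕ) : Type := selfAdjoint (Mat n)

/-- Spaces of matrices carry the Borel σ-algebra. -/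
instance instMeasurableSpaceMat (n : ℕ) : MeasurableSpace (Mat n) := borel _

instance instBorelSpaceMat (n : ℕ) : BorelSpace (Mat n) := ⟨rfl⟩

/-- The normalized trace `(1/n) Tr`. -/
def ntr {n : ℕ} (A : Mat n) : ℂ := (n : ℂ)⁻¹ * A.trace

/-- The operator norm of a matrix acting on the Hilbert space `ℂⁿ`. -/
def opNorm {n : ℕ} (A : Mat n) : ℝ := ‖Matrix.toEuclideanCLM (𝕜 := ℂ) A‖

/-- The `(F, ε)`-neighborhood of a set of tuples of self-adjoint matrices. -/
def nhd {ι : Type*} {n : ℕ} (F : Finset ι) (ε : ℝ) (S : Set (ι → MatSA n)) :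
    Set (ι → MatSA n) :=
  {B | ∃ A ∈ S, ∀ i ∈ F, twoNorm ntr ((A i : Mat n) - (B i : Mat n)) < ε}

/-- The covering number `K_{F,ε}(S)`: the least number of points of `S` whose
`(F, ε)`-neighborhoods cover `S`. -/
def coverNum {ι : Type*} {n : ℕ} (F : Finset ι) (ε : ℝ) (S : Set (ι → MatSA n)) : ℕ∞ :=
  ⨅ (S₀ : Set (ι → MatSA n)) (_ : S₀ ⊆ S ∧ S ⊆ nhd F ε S₀), S₀.encard

/-! ### Exponential concentration of measure -/

/-- The concentration function `α_μ(F, ε)` of a measure on tuples of self-adjoint matrices. -/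
def concFun {ι : Type*} {n : ℕ} (μ : Measure (ι → MatSA n)) (F : Finset ι) (ε : ℝ) : ENNReal :=
  ⨆ (S : Set (ι → MatSA n)) (_ : MeasurableSet S ∧ 1 / 2 ≤ μ S), μ (nhd F ε S)ᶜ

/-- Exponential concentration of measure at the scale `n(k)²`:
`limsup_k n(k)⁻² log α_{μ_k}(F, ε) < 0` for all finite `F` and all `ε > 0`. -/
def HasExpConcentration {ι : Type*} {n : ℕ → ℕ} (μ : ∀ k, Measure (ι → MatSA (n k))) : Prop :=
  ∀ (F : Finset ι) (ε : ℝ), 0 < ε →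
    limsup (fun k => ENNReal.log (concFun (μ k) F ε) / (((n k : ℝ) ^ 2 : ℝ) : EReal)) atTop < 0

/-! ### Tracial von Neumann algebras -/

section VN

variable {H : Type*} [NormedAddCommGroup H] [InnerProductSpace ℂ H] [CompleteSpace H]

/-- `τ` is a faithful normal tracial state on the von Neumann algebra `M`. Normality is
ultraweak continuity, i.e. `τ` is given by square-summable sequences of vectors. -/
structure IsFaithfulNormalTracialState (M : VonNeumannAlgebra H)
    (τ : M.toStarSubalgebra →ₗ[ℂ] ℂ) : Prop where
  map_one : τ 1 = 1
  nonneg : ∀ a, 0 ≤ τ (star a * a)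
  tracial : ∀ a b, τ (a * b) = τ (b * a)
  faithful : ∀ a, τ (star a * a) = 0 → a = 0
  normal : ∃ ξ η : ℕ → H, (Summable fun m => ‖ξ m‖ ^ 2) ∧ (Summable fun m => ‖η m‖ ^ 2) ∧
    ∀ a : M.toStarSubalgebra, HasSum (fun m => ⟪ξ m, (a : H →L[ℂ] H) (η m)⟫_ℂ) (τ a)

/-- The tuple `x` of self-adjoint operators generates the von Neumann algebra `N`, i.e. `N` is
the double commutant of `x`. -/
def Generates {ι : Type*} (x : ι → H →L[ℂ] H) (N : VonNeumannAlgebra H) : Prop :=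
  (∀ i, IsSelfAdjoint (x i)) ∧ Set.centralizer (Set.centralizer (Set.range x)) = (N : Set _)

/-- A von Neumann algebra (given by its set of elements) is diffuse if it has no minimal
projection: every nonzero projection has a nonzero proper subprojection. -/
def IsDiffuse (S : Set (H →L[ℂ] H)) : Prop :=
  ∀ p ∈ S, IsStarProjection p → p ≠ 0 →
    ∃ q ∈ S, IsStarProjection q ∧ p * q = q ∧ q ≠ 0 ∧ q ≠ p

/-- A self-adjoint operator has diffuse spectrum if its spectral measure has no atoms. The
spectral projection of `{t}` is the projection onto the eigenspace of `t`. -/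
def HasDiffuseSpectrum (z : H →L[ℂ] H) : Prop :=
  ∀ (t : ℝ) (v : H), z v = (t : ℂ) • v → v = 0

open Classical in
/-- The trace-preserving conditional expectation `E_P : M → P`: `E_P a` is the unique `b ∈ P`
with `τ(b c) = τ(a c)` for all `c ∈ P`. -/
def condExpTr {M : VonNeumannAlgebra H} (τ : M.toStarSubalgebra →ₗ[ℂ] ℂ)
    (P : VonNeumannAlgebra H) (a : M.toStarSubalgebra) : M.toStarSubalgebra :=
  if h : ∃ b : M.toStarSubalgebra, (b : H →L[ℂ] H) ∈ P ∧
      ∀ c : M.toStarSubalgebra, (c : H →L[ℂ] H) ∈ P → τ (b * c) = τ (a * c)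
  then h.choose else 0

/-- The defining property determines the conditional expectation. -/
theorem condExpTr_eq {M : VonNeumannAlgebra H} {τ : M.toStarSubalgebra →ₗ[ℂ] ℂ}
    (hτ : IsFaithfulNormalTracialState M τ) {P : VonNeumannAlgebra H}
    {a b : M.toStarSubalgebra} (hb : (b : H →L[ℂ] H) ∈ P)
    (h : ∀ c : M.toStarSubalgebra, (c : H →L[ℂ] H) ∈ P → τ (b * c) = τ (a * c)) :
    condExpTr τ P a = b := by
  have hex : ∃ b : M.toStarSubalgebra, (b : H →L[ℂ] H) ∈ P ∧
      ∀ c : M.toStarSubalgebra, (c : H →L[ℂ] H) ∈ P → τ (b * c) = τ (a * c) := ⟨b, hb, h⟩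
  rw [condExpTr, dif_pos hex]
  obtain ⟨h1, h2⟩ := hex.choose_spec
  set d := hex.choose
  have hmem : ((star (d - b) : M.toStarSubalgebra) : H →L[ℂ] H) ∈ P :=
    star_mem (sub_mem h1 hb)
  have h0 : τ (star (d - b) * (d - b)) = 0 := by
    rw [hτ.tracial, sub_mul, map_sub, h2 _ hmem, h _ hmem, sub_self]
  exact sub_eq_zero.1 (hτ.faithful _ h0)

/-! ### The 1-bounded entropy -/

/-- The microstate space `Γ_{R,n}(y : x | C ⇝ z; U)` for `y` in the presence of `x` relative to
`C`, where `U` is a set of laws. -/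
def microstates {I J : Type*} {n : ℕ} (Rx : I → ℝ) (Ry : J → ℝ) (C : MatSA n)
    (U : Set (FreeAlgebra ℂ (I ⊕ J ⊕ Unit) → ℂ)) : Set (J → MatSA n) :=
  {B | ∃ A : I → MatSA n, (∀ i, opNorm (A i : Mat n) ≤ Rx i) ∧
    (∀ j, opNorm (B j : Mat n) ≤ Ry j) ∧
    ncLaw ntr (joint (fun i => (A i : Mat n)) (fun j => (B j : Mat n)) (C : Mat n)) ∈ U}

/-- A choice of the auxiliary objects in the definition of the 1-bounded entropy of `N` in the
presence of `M`: self-adjoint generators `x` of `M` and `y` of `N`, a self-adjoint `z ∈ N` with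
diffuse spectrum, cut-offs for the operator norms, and a sequence `C` of microstates for `z`. -/
structure EntropyData (M : VonNeumannAlgebra H) (τ : M.toStarSubalgebra →ₗ[ℂ] ℂ)
    (N : VonNeumannAlgebra H) (I J : Type*) where
  x : I → M.toStarSubalgebra
  y : J → M.toStarSubalgebra
  z : M.toStarSubalgebra
  generates_x : Generates (fun i => (x i : H →L[ℂ] H)) M
  generates_y : Generates (fun j => (y j : H →L[ℂ] H)) N
  z_mem : (z : H →L[ℂ] H) ∈ N
  z_selfAdjoint : IsSelfAdjoint z
  z_diffuse : HasDiffuseSpectrum (z : H →L[ℂ] H)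
  Rx : I → ℝ
  Ry : J → ℝ
  Rz : ℝ
  norm_x_lt : ∀ i, ‖x i‖ < Rx i
  norm_y_lt : ∀ j, ‖y j‖ < Ry j
  norm_z_lt : ‖z‖ < Rz
  C : ∀ n : ℕ, MatSA n
  norm_C_le : ∀ n, opNorm (C n : Mat n) ≤ Rz
  tendsto_C : Tendsto (fun n => ncLaw ntr fun _ : Unit => (C n : Mat n)) atTop
    (𝓝 (ncLaw τ fun _ : Unit => z))

/-- The 1-bounded entropy `h(N : M)`, computed with the given auxiliary choices:
`sup_{F,ε} inf_U limsup_n n⁻² log K_{F,ε}(Γ_{R,n}(y : x | C ⇝ z; U))`, where `U` ranges over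
the neighborhoods of the law of `(x, y, z)`. Since the cut-offs confine all laws in question to
the set of laws with these cut-offs, neighborhoods in the ambient space can be used. -/
def EntropyData.h {M : VonNeumannAlgebra H} {τ : M.toStarSubalgebra →ₗ[ℂ] ℂ}
    {N : VonNeumannAlgebra H} {I J : Type*} (D : EntropyData M τ N I J) : EReal :=
  ⨆ (F : Finset J) (ε : ℝ) (_ : 0 < ε),
    ⨅ U ∈ 𝓝 (ncLaw τ (joint D.x D.y D.z)),
      limsup (fun n : ℕ =>
        ENNReal.log (coverNum F ε (microstates D.Rx D.Ry (D.C n) U) : ENNReal) /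
          (((n : ℝ) ^ 2 : ℝ) : EReal)) atTop

end VN

end

/-! Let `y` be a generator of `N` and `s` a polynomial with `s(x)` close to `y` in 2-norm. Condition
4 identifies `‖s(x) - E_P s(x)‖₂²` with the limit of the variance of the random matrix `s(X)`, so `y
∈ P` follows once `s(X)` is close to a deterministic matrix in mean square. Exponential
concentration reduces this to a much weaker claim: for every `c > 0`, some ball of small radius
contains `s(X)` with probability at least `exp(-c n²)`. Indeed, a set whose measure exceeds the
concentration function swells to almost full measure (`measure_compl_nhd_nhd_le`,
`IsMatrixModel.twoNorm_sub_condExpTr_le_of_ball`).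

Such balls come from vanishing entropy by pigeonhole (`IsMatrixModel.exists_ball`). Polynomials `q
j` in `x` that approximate the generators of `N` turn typical values of `X` into microstates. But
entropy counts microstates relative to a fixed sequence `C` for a diffuse element, and `q(X)`
becomes one of these only after conjugation by a unitary `V` that depends on `X`
(`EntropyData.exists_polynomials_microstates`). So entropy supplies at most `exp(c n²)` labels, with
`c` arbitrarily small, for the conjugates `V q(X) V*` only.

The conjugation is undone with the help of `N ∩ P`. Diffuseness gives `z ∈ N ∩ P` whose spectral
measure consists of small atoms at integers (`exists_small_atoms`). As `z ∈ P`, a polynomial `t(X)`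
approximating `z` has small variance and is almost a constant matrix `D`. As `z ∈ N`, it is nearly a
polynomial in the generators of `N`, so its conjugate by `V` is determined by the label too. If two
values of `X` share a label, then `V'* V` almost commutes with `D`. Such a matrix is nearly
supported on the entries indexed by close pairs of eigenvalues of `D`. These are few
(`exists_card_close_eigenvalues_le`), so the approximate commutant has a net of size `exp(c n²)`
(`exists_finset_cover_commutant`). Adding a net point to the label determines `V` up to a fixed
unitary and small error, and hence `q(X)` itself (`exists_label_of_label_conj`,
`EntropyData.exists_tests_label`). -/

noncomputable section

/-! ### Tracial states on C*-algebras -/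

/-- A tracial state on a C*-algebra. -/
structure IsTracialState {A : Type*} [CStarAlgebra A] (φ : A →ₗ[ℂ] ℂ) : Prop where
  map_one : φ 1 = 1
  nonneg : ∀ a, 0 ≤ φ (star a * a)
  tracial : ∀ a b, φ (a * b) = φ (b * a)

section CStar

variable {A : Type*} [CStarAlgebra A]

theorem IsSelfAdjoint.abs_le_of_mem_spectrum {a : A} {r t : ℝ} (h : ‖a‖ ≤ r)
    (ht : t ∈ spectrum ℝ a) : |t| ≤ r := by
  have h1 : Nontrivial A := by
    by_contra hA
    rw [not_nontrivial_iff_subsingleton] at hA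
    simp at ht
  have := spectrum.norm_le_norm_of_mem ht
  rw [Real.norm_eq_abs] at this
  exact this.trans h

theorem IsSelfAdjoint.exists_star_mul_self_eq_cfc (a : A) {f : ℝ → ℝ} (hf : Continuous f)
    (hpos : ∀ t ∈ spectrum ℝ a, 0 ≤ f t) : ∃ d : A, star d * d = cfc f a := by
  refine ⟨cfc (fun t => √(f t)) a, ?_⟩
  rw [← cfc_star, ← cfc_mul _ _ a (by fun_prop) (by fun_prop)]
  refine cfc_congr fun t ht => ?_
  simp [Real.mul_self_sqrt (hpos t ht)]

theorem IsSelfAdjoint.exists_star_mul_self_eq_sub {a : A} (ha : IsSelfAdjoint a) {r : ℝ}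
    (h : ‖a‖ ≤ r) : ∃ d : A, star d * d = (r : ℂ) • (1 : A) - a := by
  obtain ⟨d, hd⟩ := IsSelfAdjoint.exists_star_mul_self_eq_cfc a (f := fun t => r - t)
    (by fun_prop) (fun t ht => by
      have := IsSelfAdjoint.abs_le_of_mem_spectrum h ht
      linarith [le_abs_self t])
  refine ⟨d, hd.trans ?_⟩
  rw [cfc_sub (fun _ => r) (fun t => t) a (by fun_prop) (by fun_prop), cfc_id' ℝ a, cfc_const r a,
    Algebra.algebraMap_eq_smul_one]
  norm_num

theorem exists_star_mul_self_eq_sq_sub (a : A) :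
    ∃ d : A, star d * d = ((‖a‖ ^ 2 : ℝ) : ℂ) • (1 : A) - star a * a := by
  refine IsSelfAdjoint.exists_star_mul_self_eq_sub (.star_mul_self a) ?_
  rw [CStarRing.norm_star_mul_self, pow_two]

end CStar

namespace IsTracialState

set_option linter.unusedSectionVars false

variable {A : Type*} [CStarAlgebra A] {φ : A →ₗ[ℂ] ℂ} (hφ : IsTracialState φ)
include hφ

/-- Positivity makes every `φ(b* b)` real. Expanding this for `b = a + 1` compares the imaginary
parts of `φ(a)` and `φ(a*)`, and for `b = a + i` the real parts. -/
theorem map_star (a : A) : φ (star a) = star (φ a) := by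
  have h1 := (Complex.le_def.1 (hφ.nonneg (a + 1))).2
  have h2 := (Complex.le_def.1 (hφ.nonneg (a + Complex.I • 1))).2
  have h3 := (Complex.le_def.1 (hφ.nonneg a)).2
  simp only [star_add, star_one, add_mul, mul_add, mul_one, one_mul, map_add, hφ.map_one,
    star_smul, smul_mul_assoc, mul_smul_comm, map_smul, smul_eq_mul, Complex.add_im,
    Complex.zero_im, Complex.star_def, Complex.conj_I, Complex.mul_im, Complex.neg_im,
    Complex.neg_re, Complex.I_re, Complex.I_im, Complex.one_im] at h1 h2 h3
  apply Complex.ext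
  · simp only [Complex.star_def, Complex.conj_re]
    simp at h2
    linarith
  · simp only [Complex.star_def, Complex.conj_im]
    linarith

/-- The pre-inner product `⟪a, b⟫ = φ(a* b)`. -/
@[reducible] def core : PreInnerProductSpace.Core ℂ A where
  inner a b := φ (star a * b)
  conj_inner_symm a b := by
    have := hφ.map_star (star b * a)
    simp only [star_mul, star_star] at this
    exact this.symm
  re_inner_nonneg a := (Complex.le_def.1 (hφ.nonneg a)).1
  add_left a b c := by simp [add_mul]
  smul_left a b c := by simp

omit hφ in
theorem twoNorm_nonneg (a : A) : 0 ≤ twoNorm φ a := Real.sqrt_nonneg _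

theorem map_star_mul_self (a : A) : φ (star a * a) = ((twoNorm φ a ^ 2 : ℝ) : ℂ) := by
  have h := Complex.le_def.1 (hφ.nonneg a)
  rw [twoNorm, Real.sq_sqrt h.1]
  exact Complex.ext rfl (by simpa using h.2.symm)

theorem re_map_star_mul_self (a : A) : (φ (star a * a)).re = twoNorm φ a ^ 2 := by
  rw [hφ.map_star_mul_self, Complex.ofReal_re]

theorem norm_map_star_mul_le (a b : A) : ‖φ (star a * b)‖ ≤ twoNorm φ a * twoNorm φ b :=
  letI := hφ.core
  InnerProductSpace.Core.norm_inner_le_norm (𝕜 := ℂ) a b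

theorem twoNorm_add_sq (a b : A) :
    twoNorm φ (a + b) ^ 2 = twoNorm φ a ^ 2 + 2 * (φ (star a * b)).re + twoNorm φ b ^ 2 := by
  have h : φ (star b * a) = star (φ (star a * b)) := by
    rw [← hφ.map_star, star_mul, star_star]
  rw [← hφ.re_map_star_mul_self, ← hφ.re_map_star_mul_self, ← hφ.re_map_star_mul_self]
  simp only [star_add, add_mul, mul_add, map_add, Complex.add_re, h, Complex.star_def,
    Complex.conj_re]
  ring

theorem twoNorm_add_le (a b : A) : twoNorm φ (a + b) ≤ twoNorm φ a + twoNorm φ b := by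
  have h := hφ.twoNorm_add_sq a b
  have h1 := (Complex.re_le_norm _).trans (hφ.norm_map_star_mul_le a b)
  refine abs_le_of_sq_le_sq' ?_ (add_nonneg (twoNorm_nonneg _) (twoNorm_nonneg _)) |>.2
  linarith [add_sq (twoNorm φ a) (twoNorm φ b)]

theorem twoNorm_smul (c : ℂ) (a : A) : twoNorm φ (c • a) = ‖c‖ * twoNorm φ a := by
  rw [twoNorm, twoNorm, star_smul, smul_mul_smul_comm, map_smul, Complex.star_def, smul_eq_mul,
    ← Complex.normSq_eq_conj_mul_self, Complex.re_ofReal_mul, Complex.normSq_eq_norm_sq,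
    Real.sqrt_mul (by positivity), Real.sqrt_sq (norm_nonneg _)]

theorem twoNorm_neg (a : A) : twoNorm φ (-a) = twoNorm φ a := by
  simp [twoNorm]

theorem twoNorm_star (a : A) : twoNorm φ (star a) = twoNorm φ a := by
  rw [twoNorm, twoNorm, star_star, hφ.tracial]

theorem twoNorm_zero : twoNorm φ (0 : A) = 0 := by simp [twoNorm]

theorem twoNorm_one : twoNorm φ (1 : A) = 1 := by simp [twoNorm, hφ.map_one]

theorem twoNorm_sub_comm (a b : A) : twoNorm φ (a - b) = twoNorm φ (b - a) := by
  rw [← hφ.twoNorm_neg, neg_sub]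

theorem twoNorm_sub_le (a b : A) : twoNorm φ (a - b) ≤ twoNorm φ a + twoNorm φ b := by
  rw [sub_eq_add_neg, ← hφ.twoNorm_neg b]
  exact hφ.twoNorm_add_le _ _

theorem twoNorm_sub_le_sub_add_sub (a b c : A) :
    twoNorm φ (a - c) ≤ twoNorm φ (a - b) + twoNorm φ (b - c) := by
  rw [← sub_add_sub_cancel a b c]
  exact hφ.twoNorm_add_le _ _

theorem norm_map_le (a : A) : ‖φ a‖ ≤ twoNorm φ a := by
  have := hφ.norm_map_star_mul_le 1 a
  rwa [star_one, one_mul, hφ.twoNorm_one, one_mul] at this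

/-- Since `‖a‖² - a* a = d* d` for some `d`, positivity of `φ((db)* (db))` is the squared
inequality. -/
theorem twoNorm_mul_le (a b : A) : twoNorm φ (a * b) ≤ ‖a‖ * twoNorm φ b := by
  obtain ⟨d, hd⟩ := exists_star_mul_self_eq_sq_sub a
  have h := (Complex.le_def.1 (hφ.nonneg (d * b))).1
  have h2 : star (d * b) * (d * b) =
      ((‖a‖ ^ 2 : ℝ) : ℂ) • (star b * b) - star (a * b) * (a * b) := by
    rw [star_mul, star_mul, mul_assoc, ← mul_assoc (star d), hd, sub_mul, mul_sub,
      smul_mul_assoc, one_mul, mul_smul_comm]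
    simp only [mul_assoc]
  rw [h2, map_sub, map_smul, hφ.map_star_mul_self, hφ.map_star_mul_self, smul_eq_mul,
    ← Complex.ofReal_mul, ← Complex.ofReal_sub, Complex.ofReal_re, Complex.zero_re] at h
  refine abs_le_of_sq_le_sq' ?_ (mul_nonneg (norm_nonneg _) (twoNorm_nonneg _)) |>.2
  rw [mul_pow]
  linarith

theorem twoNorm_mul_le' (a b : A) : twoNorm φ (a * b) ≤ twoNorm φ a * ‖b‖ := by
  have := hφ.twoNorm_mul_le (star b) (star a)
  rwa [← star_mul, hφ.twoNorm_star, hφ.twoNorm_star, norm_star, mul_comm] at this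

theorem twoNorm_le_norm (a : A) : twoNorm φ a ≤ ‖a‖ := by
  have := hφ.twoNorm_mul_le a 1
  rwa [mul_one, hφ.twoNorm_one, mul_one] at this

theorem nontrivial : Nontrivial A :=
  ⟨1, 0, fun h => by
    have := hφ.map_one
    rw [h, map_zero] at this
    exact zero_ne_one this⟩

theorem twoNorm_unitary_mul {u : A} (hu : u ∈ unitary A) (a : A) :
    twoNorm φ (u * a) = twoNorm φ a := by
  rw [twoNorm, twoNorm, star_mul, mul_assoc, ← mul_assoc (star u), (Unitary.mem_iff.1 hu).1,
    one_mul]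

theorem twoNorm_mul_unitary {u : A} (hu : u ∈ unitary A) (a : A) :
    twoNorm φ (a * u) = twoNorm φ a := by
  rw [← hφ.twoNorm_star, star_mul, hφ.twoNorm_unitary_mul (Unitary.star_mem hu), hφ.twoNorm_star]

/-- A product of two positive elements need not be positive, but by traciality its trace is `φ((d
w*)* (d w*))`. -/
theorem re_map_mul_nonneg (d w : A) : 0 ≤ (φ (star d * d * (star w * w))).re := by
  have h := (Complex.le_def.1 (hφ.nonneg (d * star w))).1
  rw [star_mul, star_star, mul_assoc, hφ.tracial] at h
  simpa only [mul_assoc, Complex.zero_re] using h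

/-- Truncating the spectrum of `c` to `[-r, r]` does not increase the 2-distance to elements of
norm at most `r`. -/
theorem twoNorm_sub_cfc_clamp_le {a c : A} {r : ℝ} (ha : IsSelfAdjoint a) (hc : IsSelfAdjoint c)
    (har : ‖a‖ ≤ r) :
    twoNorm φ (a - cfc (fun t => max (-r) (min t r)) c) ≤ twoNorm φ (a - c) := by
  have hr : 0 ≤ r := (norm_nonneg _).trans har
  -- With `u = (c - r)₊` and `v = (-r - c)₊` one has `k - c = v - u`. The cross term in the
  -- expansion of `‖(a - k) + (k - c)‖₂²` is twice the real part of `φ((r + a) v) + φ((r - a) u)`,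
  -- where all four factors are positive.
  set k := cfc (fun t => max (-r) (min t r)) c with hk
  set u := cfc (fun t => max (t - r) 0) c with hu
  set v := cfc (fun t => max (-r - t) 0) c with hv
  obtain ⟨u', hu'⟩ := IsSelfAdjoint.exists_star_mul_self_eq_cfc c (f := fun t => max (t - r) 0)
    (by fun_prop) (fun t _ => le_max_right _ _)
  obtain ⟨v', hv'⟩ := IsSelfAdjoint.exists_star_mul_self_eq_cfc c (f := fun t => max (-r - t) 0)
    (by fun_prop) (fun t _ => le_max_right _ _)
  obtain ⟨d, hd⟩ := ha.exists_star_mul_self_eq_sub har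
  obtain ⟨e, he⟩ := ha.neg.exists_star_mul_self_eq_sub (r := r) (by rwa [norm_neg])
  have hks : IsSelfAdjoint k := IsSelfAdjoint.cfc
  have hku : k * u = (r : ℂ) • u := by
    rw [hk, hu, ← cfc_mul _ _ c (by fun_prop) (by fun_prop), Complex.coe_smul,
      ← cfc_const_mul _ _ _ (by fun_prop)]
    refine cfc_congr fun t _ => ?_
    rcases le_total t r with h | h
    · simp [max_eq_right (sub_nonpos.2 h)]
    · simp [min_eq_right h, max_eq_right (neg_le_self hr)]
  have hkv : k * v = -((r : ℂ) • v) := by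
    rw [hk, hv, ← cfc_mul _ _ c (by fun_prop) (by fun_prop), Complex.coe_smul,
      ← cfc_const_mul _ _ _ (by fun_prop), ← cfc_neg]
    refine cfc_congr fun t _ => ?_
    rcases le_total (-r) t with h | h
    · simp [max_eq_right (sub_nonpos.2 h)]
    · have : t ≤ r := by linarith
      simp [min_eq_left this, max_eq_left h]
  have hkc : k - c = v - u := by
    conv_lhs => rw [← cfc_id' ℝ c]
    rw [hk, hu, hv, ← cfc_sub _ _ c (by fun_prop) (by fun_prop),
      ← cfc_sub _ _ c (by fun_prop) (by fun_prop)]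
    refine cfc_congr fun t _ => ?_
    rcases le_total t r with h | h <;> rcases le_total (-r) t with h' | h'
    · simp [h, h']
    · simp [h, h']
    · have : -r ≤ r := by linarith
      have h2 : -r - t ≤ 0 := by linarith
      simp [h, this, h2]
    · have : -r ≤ r := by linarith
      have h'' : t = r := by linarith
      have h3 : r = 0 := by linarith
      simp [h'', h3]
  have h1 := hφ.twoNorm_add_sq (a - k) (k - c)
  rw [sub_add_sub_cancel, star_sub, ha.star_eq, hks.star_eq, hkc] at h1
  have h2 : (a - k) * (v - u) =
      star e * e * (star v' * v') + star d * d * (star u' * u') := by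
    rw [hu', hv', hd, he, ← hu, ← hv]
    simp only [sub_mul, mul_sub, hku, hkv, smul_mul_assoc, one_mul, neg_mul]
    abel
  have h3 := hφ.re_map_mul_nonneg e v'
  have h4 := hφ.re_map_mul_nonneg d u'
  rw [h2, map_add, Complex.add_re] at h1
  refine abs_le_of_sq_le_sq' ?_ (twoNorm_nonneg _) |>.2
  have := sq_nonneg (twoNorm φ (v - u))
  linarith

end IsTracialState

theorem norm_cfc_clamp_le {A : Type*} [CStarAlgebra A] (c : A) {r : ℝ} (hr : 0 ≤ r) :
    ‖cfc (fun t => max (-r) (min t r)) c‖ ≤ r := by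
  refine norm_cfc_le hr fun t _ => ?_
  rw [Real.norm_eq_abs, abs_le]
  exact ⟨le_max_left _ _, max_le (by linarith) (min_le_right _ _)⟩

/-- A polynomial that approximates the truncation to `[-r, r]` on `[-C, C]`. -/
theorem exists_polynomial_near_clamp (r C : ℝ) {δ : ℝ} (hδ : 0 < δ) :
    ∃ q : Polynomial ℝ, ∀ t : ℝ, |t| ≤ C → |q.eval t - max (-r) (min t r)| < δ := by
  obtain ⟨q, hq⟩ := exists_polynomial_near_of_continuousOn (-C) C
    (fun t => max (-r) (min t r)) (by fun_prop) δ hδ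
  exact ⟨q, fun t ht => hq t (abs_le.1 ht)⟩

theorem norm_aeval_sub_cfc_le {A : Type*} [CStarAlgebra A] {c : A} (hc : IsSelfAdjoint c)
    {f : ℝ → ℝ} (hf : Continuous f) {q : Polynomial ℝ} {C δ : ℝ} (hδ : 0 ≤ δ) (hcC : ‖c‖ ≤ C)
    (hq : ∀ t : ℝ, |t| ≤ C → |q.eval t - f t| ≤ δ) :
    ‖Polynomial.aeval c q - cfc f c‖ ≤ δ := by
  rw [← cfc_polynomial q c, ← cfc_sub _ _ c (by fun_prop) (by fun_prop)]
  refine norm_cfc_le hδ fun t ht => ?_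
  exact hq t (IsSelfAdjoint.abs_le_of_mem_spectrum hcC ht)

/-! ### Evaluation of non-commutative polynomials -/

section Star

variable {ι : Type*}

/-- The antilinear anti-automorphism of `ℂ⟨tᵢ⟩` that fixes the variables, with values in the
opposite algebra. -/
def ncStarHom (ι : Type*) : FreeAlgebra ℂ ι →+* (FreeAlgebra ℂ ι)ᵐᵒᵖ :=
  -- Scalars act on the opposite algebra through complex conjugation, so the universal property
  -- yields an antilinear map.
  letI : Algebra ℂ (FreeAlgebra ℂ ι)ᵐᵒᵖ :=
    Algebra.compHom (FreeAlgebra ℂ ι)ᵐᵒᵖ (starRingEnd ℂ)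
  (FreeAlgebra.lift ℂ fun i : ι => MulOpposite.op (FreeAlgebra.ι ℂ i)).toRingHom

/-- The adjoint of a non-commutative polynomial. -/
def ncStar (p : FreeAlgebra ℂ ι) : FreeAlgebra ℂ ι := (ncStarHom ι p).unop

theorem ncStar_add (p q : FreeAlgebra ℂ ι) : ncStar (p + q) = ncStar p + ncStar q := by
  simp [ncStar]

theorem ncStar_mul (p q : FreeAlgebra ℂ ι) : ncStar (p * q) = ncStar q * ncStar p := by
  simp [ncStar]

theorem ncStar_ι (i : ι) : ncStar (FreeAlgebra.ι ℂ i) = FreeAlgebra.ι ℂ i := by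
  let : Algebra ℂ (FreeAlgebra ℂ ι)ᵐᵒᵖ :=
    Algebra.compHom (FreeAlgebra ℂ ι)ᵐᵒᵖ (starRingEnd ℂ)
  exact congrArg MulOpposite.unop
    (FreeAlgebra.lift_ι_apply (R := ℂ) (fun i : ι => MulOpposite.op (FreeAlgebra.ι ℂ i)) i)

theorem ncStar_algebraMap (c : ℂ) : ncStar (algebraMap ℂ (FreeAlgebra ℂ ι) c) =
    algebraMap ℂ (FreeAlgebra ℂ ι) (star c) := by
  let : Algebra ℂ (FreeAlgebra ℂ ι)ᵐᵒᵖ :=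
    Algebra.compHom (FreeAlgebra ℂ ι)ᵐᵒᵖ (starRingEnd ℂ)
  exact congrArg MulOpposite.unop
    (AlgHom.commutes (FreeAlgebra.lift ℂ fun i : ι => MulOpposite.op (FreeAlgebra.ι ℂ i)) c)

theorem lift_ncStar {A : Type*} [Ring A] [StarRing A] [Algebra ℂ A] [StarModule ℂ A] {a : ι → A}
    (ha : ∀ i, IsSelfAdjoint (a i)) (p : FreeAlgebra ℂ ι) :
    FreeAlgebra.lift ℂ a (ncStar p) = star (FreeAlgebra.lift ℂ a p) := by
  induction p using FreeAlgebra.induction with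
  | grade0 c => rw [ncStar_algebraMap, AlgHom.commutes, AlgHom.commutes, algebraMap_star_comm]
  | grade1 i => simp [ncStar_ι, (ha i).star_eq]
  | mul p q hp hq => simp [ncStar_mul, hp, hq]
  | add p q hp hq => simp [ncStar_add, hp, hq]

theorem lift_lift {κ A : Type*} [Ring A] [Algebra ℂ A] (a : ι → A) (p : κ → FreeAlgebra ℂ ι)
    (g : FreeAlgebra ℂ κ) :
    FreeAlgebra.lift ℂ a (FreeAlgebra.lift ℂ p g) =
      FreeAlgebra.lift ℂ (fun j => FreeAlgebra.lift ℂ a (p j)) g := by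
  induction g using FreeAlgebra.induction with
  | grade0 c => simp
  | grade1 i => simp
  | mul p q hp hq => simp [hp, hq]
  | add p q hp hq => simp [hp, hq]

theorem map_lift {A B : Type*} [Ring A] [Algebra ℂ A] [Ring B] [Algebra ℂ B] (e : A →ₐ[ℂ] B)
    (a : ι → A) (p : FreeAlgebra ℂ ι) :
    e (FreeAlgebra.lift ℂ a p) = FreeAlgebra.lift ℂ (fun i => e (a i)) p := by
  induction p using FreeAlgebra.induction with
  | grade0 c => simp
  | grade1 i => simp
  | mul p q hp hq => simp [hp, hq]
  | add p q hp hq => simp [hp, hq]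

/-- The self-adjoint part `(p + p*) / 2` of a non-commutative polynomial. -/
def ncRe (p : FreeAlgebra ℂ ι) : FreeAlgebra ℂ ι := (2⁻¹ : ℂ) • (p + ncStar p)

theorem lift_ncRe {A : Type*} [Ring A] [StarRing A] [Algebra ℂ A] [StarModule ℂ A] {a : ι → A}
    (ha : ∀ i, IsSelfAdjoint (a i)) (p : FreeAlgebra ℂ ι) :
    FreeAlgebra.lift ℂ a (ncRe p) =
      (2⁻¹ : ℂ) • (FreeAlgebra.lift ℂ a p + star (FreeAlgebra.lift ℂ a p)) := by
  simp [ncRe, lift_ncStar ha]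

theorem isSelfAdjoint_lift_ncRe {A : Type*} [Ring A] [StarRing A] [Algebra ℂ A] [StarModule ℂ A]
    {a : ι → A} (ha : ∀ i, IsSelfAdjoint (a i)) (p : FreeAlgebra ℂ ι) :
    IsSelfAdjoint (FreeAlgebra.lift ℂ a (ncRe p)) := by
  rw [lift_ncRe ha, IsSelfAdjoint, star_smul, star_add, star_star, add_comm]
  simp

/-- The real polynomial `q` applied to the self-adjoint part of `p`. -/
def ncComp (q : Polynomial ℝ) (p : FreeAlgebra ℂ ι) : FreeAlgebra ℂ ι :=
  Polynomial.aeval (ncRe p) (q.map (algebraMap ℝ ℂ))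

theorem lift_ncComp {A : Type*} [CStarAlgebra A] (a : ι → A) (q : Polynomial ℝ)
    (p : FreeAlgebra ℂ ι) :
    FreeAlgebra.lift ℂ a (ncComp q p) =
      Polynomial.aeval (FreeAlgebra.lift ℂ a (ncRe p)) q := by
  rw [ncComp, ← Polynomial.aeval_algHom_apply, Polynomial.aeval_map_algebraMap]

theorem isSelfAdjoint_aeval {A : Type*} [CStarAlgebra A] {a : A} (ha : IsSelfAdjoint a)
    (q : Polynomial ℝ) : IsSelfAdjoint (Polynomial.aeval a q) := by
  rw [← cfc_polynomial q a]
  exact IsSelfAdjoint.cfc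

end Star

/-- The adjoint is isometric for the 2-norm, so passing to the self-adjoint part is a contraction.
-/
theorem IsTracialState.twoNorm_ncRe_sub_le {A ι : Type*} [CStarAlgebra A] {φ : A →ₗ[ℂ] ℂ}
    (hφ : IsTracialState φ) {a : ι → A} (ha : ∀ i, IsSelfAdjoint (a i)) {b : A}
    (hb : IsSelfAdjoint b) (p : FreeAlgebra ℂ ι) :
    twoNorm φ (FreeAlgebra.lift ℂ a (ncRe p) - b) ≤ twoNorm φ (FreeAlgebra.lift ℂ a p - b) := by
  set c := FreeAlgebra.lift ℂ a p
  have h : FreeAlgebra.lift ℂ a (ncRe p) - b = (2⁻¹ : ℂ) • ((c - b) + star (c - b)) := by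
    rw [lift_ncRe ha, star_sub, hb.star_eq, sub_add_sub_comm, smul_sub, ← two_smul ℂ b, smul_smul]
    simp [c]
  rw [h, hφ.twoNorm_smul]
  have := hφ.twoNorm_add_le (c - b) (star (c - b))
  rw [hφ.twoNorm_star] at this
  rw [norm_inv, Complex.norm_ofNat]
  linarith

/-! ### Uniform Lipschitz bounds for polynomial evaluation -/

section Lipschitz

variable {ι κ : Type*} {A : κ → Type*} [∀ k, CStarAlgebra (A k)] {φ : ∀ k, A k →ₗ[ℂ] ℂ}

/-- Evaluation of a non-commutative polynomial is bounded in operator norm and Lipschitz in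
2-norm on operator norm bounded tuples, uniformly over a family of algebras. -/
theorem exists_bound_lift (hφ : ∀ k, IsTracialState (φ k)) (R : ι → ℝ)
    (p : FreeAlgebra ℂ ι) : ∃ (C : ℝ) (F : Finset ι), 0 ≤ C ∧ ∀ k, ∀ a : ι → A k,
      (∀ i, ‖a i‖ ≤ R i) → ‖FreeAlgebra.lift ℂ a p‖ ≤ C ∧ ∀ b : ι → A k, (∀ i, ‖b i‖ ≤ R i) →
        ∀ ε : ℝ, 0 ≤ ε → (∀ i ∈ F, twoNorm (φ k) (a i - b i) ≤ ε) →
        twoNorm (φ k) (FreeAlgebra.lift ℂ a p - FreeAlgebra.lift ℂ b p) ≤ C * ε := by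
  classical
  induction p using FreeAlgebra.induction with
  | grade0 c =>
    refine ⟨‖c‖, ∅, norm_nonneg _, fun k a _ => ⟨?_, fun b _ ε hε _ => ?_⟩⟩
    · have := (hφ k).nontrivial
      simp
    · simp only [AlgHom.commutes, sub_self, (hφ k).twoNorm_zero]
      positivity
  | grade1 i =>
    refine ⟨max (R i) 1, {i}, by positivity, fun k a ha => ⟨?_, fun b _ ε hε h => ?_⟩⟩
    · simpa using Or.inl (ha i)
    · simp only [FreeAlgebra.lift_ι_apply]
      exact (h i (Finset.mem_singleton_self i)).trans
        (le_mul_of_one_le_left hε (le_max_right _ _))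
  | mul p q hp hq =>
    obtain ⟨C, F, hC, h⟩ := hp
    obtain ⟨D, G, hD, h'⟩ := hq
    refine ⟨2 * (C * D), F ∪ G, by positivity, fun k a ha => ⟨?_, fun b hb ε hε hab => ?_⟩⟩
    · rw [map_mul]
      refine (norm_mul_le _ _).trans ?_
      have := mul_le_mul (h k a ha).1 (h' k a ha).1 (norm_nonneg _) hC
      have : 0 ≤ C * D := by positivity
      linarith
    · have h1 := (h k a ha).2 b hb ε hε fun i hi => hab i (Finset.mem_union_left _ hi)
      have h2 := (h' k a ha).2 b hb ε hε fun i hi => hab i (Finset.mem_union_right _ hi)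
      rw [map_mul, map_mul, ← sub_add_sub_cancel _ (FreeAlgebra.lift ℂ a p *
        FreeAlgebra.lift ℂ b q) _, ← mul_sub, ← sub_mul]
      refine ((hφ k).twoNorm_add_le _ _).trans ?_
      have h3 := ((hφ k).twoNorm_mul_le (FreeAlgebra.lift ℂ a p)
        (FreeAlgebra.lift ℂ a q - FreeAlgebra.lift ℂ b q)).trans
        (mul_le_mul (h k a ha).1 h2 (IsTracialState.twoNorm_nonneg _) hC)
      have h4 := ((hφ k).twoNorm_mul_le' (FreeAlgebra.lift ℂ a p - FreeAlgebra.lift ℂ b p)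
        (FreeAlgebra.lift ℂ b q)).trans
        (mul_le_mul h1 (h' k b hb).1 (norm_nonneg _) (by positivity))
      linarith
  | add p q hp hq =>
    obtain ⟨C, F, hC, h⟩ := hp
    obtain ⟨D, G, hD, h'⟩ := hq
    refine ⟨C + D, F ∪ G, by positivity, fun k a ha => ⟨?_, fun b hb ε hε hab => ?_⟩⟩
    · rw [map_add]
      exact (norm_add_le _ _).trans (add_le_add (h k a ha).1 (h' k a ha).1)
    · have h1 := (h k a ha).2 b hb ε hε fun i hi => hab i (Finset.mem_union_left _ hi)
      have h2 := (h' k a ha).2 b hb ε hε fun i hi => hab i (Finset.mem_union_right _ hi)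
      rw [map_add, map_add, add_sub_add_comm, add_mul]
      exact ((hφ k).twoNorm_add_le _ _).trans (add_le_add h1 h2)

end Lipschitz

/-! ### The normalized trace on matrices -/

section NormalizedTrace

open scoped Matrix.Norms.L2Operator

/-- The normalized trace as a linear functional. -/
def ntrLin (n : ℕ) : Mat n →ₗ[ℂ] ℂ := (n : ℂ)⁻¹ • Matrix.traceLinearMap (Fin n) ℂ ℂ

theorem coe_ntrLin (n : ℕ) : ⇑(ntrLin n) = ntr := rfl

theorem trace_star_mul_self {n : ℕ} (A : Mat n) :
    (star A * A).trace = ((∑ a, ∑ b, ‖A a b‖ ^ 2 : ℝ) : ℂ) := by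
  rw [Finset.sum_comm]
  simp [Matrix.trace, Matrix.mul_apply, Matrix.star_apply, Complex.conj_mul']

theorem isTracialState_ntr {n : ℕ} (hn : 0 < n) : IsTracialState (ntrLin n) where
  map_one := by
    have : (n : ℂ) ≠ 0 := by exact_mod_cast hn.ne'
    simp [coe_ntrLin, ntr, this]
  nonneg A := by
    rw [coe_ntrLin, ntr, trace_star_mul_self, ← Complex.ofReal_natCast, ← Complex.ofReal_inv,
      ← Complex.ofReal_mul]
    exact_mod_cast by positivity
  tracial A B := by rw [coe_ntrLin, ntr, ntr, Matrix.trace_mul_comm]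

theorem twoNorm_ntr_sq {n : ℕ} (A : Mat n) :
    twoNorm ntr A ^ 2 = (n : ℝ)⁻¹ * ∑ a, ∑ b, ‖A a b‖ ^ 2 := by
  rw [twoNorm, ntr, trace_star_mul_self, ← Complex.ofReal_natCast, ← Complex.ofReal_inv,
    ← Complex.ofReal_mul, Complex.ofReal_re, Real.sq_sqrt (by positivity)]

/-- One constant serves all matrix sizes; this is what makes tolerances chosen in advance valid for
all large `n`. -/
theorem exists_bound_lift_mat {ι : Type*} (R : ι → ℝ) (p : FreeAlgebra ℂ ι) :
    ∃ (C : ℝ) (F : Finset ι), 0 ≤ C ∧ ∀ n : ℕ, 0 < n → ∀ a : ι → Mat n,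
      (∀ i, opNorm (a i) ≤ R i) → opNorm (FreeAlgebra.lift ℂ a p) ≤ C ∧
        ∀ b : ι → Mat n, (∀ i, opNorm (b i) ≤ R i) →
        ∀ ε : ℝ, 0 ≤ ε → (∀ i ∈ F, twoNorm ntr (a i - b i) ≤ ε) →
        twoNorm ntr (FreeAlgebra.lift ℂ a p - FreeAlgebra.lift ℂ b p) ≤ C * ε := by
  obtain ⟨C, F, hC, h⟩ := exists_bound_lift (κ := {n : ℕ // 0 < n}) (A := fun n => Mat n)
    (φ := fun n => ntrLin n) (fun n => isTracialState_ntr n.2) R p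
  exact ⟨C, F, hC, fun n hn a ha => h ⟨n, hn⟩ a ha⟩

end NormalizedTrace

/-! ### Weak limits and conditional expectations in von Neumann algebras -/

section VonNeumann

variable {H : Type*} [NormedAddCommGroup H] [InnerProductSpace ℂ H] [CompleteSpace H]

theorem VonNeumannAlgebra.isClosed_coe (M : VonNeumannAlgebra H) :
    IsClosed (M : Set (H →L[ℂ] H)) := by
  rw [← M.centralizer_centralizer]
  exact Set.isClosed_centralizer _

/-- A von Neumann algebra is a C*-algebra. -/
@[reducible] def VonNeumannAlgebra.cstarAlgebra (M : VonNeumannAlgebra H) :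
    CStarAlgebra M.toStarSubalgebra where
  complete := (M.isClosed_coe.isComplete.completeSpace_coe :
    CompleteSpace M.toStarSubalgebra).complete

attribute [local instance] VonNeumannAlgebra.cstarAlgebra

theorem VonNeumannAlgebra.mem_of_commute {N : VonNeumannAlgebra H} {T : H →L[ℂ] H}
    (h : ∀ S ∈ N.commutant, S * T = T * S) : T ∈ N := by
  rw [← N.commutant_commutant]
  exact VonNeumannAlgebra.mem_commutant_iff.2 h

theorem VonNeumannAlgebra.commute_of_mem {N : VonNeumannAlgebra H} {T S : H →L[ℂ] H}
    (hT : T ∈ N) (hS : S ∈ N.commutant) : T * S = S * T :=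
  VonNeumannAlgebra.mem_commutant_iff.1 hS T hT

theorem VonNeumannAlgebra.smul_mem (N : VonNeumannAlgebra H) {T : H →L[ℂ] H} (c : ℂ)
    (hT : T ∈ N) : c • T ∈ N :=
  N.toStarSubalgebra.toSubalgebra.smul_mem hT c

theorem VonNeumannAlgebra.cfc_mem {N : VonNeumannAlgebra H} {T : H →L[ℂ] H} (hT : T ∈ N)
    (f : ℝ → ℝ) : cfc f T ∈ N :=
  mem_of_commute fun _ hS =>
    ((Commute.cfc_real (VonNeumannAlgebra.commute_of_mem hT hS) f).symm : Commute _ _)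

theorem VonNeumannAlgebra.coe_cfc {M : VonNeumannAlgebra H} {a : M.toStarSubalgebra}
    (ha : IsSelfAdjoint a) {f : ℝ → ℝ} (hf : Continuous f) :
    ((cfc f a : M.toStarSubalgebra) : H →L[ℂ] H) = cfc f (a : H →L[ℂ] H) :=
  StarAlgHomClass.map_cfc (S := ℂ) M.toStarSubalgebra.subtype f a (by fun_prop)
    continuous_subtype_val ha (ha.map M.toStarSubalgebra.subtype)

/-- Bounded families of operators have limits along ultrafilters in the weak operator topology. -/
theorem exists_weak_limit {α : Type*} (U : Ultrafilter α) (b : α → H →L[ℂ] H) {r : ℝ}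
    (hb : ∀ i, ‖b i‖ ≤ r) :
    ∃ T : H →L[ℂ] H, ∀ v w : H, Tendsto (fun i => ⟪b i v, w⟫_ℂ) U (𝓝 ⟪T v, w⟫_ℂ) := by
  have hbound : ∀ v w i, ‖⟪b i v, w⟫_ℂ‖ ≤ r * ‖v‖ * ‖w‖ := fun v w i =>
    (norm_inner_le_norm _ _).trans <| mul_le_mul_of_nonneg_right
      (((b i).le_opNorm v).trans (mul_le_mul_of_nonneg_right (hb i) (norm_nonneg _)))
      (norm_nonneg _)
  have hlim : ∀ v w : H, ∃ l, ‖l‖ ≤ r * ‖v‖ * ‖w‖ ∧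
      Tendsto (fun i => ⟪b i v, w⟫_ℂ) U (𝓝 l) := fun v w => by
    obtain ⟨l, hl, h⟩ := (isCompact_closedBall (0 : ℂ) (r * ‖v‖ * ‖w‖)).ultrafilter_le_nhds
      (U.map fun i => ⟪b i v, w⟫_ℂ) (by
        rw [le_principal_iff]
        exact Filter.eventually_map.2 (.of_forall fun i => by simpa using hbound v w i))
    exact ⟨l, by simpa using hl, h⟩
  choose l hl hlt using hlim
  let B : H →ₗ⋆[ℂ] H →ₗ[ℂ] ℂ := LinearMap.mk₂'ₛₗ (starRingEnd ℂ) (RingHom.id ℂ) l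
    (fun v v' w => tendsto_nhds_unique (hlt _ _) (by
      simpa [inner_add_left] using (hlt v w).add (hlt v' w)))
    (fun c v w => tendsto_nhds_unique (hlt _ _) (by
      simpa [inner_smul_left, mul_comm] using (hlt v w).const_mul (starRingEnd ℂ c)))
    (fun v w w' => tendsto_nhds_unique (hlt _ _) (by
      simpa [inner_add_right] using (hlt v w).add (hlt v w')))
    (fun c v w => tendsto_nhds_unique (hlt _ _) (by
      simpa [inner_smul_right] using (hlt v w).const_mul c))
  refine ⟨InnerProductSpace.continuousLinearMapOfBilin (B.mkContinuous₂ r fun v w => hl v w),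
    fun v w => ?_⟩
  rw [InnerProductSpace.continuousLinearMapOfBilin_apply]
  exact hlt v w

/-- Commutation with a fixed operator of the commutant survives weak limits. -/
theorem VonNeumannAlgebra.mem_of_weak_limit {α : Type*} {l : Filter α} [l.NeBot]
    {N : VonNeumannAlgebra H} {b : α → H →L[ℂ] H} {T : H →L[ℂ] H} (hb : ∀ i, b i ∈ N)
    (h : ∀ v w : H, Tendsto (fun i => ⟪b i v, w⟫_ℂ) l (𝓝 ⟪T v, w⟫_ℂ)) : T ∈ N := by
  refine mem_of_commute fun S hS => ContinuousLinearMap.ext fun v => ext_inner_right ℂ fun w => ?_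
  refine tendsto_nhds_unique (f := fun i => ⟪(S * b i) v, w⟫_ℂ) (l := l) ?_ ?_
  · have := h v (ContinuousLinearMap.adjoint S w)
    simpa [ContinuousLinearMap.adjoint_inner_right] using this
  · have := h (S v) w
    simp only [← commute_of_mem (hb _) hS]
    exact this

namespace IsFaithfulNormalTracialState

variable {M : VonNeumannAlgebra H} {τ : M.toStarSubalgebra →ₗ[ℂ] ℂ}
  (hτ : IsFaithfulNormalTracialState M τ)
include hτ

theorem isTracialState : IsTracialState τ := ⟨hτ.map_one, hτ.nonneg, hτ.tracial⟩

theorem eq_zero_of_twoNorm {a : M.toStarSubalgebra} (h : twoNorm τ a = 0) : a = 0 := by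
  refine hτ.faithful a ?_
  rw [hτ.isTracialState.map_star_mul_self, h]
  simp

/-- On bounded sets `τ` is continuous in the weak operator topology. -/
theorem tendsto_of_weak_limit {α : Type*} {l : Filter α} {b : α → M.toStarSubalgebra}
    {T : M.toStarSubalgebra} {r : ℝ} (hb : ∀ i, ‖b i‖ ≤ r)
    (h : ∀ v w : H, Tendsto (fun i => ⟪(b i : H →L[ℂ] H) v, w⟫_ℂ) l
      (𝓝 ⟪(T : H →L[ℂ] H) v, w⟫_ℂ)) (d : M.toStarSubalgebra) :
    Tendsto (fun i => τ (b i * d)) l (𝓝 (τ (T * d))) := by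
  obtain ⟨ξ, η, hξ, hη, hsum⟩ := hτ.normal
  have h1 : (fun i => τ (b i * d)) =
      fun i => ∑' m, ⟪ξ m, ((b i * d : M.toStarSubalgebra) : H →L[ℂ] H) (η m)⟫_ℂ :=
    funext fun i => (hsum _).tsum_eq.symm
  rw [h1, ← (hsum (T * d)).tsum_eq]
  refine tendsto_tsum_of_dominated_convergence
    (bound := fun m => r * ‖d‖ * (‖ξ m‖ ^ 2 + ‖η m‖ ^ 2)) ?_ (fun m => ?_) (.of_forall fun i m => ?_)
  · exact (hξ.add hη).mul_left _
  · have := (h ((d : H →L[ℂ] H) (η m)) (ξ m)).star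
    simpa using this
  · have hr : 0 ≤ r := (norm_nonneg _).trans (hb i)
    refine (norm_inner_le_norm _ _).trans ?_
    have h2 : ‖((b i * d : M.toStarSubalgebra) : H →L[ℂ] H) (η m)‖ ≤ r * ‖d‖ * ‖η m‖ := by
      refine (ContinuousLinearMap.le_opNorm _ _).trans ?_
      refine mul_le_mul_of_nonneg_right ?_ (norm_nonneg _)
      exact (norm_mul_le (b i) d).trans (mul_le_mul_of_nonneg_right (hb i) (norm_nonneg _))
    refine (mul_le_mul_of_nonneg_left h2 (norm_nonneg _)).trans ?_
    have h3 : 0 ≤ r * ‖d‖ := by positivity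
    nlinarith [mul_le_mul_of_nonneg_left (two_mul_le_add_sq ‖ξ m‖ ‖η m‖) h3,
      mul_nonneg h3 (mul_nonneg (norm_nonneg (ξ m)) (norm_nonneg (η m)))]

/-- A sequence in `P` minimizing the 2-distance to `a` can be made self-adjoint and truncated to
norm at most `‖a‖` without losing distance. Boundedness then gives a weak limit in `P` itself, not
merely in its 2-norm completion. -/
theorem exists_condExp_of_isSelfAdjoint {P : VonNeumannAlgebra H} (hPM : P ≤ M)
    {a : M.toStarSubalgebra} (ha : IsSelfAdjoint a) :
    ∃ b : M.toStarSubalgebra, (b : H →L[ℂ] H) ∈ P ∧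
      ∀ c : M.toStarSubalgebra, (c : H →L[ℂ] H) ∈ P → τ (b * c) = τ (a * c) := by
  have hφ := hτ.isTracialState
  set D : Set ℝ := {t | ∃ c : M.toStarSubalgebra, (c : H →L[ℂ] H) ∈ P ∧ twoNorm τ (a - c) = t}
  have hD0 : ∀ t ∈ D, 0 ≤ t := by
    rintro _ ⟨c, -, rfl⟩
    exact IsTracialState.twoNorm_nonneg _
  have hDb : BddBelow D := ⟨0, hD0⟩
  have hDne : D.Nonempty := ⟨_, 0, zero_mem P, rfl⟩
  set d := sInf D
  have hd0 : 0 ≤ d := le_csInf hDne hD0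
  have hseq : ∀ k : ℕ, ∃ b : M.toStarSubalgebra, (b : H →L[ℂ] H) ∈ P ∧ IsSelfAdjoint b ∧
      ‖b‖ ≤ ‖a‖ ∧ twoNorm τ (a - b) < d + 1 / ((k : ℝ) + 1) := fun k => by
    obtain ⟨_, ⟨c, hcP, rfl⟩, hc⟩ := exists_lt_of_csInf_lt hDne
      (lt_add_of_pos_right d (Nat.one_div_pos_of_nat (n := k) (α := ℝ)))
    set c' : M.toStarSubalgebra := (2⁻¹ : ℂ) • (c + star c) with hc'
    have hc's : IsSelfAdjoint c' := by
      rw [hc', IsSelfAdjoint, star_smul, star_add, star_star, add_comm]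
      simp
    have hc'P : (c' : H →L[ℂ] H) ∈ P := P.smul_mem _ (add_mem hcP (star_mem hcP))
    have hac' : twoNorm τ (a - c') ≤ twoNorm τ (a - c) := by
      have h : a - c' = (2⁻¹ : ℂ) • ((a - c) + star (a - c)) := by
        rw [star_sub, ha.star_eq, sub_add_sub_comm, smul_sub, ← two_smul ℂ a, smul_smul]
        simp [hc']
      have h2 := hφ.twoNorm_add_le (a - c) (star (a - c))
      rw [hφ.twoNorm_star] at h2
      rw [h, hφ.twoNorm_smul, norm_inv, Complex.norm_ofNat]
      linarith
    refine ⟨cfc (fun t => max (-‖a‖) (min t ‖a‖)) c', ?_, IsSelfAdjoint.cfc,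
      norm_cfc_clamp_le _ (norm_nonneg _),
      (hφ.twoNorm_sub_cfc_clamp_le ha hc's le_rfl).trans_lt (hac'.trans_lt hc)⟩
    rw [VonNeumannAlgebra.coe_cfc hc's (by fun_prop)]
    exact VonNeumannAlgebra.cfc_mem hc'P _
  choose b hbP hbs hbn hbd using hseq
  have horth : ∀ c : M.toStarSubalgebra, (c : H →L[ℂ] H) ∈ P →
      Tendsto (fun k => τ ((a - b k) * c)) atTop (𝓝 0) := fun c hc => by
    -- With `w = τ((a - b k) c)`, moving `b k` by `s⁻¹ w̄ c` lowers the squared distance to `a` by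
    -- at least `‖w‖² / s`. The infimum `d` therefore bounds `w`. The summand `1` keeps `s`
    -- invertible when `c` has 2-norm zero.
    set s : ℝ := twoNorm τ c ^ 2 + 1 with hs
    have hs1 : 0 < s := by positivity
    have key : ∀ k, ‖τ ((a - b k) * c)‖ ^ 2 ≤ (twoNorm τ (a - b k) ^ 2 - d ^ 2) * s := fun k => by
      set w := τ ((a - b k) * c) with hw
      have h1 : d ≤ twoNorm τ (a - (b k + ((s⁻¹ : ℝ) * star w : ℂ) • c)) :=
        csInf_le hDb ⟨_, add_mem (hbP k) (P.smul_mem _ hc), rfl⟩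
      rw [← sub_sub, sub_eq_add_neg (a - b k), ← neg_smul] at h1
      have h2 := pow_le_pow_left₀ hd0 h1 2
      rw [hφ.twoNorm_add_sq, star_sub, ha.star_eq, (hbs k).star_eq, mul_smul_comm, map_smul, ← hw,
        hφ.twoNorm_smul, mul_pow, norm_neg, norm_mul, norm_star, smul_eq_mul, neg_mul, mul_assoc,
        Complex.star_def, Complex.conj_mul', Complex.norm_real, Real.norm_eq_abs,
        abs_of_pos (inv_pos.2 hs1), ← Complex.ofReal_pow, ← Complex.ofReal_mul,
        ← Complex.ofReal_neg, Complex.ofReal_re] at h2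
      have h3 : twoNorm τ c ^ 2 = s - 1 := by rw [hs]; ring
      rw [h3] at h2
      have h4 : (s⁻¹ * ‖w‖) ^ 2 * (s - 1) = s⁻¹ * ‖w‖ ^ 2 - s⁻¹ ^ 2 * ‖w‖ ^ 2 := by
        field_simp
      have h5 : 0 ≤ s⁻¹ ^ 2 * ‖w‖ ^ 2 := by positivity
      have h6 : s⁻¹ * ‖w‖ ^ 2 ≤ twoNorm τ (a - b k) ^ 2 - d ^ 2 := by linarith
      rwa [inv_mul_le_iff₀ hs1, mul_comm s] at h6
    have hlim : Tendsto (fun k => twoNorm τ (a - b k)) atTop (𝓝 d) := by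
      refine tendsto_of_tendsto_of_tendsto_of_le_of_le tendsto_const_nhds
        (by simpa using tendsto_const_nhds.add (tendsto_one_div_add_atTop_nhds_zero_nat (𝕜 := ℝ)))
        (fun k => csInf_le hDb ⟨b k, hbP k, rfl⟩) (fun k => (hbd k).le)
    have hlim2 : Tendsto (fun k => (twoNorm τ (a - b k) ^ 2 - d ^ 2) * s) atTop (𝓝 0) := by
      have := ((hlim.pow 2).sub_const (d ^ 2)).mul_const s
      rwa [sub_self, zero_mul] at this
    have hlim3 : Tendsto (fun k => ‖τ ((a - b k) * c)‖ ^ 2) atTop (𝓝 0) :=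
      squeeze_zero (fun k => by positivity) key hlim2
    have hlim4 := hlim3.sqrt
    simp only [Real.sqrt_sq (norm_nonneg _), Real.sqrt_zero] at hlim4
    exact tendsto_zero_iff_norm_tendsto_zero.2 hlim4
  obtain ⟨T, hT⟩ := exists_weak_limit (hyperfilter ℕ) (fun k => (b k : H →L[ℂ] H)) hbn
  have hTP : T ∈ P := VonNeumannAlgebra.mem_of_weak_limit hbP hT
  refine ⟨⟨T, hPM hTP⟩, hTP, fun c hc => ?_⟩
  have h1 := hτ.tendsto_of_weak_limit (T := ⟨T, hPM hTP⟩) hbn hT c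
  have h2 := (horth c hc).mono_left (Nat.hyperfilter_le_atTop)
  have h3 := h1.add h2
  simp only [← map_add, ← add_mul, add_sub_cancel, add_zero] at h3
  exact tendsto_nhds_unique h3 tendsto_const_nhds

theorem exists_condExp {P : VonNeumannAlgebra H} (hPM : P ≤ M) (a : M.toStarSubalgebra) :
    ∃ b : M.toStarSubalgebra, (b : H →L[ℂ] H) ∈ P ∧
      ∀ c : M.toStarSubalgebra, (c : H →L[ℂ] H) ∈ P → τ (b * c) = τ (a * c) := by
  obtain ⟨b, hb, hb'⟩ := hτ.exists_condExp_of_isSelfAdjoint hPM (realPart a).2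
  obtain ⟨c, hc, hc'⟩ := hτ.exists_condExp_of_isSelfAdjoint hPM (imaginaryPart a).2
  refine ⟨b + Complex.I • c, add_mem hb (P.smul_mem _ hc), fun d hd => ?_⟩
  conv_rhs => rw [← realPart_add_I_smul_imaginaryPart a]
  simp only [add_mul, map_add, smul_mul_assoc, map_smul, hb' d hd, hc' d hd]

theorem condExpTr_mem {P : VonNeumannAlgebra H} (hPM : P ≤ M) (a : M.toStarSubalgebra) :
    (condExpTr τ P a : H →L[ℂ] H) ∈ P := by
  obtain ⟨b, hb, hb'⟩ := hτ.exists_condExp hPM a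
  rwa [condExpTr_eq hτ hb hb']

theorem map_condExpTr_mul {P : VonNeumannAlgebra H} (hPM : P ≤ M) (a : M.toStarSubalgebra)
    {c : M.toStarSubalgebra} (hc : (c : H →L[ℂ] H) ∈ P) :
    τ (condExpTr τ P a * c) = τ (a * c) := by
  obtain ⟨b, hb, hb'⟩ := hτ.exists_condExp hPM a
  rw [condExpTr_eq hτ hb hb', hb' c hc]

theorem twoNorm_sub_sq_eq {P : VonNeumannAlgebra H} (hPM : P ≤ M) (a : M.toStarSubalgebra)
    {c : M.toStarSubalgebra} (hc : (c : H →L[ℂ] H) ∈ P) :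
    twoNorm τ (a - c) ^ 2 =
      twoNorm τ (a - condExpTr τ P a) ^ 2 + twoNorm τ (condExpTr τ P a - c) ^ 2 := by
  have hφ := hτ.isTracialState
  have h := hφ.twoNorm_add_sq (condExpTr τ P a - c) (a - condExpTr τ P a)
  have h0 : (star (condExpTr τ P a - c) : M.toStarSubalgebra).1 ∈ P :=
    star_mem (sub_mem (hτ.condExpTr_mem hPM a) hc)
  rw [hφ.tracial, sub_mul, map_sub, hτ.map_condExpTr_mul hPM a h0, sub_self,
    sub_add_sub_cancel'] at h
  rw [h]
  simp only [Complex.zero_re]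
  ring

theorem twoNorm_sub_condExpTr_sq {P : VonNeumannAlgebra H} (hPM : P ≤ M)
    (a : M.toStarSubalgebra) :
    twoNorm τ (a - condExpTr τ P a) ^ 2 = twoNorm τ a ^ 2 - twoNorm τ (condExpTr τ P a) ^ 2 := by
  have := hτ.twoNorm_sub_sq_eq hPM a (c := 0) (zero_mem P)
  rw [sub_zero, sub_zero] at this
  linarith

theorem twoNorm_sub_condExpTr_le {P : VonNeumannAlgebra H} (hPM : P ≤ M)
    (a : M.toStarSubalgebra) {c : M.toStarSubalgebra} (hc : (c : H →L[ℂ] H) ∈ P) :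
    twoNorm τ (a - condExpTr τ P a) ≤ twoNorm τ (a - c) := by
  refine abs_le_of_sq_le_sq' ?_ (IsTracialState.twoNorm_nonneg _) |>.2
  rw [hτ.twoNorm_sub_sq_eq hPM a hc]
  linarith [sq_nonneg (twoNorm τ (condExpTr τ P a - c))]

/-- A von Neumann subalgebra is closed in 2-norm. -/
theorem mem_of_forall_twoNorm_sub_le {P : VonNeumannAlgebra H} (hPM : P ≤ M)
    (a : M.toStarSubalgebra)
    (h : ∀ ε : ℝ, 0 < ε → ∃ c : M.toStarSubalgebra, (c : H →L[ℂ] H) ∈ P ∧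
      twoNorm τ (a - c) ≤ ε) : (a : H →L[ℂ] H) ∈ P := by
  have h0 : twoNorm τ (a - condExpTr τ P a) = 0 := by
    refine le_antisymm (le_of_forall_pos_le_add fun ε hε => ?_) (IsTracialState.twoNorm_nonneg _)
    obtain ⟨c, hc, hac⟩ := h ε hε
    linarith [hτ.twoNorm_sub_condExpTr_le hPM a hc]
  rw [sub_eq_zero.1 (hτ.eq_zero_of_twoNorm h0)]
  exact hτ.condExpTr_mem hPM a

end IsFaithfulNormalTracialState

end VonNeumann

section Density

variable {H : Type*} [NormedAddCommGroup H] [InnerProductSpace ℂ H] [CompleteSpace H]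

attribute [local instance] VonNeumannAlgebra.cstarAlgebra

/-! ### Density of non-commutative polynomials -/

omit [CompleteSpace H] in
theorem memℓp_amplification {α : Type*} (T : H →L[ℂ] H) (v : lp (fun _ : α => H) 2) :
    Memℓp (fun i => T (v i)) 2 := by
  refine memℓp_gen ?_
  have hv := (lp.memℓp v).summable (by norm_num)
  refine Summable.of_nonneg_of_le (fun i => by positivity) (fun i => ?_)
    (hv.mul_left (‖T‖ ^ (2 : ENNReal).toReal))
  rw [← Real.mul_rpow (norm_nonneg _) (norm_nonneg _)]
  exact Real.rpow_le_rpow (norm_nonneg _) (T.le_opNorm _) (by norm_num)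

/-- The diagonal action of an operator on a multiple of the Hilbert space. -/
def amplification (α : Type*) (T : H →L[ℂ] H) :
    lp (fun _ : α => H) 2 →L[ℂ] lp (fun _ : α => H) 2 :=
  LinearMap.mkContinuous
    { toFun := fun v => ⟨fun i => T (v i), memℓp_amplification T v⟩
      map_add' := fun v w => by ext i; exact map_add T _ _
      map_smul' := fun c v => by ext i; exact map_smul T _ _ } ‖T‖ fun v => by
    refine lp.norm_le_of_tsum_le (by norm_num) (by positivity) ?_
    rw [Real.mul_rpow (norm_nonneg _) (norm_nonneg _), lp.norm_rpow_eq_tsum (by norm_num) v,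
      ← tsum_mul_left]
    have hv := (lp.memℓp v).summable (by norm_num)
    refine Summable.tsum_le_tsum (fun i => ?_)
      ((memℓp_amplification T v).summable (by norm_num)) (hv.mul_left _)
    rw [← Real.mul_rpow (norm_nonneg _) (norm_nonneg _)]
    exact Real.rpow_le_rpow (norm_nonneg _) (T.le_opNorm _) (by norm_num)

omit [CompleteSpace H] in
@[simp] theorem amplification_apply {α : Type*} (T : H →L[ℂ] H) (v : lp (fun _ : α => H) 2)
    (i : α) : amplification α T v i = T (v i) := rfl

theorem inner_amplification {α : Type*} {T : H →L[ℂ] H} (hT : IsSelfAdjoint T)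
    (v w : lp (fun _ : α => H) 2) :
    ⟪amplification α T v, w⟫_ℂ = ⟪v, amplification α T w⟫_ℂ := by
  simp only [lp.inner_eq_tsum, amplification_apply]
  refine tsum_congr fun i => ?_
  have := ContinuousLinearMap.adjoint_inner_left T (w i) (v i)
  rwa [← ContinuousLinearMap.star_eq_adjoint, hT.star_eq] at this

theorem amplification_single {α : Type*} [DecidableEq α] (T : H →L[ℂ] H) (i : α) (v : H) :
    amplification α T (lp.single 2 i v) = lp.single 2 i (T v) := by
  ext j
  rw [amplification_apply]
  rcases eq_or_ne j i with rfl | h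
  · rw [lp.single_apply_self, lp.single_apply_self]
  · rw [lp.single_apply_ne _ _ _ h, lp.single_apply_ne _ _ _ h, map_zero]

/-- The double commutant theorem for countable multiples: an element of the generated von Neumann
algebra is approximated by polynomials on a square summable family of vectors. -/
theorem exists_lift_norm_amplification_sub_le {α ι : Type*} {x : ι → H →L[ℂ] H}
    {N : VonNeumannAlgebra H} (hx : Generates x N) {y : H →L[ℂ] H} (hy : y ∈ N)
    (ζ : lp (fun _ : α => H) 2) {ε : ℝ} (hε : 0 < ε) :
    ∃ p : FreeAlgebra ℂ ι,
      ‖amplification α (FreeAlgebra.lift ℂ x p) ζ - amplification α y ζ‖ < ε := by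
  classical
  let V₀ : Submodule ℂ (lp (fun _ : α => H) 2) :=
    { carrier := Set.range fun p => amplification α (FreeAlgebra.lift ℂ x p) ζ
      add_mem' := by
        rintro _ _ ⟨p, rfl⟩ ⟨q, rfl⟩
        exact ⟨p + q, by ext i; simp⟩
      zero_mem' := ⟨0, by ext i; simp⟩
      smul_mem' := by
        rintro c _ ⟨p, rfl⟩
        exact ⟨c • p, by ext i; simp⟩ }
  let V := V₀.topologicalClosure
  have hVc : IsClosed (V : Set (lp (fun _ : α => H) 2)) := V₀.isClosed_topologicalClosure
  have : CompleteSpace V := hVc.completeSpace_coe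
  have hinv : ∀ i, ∀ v ∈ V, amplification α (x i) v ∈ V := fun i v hv => by
    refine map_mem_closure (amplification α (x i)).continuous hv ?_
    rintro _ ⟨p, rfl⟩
    exact ⟨FreeAlgebra.ι ℂ i * p, by ext j; simp⟩
  have hcomm : ∀ i v, V.starProjection (amplification α (x i) v) =
      amplification α (x i) (V.starProjection v) := fun i v => by
    refine Submodule.eq_starProjection_of_mem_orthogonal (hinv i _ (V.starProjection_apply_mem v))
      ?_
    rw [← map_sub, Submodule.mem_orthogonal]
    intro w hw
    rw [← inner_amplification (hx.1 i)]
    exact (Submodule.mem_orthogonal _ _).1 (V.sub_starProjection_mem_orthogonal v) _ (hinv i w hw)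
  -- These are the matrix entries of the projection onto `V`, the closure of the polynomials applied
  -- to `ζ`. The projection commutes with the amplified `x i`, so its entries lie in the commutant
  -- of the `x i` and commute with `y`.
  let E (m n : α) : H →L[ℂ] H := (lp.evalCLM ℂ (fun _ : α => H) 2 m).comp
    (V.starProjection.comp (lp.singleContinuousLinearMap ℂ (fun _ : α => H) 2 n))
  have hE : ∀ m n v, E m n v = V.starProjection (lp.single 2 n v) m := fun m n v => rfl
  have hyE : ∀ m n, E m n * y = y * E m n := fun m n => by
    have hy' : y ∈ Set.centralizer (Set.centralizer (Set.range x)) := by rw [hx.2]; exact hy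
    refine hy' _ ?_
    rintro _ ⟨i, rfl⟩
    ext v
    simp only [mul_apply_eq_comp, hE]
    rw [← amplification_single, hcomm, amplification_apply]
  have hζ : V.starProjection (amplification α y ζ) = amplification α y (V.starProjection ζ) := by
    have h1 := lp.hasSum_single (p := 2) (by norm_num) ζ
    have h2 := ((h1.mapL (amplification α y)).mapL V.starProjection)
    have h3 := ((h1.mapL V.starProjection).mapL (amplification α y))
    have h4 : (fun n => V.starProjection (amplification α y (lp.single 2 n (ζ n)))) =
        fun n => amplification α y (V.starProjection (lp.single 2 n (ζ n))) := by
      funext n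
      ext m
      rw [amplification_single, amplification_apply, ← hE, ← hE]
      exact congrArg (fun T : H →L[ℂ] H => T (ζ n)) (hyE m n)
    rw [h4] at h2
    exact h2.unique h3
  have hζV : ζ ∈ V := V₀.le_topologicalClosure ⟨1, by ext i; simp⟩
  have hyV : amplification α y ζ ∈ V := by
    rw [← V.starProjection_eq_self_iff, hζ, V.starProjection_eq_self_iff.2 hζV]
  obtain ⟨_, ⟨p, rfl⟩, hp⟩ := Metric.mem_closure_iff.1 hyV ε hε
  exact ⟨p, by rwa [dist_comm, dist_eq_norm] at hp⟩

variable {M : VonNeumannAlgebra H} {τ : M.toStarSubalgebra →ₗ[ℂ] ℂ}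

theorem coe_lift {ι : Type*} (x : ι → M.toStarSubalgebra) (p : FreeAlgebra ℂ ι) :
    ((FreeAlgebra.lift ℂ x p : M.toStarSubalgebra) : H →L[ℂ] H) =
      FreeAlgebra.lift ℂ (fun i => (x i : H →L[ℂ] H)) p :=
  map_lift M.toStarSubalgebra.subtype.toAlgHom x p

-- Cauchy–Schwarz term by term. By normality `‖D‖₂²` is a sum of terms `⟪D ξ, D η⟫`, so it is
-- controlled by the action of `D` on the single vector `ξ ⊕ η` of the amplified space.
omit [CompleteSpace H] in
theorem tsum_inner_le {w : ℕ ⊕ ℕ → H} (hw : Summable fun i => ‖w i‖ ^ 2) {t : ℝ}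
    (h : HasSum (fun m => (⟪w (Sum.inl m), w (Sum.inr m)⟫_ℂ).re) t) : t ≤ ∑' i, ‖w i‖ ^ 2 := by
  have hinl : Summable fun m => ‖w (Sum.inl m)‖ ^ 2 :=
    hw.comp_injective (i := Sum.inl) Sum.inl_injective
  have hinr : Summable fun m => ‖w (Sum.inr m)‖ ^ 2 :=
    hw.comp_injective (i := Sum.inr) Sum.inr_injective
  have h2 : HasSum (fun i => ‖w i‖ ^ 2)
      (∑' m, ‖w (Sum.inl m)‖ ^ 2 + ∑' m, ‖w (Sum.inr m)‖ ^ 2) :=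
    HasSum.sum (f := fun i => ‖w i‖ ^ 2) hinl.hasSum hinr.hasSum
  rw [h2.tsum_eq]
  refine hasSum_le (fun m => ?_) h (hinl.hasSum.add hinr.hasSum)
  refine (Complex.re_le_norm _).trans ((norm_inner_le_norm _ _).trans ?_)
  nlinarith [two_mul_le_add_sq ‖w (Sum.inl m)‖ ‖w (Sum.inr m)‖, sq_nonneg ‖w (Sum.inl m)‖,
    sq_nonneg ‖w (Sum.inr m)‖]

/-- Polynomials in generators are dense in 2-norm. -/
theorem IsFaithfulNormalTracialState.exists_lift_twoNorm_sub_lt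
    (hτ : IsFaithfulNormalTracialState M τ) {ι : Type*} {x : ι → M.toStarSubalgebra}
    {N : VonNeumannAlgebra H} (hx : Generates (fun i => (x i : H →L[ℂ] H)) N)
    {y : M.toStarSubalgebra} (hy : (y : H →L[ℂ] H) ∈ N) {ε : ℝ} (hε : 0 < ε) :
    ∃ p : FreeAlgebra ℂ ι, twoNorm τ (FreeAlgebra.lift ℂ x p - y) < ε := by
  obtain ⟨ξ, η, hξ, hη, hsum⟩ := hτ.normal
  have hmem : Memℓp (Sum.elim ξ η) 2 := by
    refine memℓp_gen ?_
    simp only [ENNReal.toReal_ofNat, Real.rpow_ofNat]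
    exact Summable.sum (f := fun i => ‖Sum.elim ξ η i‖ ^ 2) hξ hη
  set ζ : lp (fun _ : ℕ ⊕ ℕ => H) 2 := ⟨Sum.elim ξ η, hmem⟩ with hζ
  obtain ⟨p, hp⟩ := exists_lift_norm_amplification_sub_le hx hy ζ hε
  refine ⟨p, ?_⟩
  set D := FreeAlgebra.lift ℂ x p - y with hD
  have hamp : amplification (ℕ ⊕ ℕ) (FreeAlgebra.lift ℂ (fun i => (x i : H →L[ℂ] H)) p) ζ -
      amplification (ℕ ⊕ ℕ) (y : H →L[ℂ] H) ζ = amplification (ℕ ⊕ ℕ) (D : H →L[ℂ] H) ζ := by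
    ext i
    rw [← coe_lift]
    simp [hD]
  rw [hamp] at hp
  set w : ℕ ⊕ ℕ → H := fun i => (D : H →L[ℂ] H) (Sum.elim ξ η i) with hw
  have hwsum : Summable fun i => ‖w i‖ ^ 2 := by
    have := (lp.memℓp (amplification (ℕ ⊕ ℕ) (D : H →L[ℂ] H) ζ)).summable (by norm_num)
    simpa using this
  have hwnorm : ‖amplification (ℕ ⊕ ℕ) (D : H →L[ℂ] H) ζ‖ ^ 2 = ∑' i, ‖w i‖ ^ 2 := by
    have := lp.norm_rpow_eq_tsum (p := 2) (by norm_num) (amplification (ℕ ⊕ ℕ) (D : H →L[ℂ] H) ζ)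
    simpa using this
  have h1 : HasSum (fun m => (⟪w (Sum.inl m), w (Sum.inr m)⟫_ℂ).re) (twoNorm τ D ^ 2) := by
    rw [← hτ.isTracialState.re_map_star_mul_self]
    convert! Complex.hasSum_re (hsum (star D * D)) using 3 with m
    have : ((star D * D : M.toStarSubalgebra) : H →L[ℂ] H) =
        ContinuousLinearMap.adjoint (D : H →L[ℂ] H) * (D : H →L[ℂ] H) := rfl
    rw [this, mul_apply_eq_comp, ContinuousLinearMap.adjoint_inner_right]
    rfl
  have h2 := (tsum_inner_le hwsum h1).trans_eq hwnorm.symm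
  exact (abs_le_of_sq_le_sq' h2 (norm_nonneg _)).2.trans_lt hp

open scoped Matrix.Norms.L2Operator in
/-- A version of Kaplansky's density theorem: a self-adjoint element of norm less than `r` is
approximated in 2-norm by polynomials that are bounded by `r` on all tuples of matrices subject to
given norm bounds. -/
theorem IsFaithfulNormalTracialState.exists_bounded_lift_twoNorm_sub_lt
    (hτ : IsFaithfulNormalTracialState M τ) {ι : Type*} {x : ι → M.toStarSubalgebra}
    {N : VonNeumannAlgebra H} (hx : Generates (fun i => (x i : H →L[ℂ] H)) N) {R : ι → ℝ}
    (hR : ∀ i, ‖x i‖ ≤ R i) {y : M.toStarSubalgebra} (hy : (y : H →L[ℂ] H) ∈ N)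
    (hys : IsSelfAdjoint y) {r : ℝ} (hr : ‖y‖ < r) {ε : ℝ} (hε : 0 < ε) :
    ∃ q : FreeAlgebra ℂ ι, twoNorm τ (FreeAlgebra.lift ℂ x q - y) < ε ∧
      IsSelfAdjoint (FreeAlgebra.lift ℂ x q) ∧ ‖FreeAlgebra.lift ℂ x q‖ ≤ r ∧
      ∀ n : ℕ, 0 < n → ∀ a : ι → Mat n, (∀ i, IsSelfAdjoint (a i)) → (∀ i, opNorm (a i) ≤ R i) →
        IsSelfAdjoint (FreeAlgebra.lift ℂ a q) ∧ opNorm (FreeAlgebra.lift ℂ a q) ≤ r := by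
  have hφ := hτ.isTracialState
  have hxs : ∀ i, IsSelfAdjoint (x i) := fun i => Subtype.ext (hx.1 i)
  obtain ⟨p, hp⟩ := hτ.exists_lift_twoNorm_sub_lt hx hy (half_pos hε)
  obtain ⟨C₁, _, -, h₁⟩ := exists_bound_lift_mat R (ncRe p)
  obtain ⟨C₂, _, -, h₂⟩ := exists_bound_lift (κ := Unit) (A := fun _ => M.toStarSubalgebra)
    (φ := fun _ => τ) (fun _ => hφ) R (ncRe p)
  -- `C` bounds the self-adjoint part of `p` at `x` and at matrix tuples of every size, so
  -- approximating the truncation on `[-C, C]` by a polynomial settles all cases at once.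
  set C := max C₁ C₂
  set r' := ‖y‖
  have hr' : 0 ≤ r' := norm_nonneg _
  -- The truncation is at `‖y‖ < r`; the slack `r - ‖y‖` absorbs the overshoot of the approximating
  -- polynomial.
  set δ := min (ε / 2) (r - r') with hδ
  have hδ0 : 0 < δ := lt_min (half_pos hε) (sub_pos.2 hr)
  obtain ⟨q, hq⟩ := exists_polynomial_near_clamp r' C hδ0
  have key : ∀ {A : Type _} [CStarAlgebra A] (c : A), IsSelfAdjoint c → ‖c‖ ≤ C →
      ‖Polynomial.aeval c q‖ ≤ r ∧
        ‖Polynomial.aeval c q - cfc (fun t => max (-r') (min t r')) c‖ ≤ δ := by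
    intro A _ c hc hcC
    have h := norm_aeval_sub_cfc_le hc (f := fun t => max (-r') (min t r')) (by fun_prop) hδ0.le
      hcC fun t ht => (hq t ht).le
    refine ⟨?_, h⟩
    have h2 := norm_cfc_clamp_le c hr'
    have h3 := norm_le_norm_add_norm_sub' (Polynomial.aeval c q)
      (cfc (fun t => max (-r') (min t r')) c)
    have h4 : δ ≤ r - r' := min_le_right _ _
    linarith
  -- The same bound in the universe of the matrix algebras; `key` is applied in that of `M`.
  have key' : ∀ {A : Type} [CStarAlgebra A] (c : A), IsSelfAdjoint c → ‖c‖ ≤ C →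
      ‖Polynomial.aeval c q‖ ≤ r := by
    intro A _ c hc hcC
    have h := norm_aeval_sub_cfc_le hc (f := fun t => max (-r') (min t r')) (by fun_prop) hδ0.le
      hcC fun t ht => (hq t ht).le
    have h2 := norm_cfc_clamp_le c hr'
    have h3 := norm_le_norm_add_norm_sub' (Polynomial.aeval c q)
      (cfc (fun t => max (-r') (min t r')) c)
    have h4 : δ ≤ r - r' := min_le_right _ _
    linarith
  set c := FreeAlgebra.lift ℂ x (ncRe p)
  have hcs : IsSelfAdjoint c := isSelfAdjoint_lift_ncRe hxs p
  have hcC : ‖c‖ ≤ C := ((h₂ () x hR).1).trans (le_max_right _ _)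
  refine ⟨ncComp q p, ?_, ?_, ?_, fun n hn a ha haR => ?_⟩
  · rw [lift_ncComp]
    have h1 := hφ.twoNorm_sub_cfc_clamp_le hys hcs (le_refl r')
    rw [hφ.twoNorm_sub_comm y c, hφ.twoNorm_sub_comm y (cfc _ c)] at h1
    have h2 := hφ.twoNorm_ncRe_sub_le hxs hys p
    have h3 := (hφ.twoNorm_le_norm _).trans (key c hcs hcC).2
    have h4 := hφ.twoNorm_sub_le_sub_add_sub (Polynomial.aeval c q)
      (cfc (fun t => max (-r') (min t r')) c) y
    have h5 : δ ≤ ε / 2 := min_le_left _ _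
    linarith
  · rw [lift_ncComp]
    exact isSelfAdjoint_aeval hcs q
  · rw [lift_ncComp]
    exact (key c hcs hcC).1
  · have has := isSelfAdjoint_lift_ncRe ha p
    rw [lift_ncComp]
    exact ⟨isSelfAdjoint_aeval has q,
      key' _ has (((h₁ n hn a haR).1).trans (le_max_left _ _))⟩

end Density

/-! ### Partitions of unity by projections of small trace -/

section Partition

variable {H : Type*} [NormedAddCommGroup H] [InnerProductSpace ℂ H] [CompleteSpace H]

attribute [local instance] VonNeumannAlgebra.cstarAlgebra

variable {M : VonNeumannAlgebra H} {τ : M.toStarSubalgebra →ₗ[ℂ] ℂ}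

/-- `q` is a projection of `M` that lies in `N` and in `P`. -/
structure IsProjIn (N P : VonNeumannAlgebra H) (q : M.toStarSubalgebra) : Prop where
  proj : IsStarProjection q
  left : (q : H →L[ℂ] H) ∈ N
  right : (q : H →L[ℂ] H) ∈ P

namespace IsProjIn

variable {N P : VonNeumannAlgebra H} {p q : M.toStarSubalgebra}

theorem mul_eq_of_mul_eq (hp : IsSelfAdjoint p) (hq : IsSelfAdjoint q) (h : p * q = q) :
    q * p = q := by
  have := congrArg star h
  rwa [star_mul, hp.star_eq, hq.star_eq] at this

theorem mul_eq_zero_of_mul_eq_zero (hp : IsSelfAdjoint p) (hq : IsSelfAdjoint q)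
    (h : p * q = 0) : q * p = 0 := by
  have := congrArg star h
  rwa [star_mul, hp.star_eq, hq.star_eq, star_zero] at this

theorem sub (hp : IsProjIn N P p) (hq : IsProjIn N P q) (h : p * q = q) :
    IsProjIn N P (p - q) where
  proj := by
    have h' := mul_eq_of_mul_eq hp.proj.isSelfAdjoint hq.proj.isSelfAdjoint h
    refine ⟨?_, hp.proj.isSelfAdjoint.sub hq.proj.isSelfAdjoint⟩
    have h1 := hp.proj.isIdempotentElem.eq
    have h2 := hq.proj.isIdempotentElem.eq
    rw [IsIdempotentElem, sub_mul, mul_sub, mul_sub, h, h', h1, h2]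
    abel
  left := sub_mem hp.left hq.left
  right := sub_mem hp.right hq.right

theorem add (hp : IsProjIn N P p) (hq : IsProjIn N P q) (h : p * q = 0) :
    IsProjIn N P (p + q) where
  proj := by
    have h' := mul_eq_zero_of_mul_eq_zero hp.proj.isSelfAdjoint hq.proj.isSelfAdjoint h
    refine ⟨?_, hp.proj.isSelfAdjoint.add hq.proj.isSelfAdjoint⟩
    have h1 := hp.proj.isIdempotentElem.eq
    have h2 := hq.proj.isIdempotentElem.eq
    rw [IsIdempotentElem, add_mul, mul_add, mul_add, h, h', h1, h2]
    abel
  left := add_mem hp.left hq.left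
  right := add_mem hp.right hq.right

theorem zero : IsProjIn N P (0 : M.toStarSubalgebra) where
  proj := ⟨by simp [IsIdempotentElem], .zero _⟩
  left := zero_mem N
  right := zero_mem P

theorem one : IsProjIn N P (1 : M.toStarSubalgebra) where
  proj := ⟨by simp [IsIdempotentElem], .one _⟩
  left := one_mem N
  right := one_mem P

theorem re_map_eq (hτ : IsTracialState τ) (hp : IsProjIn N P p) :
    (τ p).re = twoNorm τ p ^ 2 := by
  rw [← hτ.re_map_star_mul_self, hp.proj.isSelfAdjoint.star_eq, hp.proj.isIdempotentElem.eq]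

theorem map_eq (hτ : IsTracialState τ) (hp : IsProjIn N P p) : τ p = ((τ p).re : ℂ) := by
  have := hτ.map_star_mul_self p
  rwa [hp.proj.isSelfAdjoint.star_eq, hp.proj.isIdempotentElem.eq, ← hp.re_map_eq hτ] at this

theorem re_map_nonneg (hτ : IsTracialState τ) (hp : IsProjIn N P p) : 0 ≤ (τ p).re := by
  rw [hp.re_map_eq hτ]
  positivity

theorem re_map_pos (hτ : IsFaithfulNormalTracialState M τ) (hp : IsProjIn N P p) (h : p ≠ 0) :
    0 < (τ p).re := by
  refine lt_of_le_of_ne (hp.re_map_nonneg hτ.isTracialState) fun h0 => h ?_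
  rw [hp.re_map_eq hτ.isTracialState] at h0
  exact hτ.eq_zero_of_twoNorm (by simpa using h0.symm)

theorem norm_le_one (hp : IsProjIn N P p) : ‖p‖ ≤ 1 := by
  have h := CStarRing.norm_star_mul_self (x := p)
  rw [hp.proj.isSelfAdjoint.star_eq, hp.proj.isIdempotentElem.eq] at h
  by_contra! h1
  nlinarith

end IsProjIn

variable {N P : VonNeumannAlgebra H}

theorem IsDiffuse.exists_isProjIn (h : IsDiffuse ((N : Set (H →L[ℂ] H)) ∩ P)) (hPM : P ≤ M)
    {p : M.toStarSubalgebra} (hp : IsProjIn N P p) (hp0 : p ≠ 0) :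
    ∃ q : M.toStarSubalgebra, IsProjIn N P q ∧ p * q = q ∧ q ≠ 0 ∧ q ≠ p := by
  have hp' : IsStarProjection (p : H →L[ℂ] H) :=
    ⟨congrArg Subtype.val hp.proj.isIdempotentElem.eq,
      congrArg Subtype.val hp.proj.isSelfAdjoint.star_eq⟩
  obtain ⟨q, ⟨hqN, hqP⟩, hq, hpq, hq0, hqp⟩ := h p ⟨hp.left, hp.right⟩ hp'
    (fun h0 => hp0 (Subtype.ext h0))
  refine ⟨⟨q, hPM hqP⟩, ⟨⟨Subtype.ext hq.isIdempotentElem.eq,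
    Subtype.ext hq.isSelfAdjoint.star_eq⟩, hqN, hqP⟩, Subtype.ext hpq,
    fun h0 => hq0 (congrArg Subtype.val h0), fun h0 => hqp (congrArg Subtype.val h0)⟩

/-- Split a projection into two nonzero pieces, keep the one with at most half of the trace, and
iterate. -/
theorem IsDiffuse.exists_isProjIn_re_map_le (τ : M.toStarSubalgebra →ₗ[ℂ] ℂ)
    (h : IsDiffuse ((N : Set (H →L[ℂ] H)) ∩ P)) (hPM : P ≤ M)
    {p : M.toStarSubalgebra} (hp : IsProjIn N P p) (hp0 : p ≠ 0) {γ : ℝ} (hγ : 0 < γ) :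
    ∃ q : M.toStarSubalgebra, IsProjIn N P q ∧ p * q = q ∧ q ≠ 0 ∧ (τ q).re ≤ γ := by
  have key : ∀ k : ℕ, ∃ q : M.toStarSubalgebra, IsProjIn N P q ∧ p * q = q ∧ q ≠ 0 ∧
      (τ q).re ≤ (τ p).re * (1 / 2) ^ k := by
    intro k
    induction k with
    | zero => exact ⟨p, hp, hp.proj.isIdempotentElem.eq, hp0, by simp⟩
    | succ k ih =>
      obtain ⟨q, hq, hpq, hq0, hqt⟩ := ih
      obtain ⟨r, hr, hqr, hr0, hrq⟩ := h.exists_isProjIn hPM hq hq0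
      have hsum : (τ (q - r)).re = (τ q).re - (τ r).re := by simp
      have hpow : (τ p).re * (1 / 2) ^ (k + 1) = (τ p).re * (1 / 2) ^ k / 2 := by ring
      rcases le_total (τ r).re ((τ q).re / 2) with h1 | h1
      · refine ⟨r, hr, ?_, hr0, by linarith⟩
        rw [← hqr, ← mul_assoc, hpq]
      · refine ⟨q - r, hq.sub hr hqr, ?_, sub_ne_zero.2 hrq.symm, by linarith⟩
        rw [mul_sub, hpq, ← hqr, ← mul_assoc, hpq]
  have hlim : Tendsto (fun k : ℕ => (τ p).re * (1 / 2 : ℝ) ^ k) atTop (𝓝 0) := by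
    simpa using (tendsto_pow_atTop_nhds_zero_of_lt_one (r := (1 / 2 : ℝ)) (by norm_num)
      (by norm_num)).const_mul (τ p).re
  obtain ⟨k, hk⟩ := (hlim.eventually (gt_mem_nhds hγ)).exists
  obtain ⟨q, hq, hpq, hq0, hqt⟩ := key k
  exact ⟨q, hq, hpq, hq0, hqt.trans hk.le⟩

/-- Greedy choice: the projection added to `q` has at least half of the supremum of the traces
available under the bound `γ`. Any competitor that stays orthogonal forever thus forces a definite
gain at every step. -/
theorem exists_isProjIn_step (τ : M.toStarSubalgebra →ₗ[ℂ] ℂ) {γ : ℝ} (hγ : 0 < γ)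
    {q : M.toStarSubalgebra} (hq : IsProjIn N P q) :
    ∃ q' : M.toStarSubalgebra, IsProjIn N P q' ∧ q' * q = q ∧ (τ q').re - (τ q).re ≤ γ ∧
      ∀ r : M.toStarSubalgebra, IsProjIn N P r → r * q = 0 → (τ r).re ≤ γ →
        (τ r).re ≤ 2 * ((τ q').re - (τ q).re) := by
  set T : Set ℝ := {t | ∃ r : M.toStarSubalgebra, IsProjIn N P r ∧ r * q = 0 ∧ (τ r).re ≤ γ ∧
    (τ r).re = t}
  have hTb : BddAbove T := ⟨γ, by rintro _ ⟨r, -, -, h, rfl⟩; exact h⟩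
  have hT0 : (0 : ℝ) ∈ T := ⟨0, .zero, by simp, by simpa using hγ.le, by simp⟩
  have hex : ∃ r : M.toStarSubalgebra, IsProjIn N P r ∧ r * q = 0 ∧ (τ r).re ≤ γ ∧
      sSup T ≤ 2 * (τ r).re := by
    rcases le_or_gt (sSup T) 0 with h | h
    · exact ⟨0, .zero, by simp, by simpa using hγ.le, by simpa using h⟩
    · obtain ⟨_, ⟨r, hr, hrq, hrγ, rfl⟩, h1⟩ := exists_lt_of_lt_csSup ⟨0, hT0⟩ (half_lt_self h)
      exact ⟨r, hr, hrq, hrγ, by linarith⟩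
  obtain ⟨r, hr, hrq, hrγ, hrs⟩ := hex
  refine ⟨r + q, hr.add hq hrq, by rw [add_mul, hrq, hq.proj.isIdempotentElem.eq, zero_add],
    by simpa using hrγ, fun r' h1 h2 h3 => ?_⟩
  have := le_csSup hTb ⟨r', h1, h2, h3, rfl⟩
  rw [map_add, Complex.add_re]
  linarith

/-- The greedy sequence increases to a projection `T` of `N ∩ P`. If `T ≠ 1`, diffuseness puts a
nonzero projection of trace at most `γ` under `1 - T`. It competes at every step, so the traces grow
at least linearly, which is absurd. Hence `T = 1`, and normality brings the traces within `γ` of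
`1`. -/
theorem exists_seq_isProjIn (hτ : IsFaithfulNormalTracialState M τ) (hPM : P ≤ M)
    (hdiff : IsDiffuse ((N : Set (H →L[ℂ] H)) ∩ P)) {γ : ℝ} (hγ : 0 < γ) :
    ∃ q : ℕ → M.toStarSubalgebra, q 0 = 0 ∧ (∀ k, IsProjIn N P (q k)) ∧
      (∀ k l, k ≤ l → q l * q k = q k) ∧ (∀ k, (τ (q (k + 1))).re - (τ (q k)).re ≤ γ) ∧
      ∃ k, 1 - (τ (q k)).re ≤ γ := by
  have hφ := hτ.isTracialState
  choose f hf1 hf2 hf3 hf4 using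
    fun q : {q : M.toStarSubalgebra // IsProjIn N P q} => exists_isProjIn_step τ hγ q.2
  let s : ℕ → {q : M.toStarSubalgebra // IsProjIn N P q} := fun k =>
    Nat.rec ⟨0, .zero⟩ (fun _ q => ⟨f q, hf1 q⟩) k
  have hs : ∀ k, (s (k + 1)).1 = f (s k) := fun k => rfl
  have hmono : ∀ k l, k ≤ l →
      (s l).1 * (s k).1 = (s k).1 := by
    intro k l hkl
    induction l, hkl using Nat.le_induction with
    | base => exact (s k).2.proj.isIdempotentElem.eq
    | succ l _ ih =>
      conv_lhs => rw [← ih, ← mul_assoc, hs, hf2]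
      exact ih
  refine ⟨fun k => (s k).1, rfl, fun k => (s k).2, hmono, fun k => hf3 (s k), ?_⟩
  have hmono' : ∀ k l, k ≤ l →
      (s k).1 * (s l).1 = (s k).1 :=
    fun k l hkl =>
    IsProjIn.mul_eq_of_mul_eq (s l).2.proj.isSelfAdjoint (s k).2.proj.isSelfAdjoint (hmono k l hkl)
  have hn1 : ∀ k, ‖(s k).1‖ ≤ 1 := fun k => (s k).2.norm_le_one
  obtain ⟨T, hT⟩ := exists_weak_limit (hyperfilter ℕ)
    (fun k => ((s k).1 : H →L[ℂ] H)) hn1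
  have hge : ∀ m, ∀ᶠ k in (hyperfilter ℕ : Filter ℕ), m ≤ k := fun m =>
    Nat.hyperfilter_le_atTop (eventually_ge_atTop m)
  have hsa : ∀ k (v w : H), ⟪((s k).1 : H →L[ℂ] H) v, w⟫_ℂ =
      ⟪v, ((s k).1 : H →L[ℂ] H) w⟫_ℂ := fun k v w => by
    rw [← ContinuousLinearMap.adjoint_inner_right, ← ContinuousLinearMap.star_eq_adjoint]
    exact congrArg (fun a : M.toStarSubalgebra => ⟪v, (a : H →L[ℂ] H) w⟫_ℂ)
      (s k).2.proj.isSelfAdjoint.star_eq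
  have hTsa : star T = T := by
    rw [ContinuousLinearMap.star_eq_adjoint]
    refine ContinuousLinearMap.ext fun v => ext_inner_right ℂ fun w => ?_
    rw [ContinuousLinearMap.adjoint_inner_left]
    refine tendsto_nhds_unique ?_ (hT v w)
    simp only [hsa]
    simpa using (hT w v).star
  have hTs : ∀ m, T * (s m).1 = (s m).1 := fun m => by
    refine ContinuousLinearMap.ext fun v => ext_inner_right ℂ fun w => ?_
    refine tendsto_nhds_unique (hT (((s m).1 : H →L[ℂ] H) v) w) ?_
    refine tendsto_const_nhds.congr' ((hge m).mono fun k hk => ?_)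
    exact congrArg (fun a : M.toStarSubalgebra => ⟪(a : H →L[ℂ] H) v, w⟫_ℂ) (hmono m k hk).symm
  have hsT : ∀ m, ((s m).1 : H →L[ℂ] H) * T = (s m).1 :=
    fun m => by
      have h1 := congrArg star (hTs m)
      have h2 : star ((s m).1 : H →L[ℂ] H) = (s m).1 :=
        congrArg Subtype.val (s m).2.proj.isSelfAdjoint.star_eq
      rwa [star_mul, h2, hTsa] at h1
  have hTT : T * T = T := by
    refine ContinuousLinearMap.ext fun v => ext_inner_right ℂ fun w => ?_
    refine tendsto_nhds_unique (hT (T v) w) ((hT v w).congr fun k => ?_)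
    exact congrArg (fun a : H →L[ℂ] H => ⟪a v, w⟫_ℂ) (hsT k).symm
  have hTN : T ∈ N := VonNeumannAlgebra.mem_of_weak_limit (fun k => (s k).2.left) hT
  have hTP : T ∈ P := VonNeumannAlgebra.mem_of_weak_limit (fun k => (s k).2.right) hT
  set T' : M.toStarSubalgebra := ⟨T, hPM hTP⟩ with hT'
  have hTproj : IsProjIn N P T' := ⟨⟨Subtype.ext hTT, Subtype.ext hTsa⟩, hTN, hTP⟩
  have hT1 : T' = 1 := by
    by_contra hne
    have h1T : IsProjIn N P (1 - T') := IsProjIn.one.sub hTproj (one_mul _)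
    obtain ⟨r, hr, hrT, hr0, hrγ⟩ :=
      hdiff.exists_isProjIn_re_map_le τ hPM h1T (sub_ne_zero.2 (Ne.symm hne)) hγ
    have hrT' := IsProjIn.mul_eq_of_mul_eq h1T.proj.isSelfAdjoint hr.proj.isSelfAdjoint hrT
    have hrs : ∀ m, r * (s m).1 = 0 := fun m => by
      have h2 : T' * (s m).1 = (s m).1 := Subtype.ext (hTs m)
      rw [← hrT', mul_assoc, sub_mul, one_mul, h2, sub_self, mul_zero]
    have hsum : ∀ m : ℕ, m * (τ r).re ≤ 2 * (τ (s m).1).re := by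
      intro m
      induction m with
      | zero => simp [s]
      | succ m ih =>
        have := hf4 (s m) r hr (hrs m) hrγ
        rw [hs]
        push_cast
        linarith
    have hpos := hr.re_map_pos hτ hr0
    obtain ⟨m, hm⟩ := exists_nat_gt (2 / (τ r).re)
    rw [div_lt_iff₀ hpos] at hm
    have h3 := (Complex.re_le_norm _).trans ((hφ.norm_map_le (s m).1).trans
      ((hφ.twoNorm_le_norm _).trans (hn1 m)))
    linarith [hsum m]
  have hlim := hτ.tendsto_of_weak_limit (T := T') hn1 hT 1
  simp only [mul_one] at hlim
  rw [hT1, hτ.map_one] at hlim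
  have hlim2 := (Complex.continuous_re.tendsto _).comp hlim
  obtain ⟨k, hk⟩ := (hlim2.eventually (lt_mem_nhds (sub_lt_self (1 : ℂ).re hγ))).exists
  refine ⟨k, ?_⟩
  simp only [Function.comp_apply, Complex.one_re] at hk
  linarith

/-- A diffuse von Neumann algebra contains a self-adjoint element whose spectral measure consists
of atoms at natural numbers with small weights. -/
theorem exists_small_atoms (hτ : IsFaithfulNormalTracialState M τ) (hPM : P ≤ M)
    (hdiff : IsDiffuse ((N : Set (H →L[ℂ] H)) ∩ P)) {γ : ℝ} (hγ : 0 < γ) :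
    ∃ (z : M.toStarSubalgebra) (m : ℕ) (w : ℕ → ℝ), IsSelfAdjoint z ∧ (z : H →L[ℂ] H) ∈ N ∧
      (z : H →L[ℂ] H) ∈ P ∧ (∀ i ∈ Finset.range m, 0 ≤ w i ∧ w i ≤ γ) ∧
      ∑ i ∈ Finset.range m, w i = 1 ∧
      ∀ l : ℕ, τ (z ^ l) = ((∑ i ∈ Finset.range m, w i * (i : ℝ) ^ l : ℝ) : ℂ) := by
  have hφ := hτ.isTracialState
  obtain ⟨s, hs0, hs, hsmono, hsγ, k, hk⟩ := exists_seq_isProjIn hτ hPM hdiff hγ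
  -- After stage `k` the chain jumps to `1`, so the increments with index at most `k` sum to `1`;
  -- the last of them, `1 - s k`, has trace at most `γ` by the choice of `k`.
  set q : ℕ → M.toStarSubalgebra := fun i => if i ≤ k then s i else 1 with hq
  have hqP : ∀ i, IsProjIn N P (q i) := fun i => by
    by_cases h : i ≤ k
    · simpa only [hq, if_pos h] using hs i
    · simpa only [hq, if_neg h] using IsProjIn.one
  have hmono : ∀ i j, i ≤ j → q j * q i = q i := fun i j hij => by
    by_cases h : j ≤ k
    · simpa only [hq, if_pos h, if_pos (hij.trans h)] using hsmono i j hij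
    · simp only [hq, if_neg h, one_mul]
  have hmono' : ∀ i j, i ≤ j → q i * q j = q i := fun i j hij =>
    IsProjIn.mul_eq_of_mul_eq (hqP j).proj.isSelfAdjoint (hqP i).proj.isSelfAdjoint (hmono i j hij)
  set e : ℕ → M.toStarSubalgebra := fun i => q (i + 1) - q i with he
  have heP : ∀ i, IsProjIn N P (e i) := fun i =>
    (hqP (i + 1)).sub (hqP i) (hmono i (i + 1) i.le_succ)
  have horth : ∀ i j, i < j → e i * e j = 0 := fun i j hij => by
    simp only [he, sub_mul, mul_sub, hmono' _ _ hij.le, hmono' _ _ (Nat.succ_le_of_lt hij),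
      hmono' _ _ (hij.le.trans j.le_succ), hmono' _ _ (Nat.succ_le_succ hij.le), sub_self]
  have horth' : ∀ i j, i ≠ j → e i * e j = 0 := fun i j hij => by
    rcases lt_or_gt_of_ne hij with h | h
    · exact horth i j h
    · exact IsProjIn.mul_eq_zero_of_mul_eq_zero (heP j).proj.isSelfAdjoint
        (heP i).proj.isSelfAdjoint (horth j i h)
  have hsum : ∑ i ∈ Finset.range (k + 1), e i = 1 := by
    rw [Finset.sum_range_sub]
    simp [hq, hs0]
  set z : M.toStarSubalgebra := ∑ i ∈ Finset.range (k + 1), (i : ℂ) • e i with hz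
  have hpow : ∀ l : ℕ, z ^ l = ∑ i ∈ Finset.range (k + 1), ((i : ℂ) ^ l) • e i := by
    intro l
    induction l with
    | zero => simp [hsum]
    | succ l ih =>
      rw [pow_succ, ih, hz, Finset.sum_mul_sum]
      refine Finset.sum_congr rfl fun i hi => ?_
      rw [Finset.sum_eq_single_of_mem i hi]
      · rw [smul_mul_smul_comm, (heP i).proj.isIdempotentElem.eq, pow_succ]
      · intro j _ hji
        rw [smul_mul_smul_comm, horth' i j hji.symm, smul_zero]
  have hzmem : ∀ Q : VonNeumannAlgebra H, (∀ i, (e i : H →L[ℂ] H) ∈ Q) →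
      (z : H →L[ℂ] H) ∈ Q := fun Q hQ => by
    rw [hz, AddSubmonoidClass.coe_finsetSum]
    exact sum_mem fun i _ => Q.smul_mem _ (hQ i)
  refine ⟨z, k + 1, fun i => (τ (e i)).re, ?_, hzmem N fun i => (heP i).left,
    hzmem P fun i => (heP i).right, fun i hi => ⟨(heP i).re_map_nonneg hφ, ?_⟩, ?_, fun l => ?_⟩
  · rw [hz, IsSelfAdjoint, star_sum]
    refine Finset.sum_congr rfl fun i _ => ?_
    rw [star_smul, (heP i).proj.isSelfAdjoint.star_eq]
    simp
  · have hik : i ≤ k := Nat.lt_succ_iff.1 (Finset.mem_range.1 hi)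
    rcases eq_or_lt_of_le hik with rfl | hlt
    · simpa [he, hq, hτ.map_one] using hk
    · have hlt' : i + 1 ≤ k := hlt
      simpa only [he, hq, if_pos hik, if_pos hlt', map_sub, Complex.sub_re] using hsγ i
  · rw [← Complex.re_sum, ← map_sum, hsum, hτ.map_one, Complex.one_re]
  · rw [hpow, map_sum, Complex.ofReal_sum]
    refine Finset.sum_congr rfl fun i _ => ?_
    rw [map_smul, (heP i).map_eq hφ, smul_eq_mul, mul_comm]
    push_cast
    rfl

end Partition

/-! ### Covering numbers of balls -/

/-- Volume comparison: the balls of radius `ρ / 2` around separated points are disjoint and fit into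
the ball of radius `1 + ρ / 2`. -/
theorem card_le_of_separated_unitBall {E : Type*} [NormedAddCommGroup E] [NormedSpace ℝ E]
    [FiniteDimensional ℝ E] {ρ : ℝ} (hρ : 0 < ρ) (t : Finset E) (ht : ∀ v ∈ t, ‖v‖ ≤ 1)
    (hsep : ∀ v ∈ t, ∀ w ∈ t, v ≠ w → ρ < ‖v - w‖) :
    (t.card : ℝ) ≤ (1 + 2 / ρ) ^ Module.finrank ℝ E := by
  borelize E
  set μ : Measure E := Measure.addHaar
  set d := Module.finrank ℝ E
  have hdisj : (t : Set E).PairwiseDisjoint fun v => Metric.ball v (ρ / 2) := by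
    intro v hv w hw hvw
    refine Metric.ball_disjoint_ball ?_
    rw [dist_eq_norm]
    linarith [hsep v hv w hw hvw]
  have hsub : (⋃ v ∈ t, Metric.ball v (ρ / 2)) ⊆ Metric.ball (0 : E) (1 + ρ / 2) := by
    refine Set.iUnion₂_subset fun v hv w hw => ?_
    rw [mem_ball_zero_iff]
    rw [mem_ball_iff_norm] at hw
    have := norm_le_norm_add_norm_sub' w v
    linarith [ht v hv]
  have h1 := measure_mono (μ := μ) hsub
  rw [measure_biUnion_finset hdisj fun _ _ => Metric.isOpen_ball.measurableSet] at h1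
  simp only [Measure.addHaar_ball_of_pos μ _ (half_pos hρ), Finset.sum_const, nsmul_eq_mul] at h1
  rw [Measure.addHaar_ball_of_pos μ _ (by positivity : 0 < 1 + ρ / 2), ← mul_assoc,
    ENNReal.mul_le_mul_iff_left (Metric.measure_ball_pos μ _ one_pos).ne' measure_ball_lt_top.ne,
    ← ENNReal.ofReal_natCast, ← ENNReal.ofReal_mul (by positivity),
    ENNReal.ofReal_le_ofReal_iff (by positivity)] at h1
  have h2 : 0 < (ρ / 2) ^ d := by positivity
  rw [← le_div_iff₀ h2, ← div_pow] at h1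
  have h3 : (1 + ρ / 2) / (ρ / 2) = 1 + 2 / ρ := by
    field_simp
    ring
  rwa [h3] at h1

/-- The closed unit ball of a real normed space of dimension `d` is covered by `(1 + 2/ρ)^d` balls
of radius `ρ`. -/
theorem exists_finset_cover_unitBall (E : Type*) [NormedAddCommGroup E] [NormedSpace ℝ E]
    [FiniteDimensional ℝ E] {ρ : ℝ} (hρ : 0 < ρ) :
    ∃ t : Finset E, (t.card : ℝ) ≤ (1 + 2 / ρ) ^ Module.finrank ℝ E ∧
      ∀ v : E, ‖v‖ ≤ 1 → ∃ w ∈ t, ‖v - w‖ ≤ ρ := by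
  classical
  -- A separated set of maximal cardinality is a net, since an uncovered point could be added to it.
  set S : Set ℕ := {k | ∃ t : Finset E, (∀ v ∈ t, ‖v‖ ≤ 1) ∧
    (∀ v ∈ t, ∀ w ∈ t, v ≠ w → ρ < ‖v - w‖) ∧ t.card = k}
  have hS : BddAbove S := by
    refine ⟨⌊(1 + 2 / ρ) ^ Module.finrank ℝ E⌋₊, ?_⟩
    rintro _ ⟨t, h1, h2, rfl⟩
    exact Nat.le_floor (card_le_of_separated_unitBall hρ t h1 h2)
  obtain ⟨t, h1, h2, h3⟩ := Nat.sSup_mem (s := S) ⟨0, ∅, by simp⟩ hS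
  refine ⟨t, card_le_of_separated_unitBall hρ t h1 h2, fun v hv => ?_⟩
  by_contra! hcon
  have hvt : v ∉ t := fun h => by
    have := hcon v h
    rw [sub_self, norm_zero] at this
    linarith
  have hmem : (insert v t).card ∈ S := by
    refine ⟨insert v t, ?_, ?_, rfl⟩
    · intro w hw
      rcases Finset.mem_insert.1 hw with rfl | hw
      · exact hv
      · exact h1 w hw
    · intro u hu w hw huw
      rcases Finset.mem_insert.1 hu with rfl | hu'
      · rcases Finset.mem_insert.1 hw with rfl | hw'
        · exact absurd rfl huw
        · exact hcon w hw'
      · rcases Finset.mem_insert.1 hw with rfl | hw'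
        · rw [norm_sub_rev]
          exact hcon u hu'
        · exact h2 u hu' w hw' huw
  have := le_csSup hS hmem
  rw [Finset.card_insert_of_notMem hvt, ← h3] at this
  omega

/-! ### Spectral calculus of Hermitian matrices -/

theorem Matrix.IsHermitian.eq_conj_diagonal {n : ℕ} {D : Mat n} (hD : D.IsHermitian) :
    D = (hD.eigenvectorUnitary : Mat n) *
      Matrix.diagonal (fun i => ((hD.eigenvalues i : ℝ) : ℂ)) *
        star (hD.eigenvectorUnitary : Mat n) := by
  conv_lhs => rw [hD.spectral_theorem, Unitary.conjStarAlgAut_apply]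
  rfl

theorem aeval_conj_diagonal {n : ℕ} {U : Mat n} (hU : U ∈ unitary (Mat n)) (v : Fin n → ℝ)
    (q : Polynomial ℝ) :
    Polynomial.aeval (U * Matrix.diagonal (fun i => ((v i : ℝ) : ℂ)) * star U) q =
      U * Matrix.diagonal (fun i => ((q.eval (v i) : ℝ) : ℂ)) * star U := by
  have h1 := (Unitary.mem_iff.1 hU).1
  have h2 := (Unitary.mem_iff.1 hU).2
  induction q using Polynomial.induction_on' with
  | add p q hp hq =>
    rw [map_add, hp, hq, ← add_mul, ← mul_add, Matrix.diagonal_add]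
    simp
  | monomial l c =>
    have h3 : (U * Matrix.diagonal (fun i => ((v i : ℝ) : ℂ)) * star U) ^ l =
        U * Matrix.diagonal (fun i => ((v i : ℝ) : ℂ)) ^ l * star U := by
      induction l with
      | zero => simp [h2]
      | succ l ih =>
        rw [pow_succ, ih, pow_succ]
        simp only [mul_assoc]
        rw [← mul_assoc (star U) U, h1, one_mul]
    rw [Polynomial.aeval_monomial, h3, Matrix.diagonal_pow, ← Algebra.smul_def, ← smul_mul_assoc,
      ← mul_smul_comm]
    congr 2
    ext i j
    rcases eq_or_ne i j with rfl | hij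
    · simp
    · simp [Matrix.diagonal_apply_ne _ hij]

theorem ntr_aeval {n : ℕ} {D : Mat n} (hD : D.IsHermitian) (q : Polynomial ℝ) :
    ntr (Polynomial.aeval D q) =
      (((n : ℝ)⁻¹ * ∑ i, q.eval (hD.eigenvalues i) : ℝ) : ℂ) := by
  conv_lhs => rw [hD.eq_conj_diagonal]
  have hU : (hD.eigenvectorUnitary : Mat n) ∈ unitary (Mat n) := hD.eigenvectorUnitary.2
  rw [aeval_conj_diagonal hU, ntr, mul_assoc, Matrix.trace_mul_comm, mul_assoc,
    (Unitary.mem_iff.1 hU).1, mul_one, Matrix.trace_diagonal]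
  push_cast
  rfl

theorem abs_eigenvalues_le {n : ℕ} {D : Mat n} (hD : D.IsHermitian) {r : ℝ} (hr : opNorm D ≤ r)
    (i : Fin n) : |hD.eigenvalues i| ≤ r := by
  open scoped Matrix.Norms.L2Operator in
  exact IsSelfAdjoint.abs_le_of_mem_spectrum (A := Mat n) hr (hD.eigenvalues_mem_spectrum_real i)

theorem twoNorm_nonneg {A : Type*} [Mul A] [Star A] (φ : A → ℂ) (a : A) : 0 ≤ twoNorm φ a :=
  Real.sqrt_nonneg _

theorem twoNorm_ntr_conj {n : ℕ} (hn : 0 < n) {U : Mat n} (hU : U ∈ unitary (Mat n)) (A : Mat n) :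
    twoNorm ntr (U * A * star U) = twoNorm ntr A := by
  open scoped Matrix.Norms.L2Operator in
  have hφ := isTracialState_ntr hn
  exact (hφ.twoNorm_mul_unitary (Unitary.star_mem hU) _).trans (hφ.twoNorm_unitary_mul hU _)

/-! ### Matching Hermitian matrices with close spectral distributions -/

/-- A single jump at `i` forces `φ (a j) ≤ φ (b j)` for all `j`: the right side is `1` for `j ≤ i`,
the left side is `0` for `j ≥ i`. So nothing cancels in the difference of the sums, and every jump
contributes `1`. -/
theorem card_jump_le {N : ℕ} {a b : Fin N → ℝ} (ha : Antitone a) (hb : Antitone b) {φ : ℝ → ℝ}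
    (hφ : Monotone φ) (h0 : ∀ t, 0 ≤ φ t) (h1 : ∀ t, φ t ≤ 1) :
    ((Finset.univ.filter fun i => φ (a i) = 0 ∧ φ (b i) = 1).card : ℝ) ≤
      |∑ i, φ (b i) - ∑ i, φ (a i)| := by
  set B := Finset.univ.filter fun i => φ (a i) = 0 ∧ φ (b i) = 1 with hB
  rcases B.eq_empty_or_nonempty with h | ⟨i, hi⟩
  · simp [h]
  · obtain ⟨hai, hbi⟩ := (Finset.mem_filter.1 hi).2
    refine le_trans ?_ (le_abs_self _)
    rw [← Finset.sum_sub_distrib]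
    have hnonneg : ∀ j, 0 ≤ φ (b j) - φ (a j) := fun j => by
      rcases le_total j i with hj | hj
      · have := hφ (hb hj)
        linarith [h1 (a j)]
      · have := hφ (ha hj)
        linarith [h0 (b j)]
    calc (B.card : ℝ) = ∑ j ∈ B, (φ (b j) - φ (a j)) := by
          rw [Finset.card_eq_sum_ones, Nat.cast_sum]
          refine Finset.sum_congr rfl fun j hj => ?_
          obtain ⟨h3, h4⟩ := (Finset.mem_filter.1 hj).2
          simp [h3, h4]
      _ ≤ _ := Finset.sum_le_univ_sum_of_nonneg hnonneg

/-- Antitone sequences whose empirical distributions agree on suitable test polynomials are close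
in mean square. -/
theorem exists_polynomials_sum_sq_sub_le (r : ℝ) {ε : ℝ} (hε : 0 < ε) :
    ∃ (Q : Finset (Polynomial ℝ)) (δ : ℝ), 0 < δ ∧ ∀ (N : ℕ) (a b : Fin N → ℝ), Antitone a →
      Antitone b → (∀ i, |a i| ≤ r) → (∀ i, |b i| ≤ r) →
      (∀ q ∈ Q, |∑ i, q.eval (a i) - ∑ i, q.eval (b i)| ≤ N * δ) →
      ∑ i, (a i - b i) ^ 2 ≤ N * ε := by
  classical
  -- Indices with `|a i - b i| ≤ 2 s` contribute at most `(2 s)² = ε / 2` each; the constant `δ`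
  -- below lets the remaining ones contribute `N ε / 2` in total.
  set s : ℝ := √(ε / 8) with hs
  have hs0 : 0 < s := Real.sqrt_pos.2 (by positivity)
  have hs2 : s ^ 2 = ε / 8 := Real.sq_sqrt (by positivity)
  set K : ℕ := ⌈2 * r / s⌉₊ + 1 with hK
  -- A ramp that rises from `0` to `1` on an interval of length `s` starting at `-r + k s`. Between
  -- two points of `[-r, r]` at distance at least `2 s` there is a complete ramp.
  set φ : ℕ → ℝ → ℝ := fun k t => max 0 (min 1 ((t - (-r + k * s)) / s)) with hφ
  set δ : ℝ := ε / (48 * K * (r ^ 2 + 1)) with hδ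
  have hK0 : (0 : ℝ) < K := by rw [hK]; positivity
  have hδ0 : 0 < δ := by positivity
  have hq : ∀ k, ∃ q : Polynomial ℝ, ∀ t ∈ Set.Icc (-r) r, |q.eval t - φ k t| < δ := fun k =>
    exists_polynomial_near_of_continuousOn (-r) r (φ k) (by fun_prop) δ hδ0
  choose q hq using hq
  have hφmono : ∀ k, Monotone (φ k) := fun k t u htu => by
    simp only [hφ]
    gcongr
  have hφ0 : ∀ k t, 0 ≤ φ k t := fun k t => le_max_left _ _
  have hφ1 : ∀ k t, φ k t ≤ 1 := fun k t => max_le zero_le_one (min_le_left _ _)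
  refine ⟨(Finset.range K).image q, δ, hδ0, fun N a b ha hb har hbr h => ?_⟩
  have hsumle : ∀ k ∈ Finset.range K, |∑ i, φ k (b i) - ∑ i, φ k (a i)| ≤ N * (3 * δ) := by
    intro k hk
    have h1 := h (q k) (Finset.mem_image_of_mem q hk)
    have h2 : ∀ c : Fin N → ℝ, (∀ i, |c i| ≤ r) →
        |∑ i, (q k).eval (c i) - ∑ i, φ k (c i)| ≤ N * δ := fun c hc => by
      rw [← Finset.sum_sub_distrib]
      refine (Finset.abs_sum_le_sum_abs _ _).trans ?_
      refine (Finset.sum_le_sum fun i _ => (hq k (c i) (abs_le.1 (hc i))).le).trans ?_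
      simp
    have h3 := h2 a har
    have h4 := h2 b hbr
    rw [abs_le] at h1 h3 h4 ⊢
    constructor <;> linarith
  have hjump : ∀ u v : ℝ, |u| ≤ r → |v| ≤ r → u + 2 * s ≤ v →
      ∃ k ∈ Finset.range K, φ k u = 0 ∧ φ k v = 1 := fun u v hu hv huv => by
    rw [abs_le] at hu hv
    refine ⟨⌈(u + r) / s⌉₊, ?_, ?_, ?_⟩
    · rw [Finset.mem_range, hK, Nat.lt_succ_iff]
      refine Nat.ceil_mono ?_
      gcongr
      linarith
    · have h1 := Nat.le_ceil ((u + r) / s)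
      rw [div_le_iff₀ hs0] at h1
      refine max_eq_left ((min_le_right _ _).trans ?_)
      exact div_nonpos_of_nonpos_of_nonneg (by linarith) hs0.le
    · have h1 := Nat.ceil_lt_add_one (a := (u + r) / s) (div_nonneg (by linarith) hs0.le)
      have h2 : (⌈(u + r) / s⌉₊ : ℝ) * s ≤ u + r + s := by
        have := mul_le_mul_of_nonneg_right h1.le hs0.le
        rwa [add_mul, div_mul_cancel₀ _ hs0.ne', one_mul] at this
      have h3 : 1 ≤ (v - (-r + (⌈(u + r) / s⌉₊ : ℝ) * s)) / s := by
        rw [le_div_iff₀ hs0]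
        linarith
      simp only [hφ, min_eq_left h3]
      simp
  set B : ℕ → Finset (Fin N) := fun k =>
    (Finset.univ.filter fun i => φ k (a i) = 0 ∧ φ k (b i) = 1) ∪
      (Finset.univ.filter fun i => φ k (b i) = 0 ∧ φ k (a i) = 1) with hB
  have hBcard : ∀ k ∈ Finset.range K, ((B k).card : ℝ) ≤ N * (6 * δ) := fun k hk => by
    have h1 := card_jump_le ha hb (hφmono k) (hφ0 k) (hφ1 k)
    have h2 := card_jump_le hb ha (hφmono k) (hφ0 k) (hφ1 k)
    rw [abs_sub_comm] at h2
    have h3 := hsumle k hk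
    have h4 : ((B k).card : ℝ) ≤
        ((Finset.univ.filter fun i => φ k (a i) = 0 ∧ φ k (b i) = 1).card : ℝ) +
          ((Finset.univ.filter fun i => φ k (b i) = 0 ∧ φ k (a i) = 1).card : ℝ) := by
      exact_mod_cast Finset.card_union_le _ _
    linarith
  set Bad := (Finset.range K).biUnion B with hBad
  have hBadcard : (Bad.card : ℝ) ≤ K * (N * (6 * δ)) := by
    calc (Bad.card : ℝ) ≤ ∑ k ∈ Finset.range K, ((B k).card : ℝ) := by
          exact_mod_cast Finset.card_biUnion_le
      _ ≤ ∑ k ∈ Finset.range K, N * (6 * δ) := Finset.sum_le_sum hBcard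
      _ = _ := by simp
  have hterm : ∀ i, (a i - b i) ^ 2 ≤ (2 * s) ^ 2 + if i ∈ Bad then 4 * r ^ 2 else 0 := fun i => by
    have hai := abs_le.1 (har i)
    have hbi := abs_le.1 (hbr i)
    by_cases hi : i ∈ Bad
    · rw [if_pos hi]
      nlinarith [sq_nonneg s]
    · rw [if_neg hi, add_zero]
      refine sq_le_sq' ?_ ?_ <;> by_contra! hcon
      · obtain ⟨k, hk, h1⟩ := hjump (a i) (b i) (har i) (hbr i) (by linarith)
        exact hi (Finset.mem_biUnion.2 ⟨k, hk, Finset.mem_union_left _ (by simpa using h1)⟩)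
      · obtain ⟨k, hk, h1⟩ := hjump (b i) (a i) (hbr i) (har i) (by linarith)
        exact hi (Finset.mem_biUnion.2 ⟨k, hk, Finset.mem_union_right _ (by simpa using h1)⟩)
  calc ∑ i, (a i - b i) ^ 2 ≤ ∑ i, ((2 * s) ^ 2 + if i ∈ Bad then 4 * r ^ 2 else 0) :=
        Finset.sum_le_sum fun i _ => hterm i
    _ = N * (2 * s) ^ 2 + Bad.card * (4 * r ^ 2) := by
        rw [Finset.sum_add_distrib, Finset.sum_ite_mem]
        simp
    _ ≤ N * (2 * s) ^ 2 + K * (N * (6 * δ)) * (4 * (r ^ 2 + 1)) := by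
        gcongr
        linarith
    _ = N * ε := by
        rw [mul_pow, hs2, hδ]
        field_simp
        ring

/-- Hermitian matrices whose spectral distributions agree on suitable test polynomials are
approximately unitarily equivalent. -/
theorem exists_polynomials_unitary_conj (r : ℝ) {ε : ℝ} (hε : 0 < ε) :
    ∃ (Q : Finset (Polynomial ℝ)) (δ : ℝ), 0 < δ ∧ ∀ n : ℕ, 0 < n → ∀ W C : Mat n,
      W.IsHermitian → C.IsHermitian → opNorm W ≤ r → opNorm C ≤ r →
      (∀ q ∈ Q, ‖ntr (Polynomial.aeval W q) - ntr (Polynomial.aeval C q)‖ ≤ δ) →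
      ∃ V ∈ unitary (Mat n), twoNorm ntr (V * W * star V - C) ≤ ε := by
  obtain ⟨Q, δ, hδ, h⟩ := exists_polynomials_sum_sq_sub_le r (sq_pos_of_pos hε)
  refine ⟨Q, δ, hδ, fun n hn W C hW hC hWr hCr hQ => ?_⟩
  have hn' : (0 : ℝ) < n := by exact_mod_cast hn
  set e := (Fintype.equivOfCardEq (Fintype.card_fin (Fintype.card (Fin n)))).symm with he
  have hWe : ∀ i, hW.eigenvalues i = hW.eigenvalues₀ (e i) := fun i => rfl
  have hCe : ∀ i, hC.eigenvalues i = hC.eigenvalues₀ (e i) := fun i => rfl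
  have hcard : ((Fintype.card (Fin n) : ℕ) : ℝ) = n := by simp
  have hsum := h _ hW.eigenvalues₀ hC.eigenvalues₀ hW.eigenvalues₀_antitone
    hC.eigenvalues₀_antitone
    (fun i => by simpa [hWe] using abs_eigenvalues_le hW hWr (e.symm i))
    (fun i => by simpa [hCe] using abs_eigenvalues_le hC hCr (e.symm i))
    (fun q hq => by
      have h1 := hQ q hq
      rw [ntr_aeval hW, ntr_aeval hC, ← Complex.ofReal_sub, Complex.norm_real, Real.norm_eq_abs,
        ← mul_sub, abs_mul, abs_of_pos (inv_pos.2 hn'), inv_mul_le_iff₀ hn'] at h1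
      rw [← Equiv.sum_comp e, ← Equiv.sum_comp e (fun i => q.eval (hC.eigenvalues₀ i)), hcard]
      exact h1)
  rw [← Equiv.sum_comp e, hcard] at hsum
  set U₁ : Mat n := (hW.eigenvectorUnitary : Mat n) with hU₁d
  set U₂ : Mat n := (hC.eigenvectorUnitary : Mat n) with hU₂d
  have hU₁ : U₁ ∈ unitary (Mat n) := hW.eigenvectorUnitary.2
  have hU₂ : U₂ ∈ unitary (Mat n) := hC.eigenvectorUnitary.2
  -- Both spectra are enumerated in the same monotone order, and this unitary matches the
  -- eigenvectors of `W` with those of `C` in that order.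
  refine ⟨U₂ * star U₁, mul_mem hU₂ (Unitary.star_mem hU₁), ?_⟩
  have hdiff : U₂ * star U₁ * W * star (U₂ * star U₁) - C =
      U₂ * Matrix.diagonal (fun i => ((hW.eigenvalues i - hC.eigenvalues i : ℝ) : ℂ)) *
        star U₂ := by
    conv_lhs => rw [hW.eq_conj_diagonal, hC.eq_conj_diagonal, ← hU₁d, ← hU₂d]
    simp only [star_mul, star_star, mul_assoc]
    rw [← mul_assoc (star U₁) U₁, (Unitary.mem_iff.1 hU₁).1, one_mul,
      ← mul_assoc (star U₁) U₁, (Unitary.mem_iff.1 hU₁).1, one_mul, ← mul_sub, ← sub_mul,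
      Matrix.diagonal_sub]
    simp
  rw [hdiff, twoNorm_ntr_conj hn hU₂]
  refine abs_le_of_sq_le_sq' ?_ hε.le |>.2
  rw [twoNorm_ntr_sq, inv_mul_le_iff₀ hn']
  refine le_trans (le_of_eq ?_) hsum
  refine Finset.sum_congr rfl fun i _ => ?_
  rw [Finset.sum_eq_single i]
  · rw [Matrix.diagonal_apply_eq, Complex.norm_real, Real.norm_eq_abs, sq_abs, hWe, hCe]
  · intro j _ hj
    rw [Matrix.diagonal_apply_ne _ hj.symm]
    simp
  · simp

/-! ### Approximate commutants -/

/-- The matrices of 2-norm at most `1` that approximately commute with a Hermitian matrix with few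
close pairs of eigenvalues have a small covering number. -/
theorem exists_finset_cover_commutant {n : ℕ} (hn : 0 < n) {D : Mat n} (hD : D.IsHermitian)
    {κ ρ : ℝ} (hκ : 0 < κ) (hρ : 0 < ρ) :
    ∃ t : Finset (Mat n), (t.card : ℝ) ≤ (1 + 2 / ρ) ^ (2 * (Finset.univ.filter
        fun p : Fin n × Fin n => |hD.eigenvalues p.1 - hD.eigenvalues p.2| < κ).card) ∧
      ∀ G : Mat n, twoNorm ntr G ≤ 1 → twoNorm ntr (G * D - D * G) ≤ κ * ρ →
        ∃ g ∈ t, twoNorm ntr (G - g) ≤ 2 * ρ := by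
  classical
  have hn' : (0 : ℝ) < n := by exact_mod_cast hn
  set S := Finset.univ.filter
    fun p : Fin n × Fin n => |hD.eigenvalues p.1 - hD.eigenvalues p.2| < κ with hS
  set U : Mat n := (hD.eigenvectorUnitary : Mat n) with hUd
  have hU : U ∈ unitary (Mat n) := hD.eigenvectorUnitary.2
  have hUU := (Unitary.mem_iff.1 hU).1
  have hUU' := (Unitary.mem_iff.1 hU).2
  obtain ⟨t, htc, ht⟩ := exists_finset_cover_unitBall (EuclideanSpace ℂ S) hρ
  have hrank : Module.finrank ℝ (EuclideanSpace ℂ S) = 2 * S.card := by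
    rw [← Module.finrank_mul_finrank ℝ ℂ (EuclideanSpace ℂ S), Complex.finrank_real_complex,
      finrank_euclideanSpace, Fintype.card_coe]
  rw [hrank] at htc
  -- Rescaling by `√n` turns the normalized 2-norm into the Euclidean norm of the entries.
  set s : ℝ := √n with hs
  have hs0 : 0 < s := Real.sqrt_pos.2 hn'
  have hs2 : s ^ 2 = n := Real.sq_sqrt hn'.le
  let emb : EuclideanSpace ℂ S → Mat n := fun v =>
    Matrix.of fun a b => if h : (a, b) ∈ S then (s : ℂ) * v ⟨(a, b), h⟩ else 0
  refine ⟨t.image fun v => U * emb v * star U,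
    (Nat.cast_le.2 Finset.card_image_le).trans htc, fun G hG hGD => ?_⟩
  set G' : Mat n := star U * G * U with hG'
  have hG'n : twoNorm ntr G' ≤ 1 := by
    have := twoNorm_ntr_conj hn (Unitary.star_mem hU) G
    rw [star_star] at this
    rwa [hG', this]
  -- In an eigenbasis of `D` the commutator multiplies each entry by a difference of eigenvalues,
  -- which is at least `κ` in modulus outside `S`. The entries outside `S` thus have 2-norm at most
  -- `ρ` in total and are replaced by zero; those in `S` form a space of real dimension `2 |S|`.
  have hcomm : twoNorm ntr (G * D - D * G) ^ 2 =
      (n : ℝ)⁻¹ * ∑ a, ∑ b, (hD.eigenvalues b - hD.eigenvalues a) ^ 2 * ‖G' a b‖ ^ 2 := by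
    have h1 : G * D - D * G = U * (G' * Matrix.diagonal (fun i => ((hD.eigenvalues i : ℝ) : ℂ)) -
        Matrix.diagonal (fun i => ((hD.eigenvalues i : ℝ) : ℂ)) * G') * star U := by
      conv_lhs => rw [hD.eq_conj_diagonal, ← hUd]
      simp only [hG', mul_sub, sub_mul, mul_assoc]
      rw [hUU', mul_one, ← mul_assoc U (star U), hUU', one_mul]
    rw [h1, twoNorm_ntr_conj hn hU, twoNorm_ntr_sq]
    congr 1
    refine Finset.sum_congr rfl fun a _ => Finset.sum_congr rfl fun b _ => ?_
    rw [Matrix.sub_apply, Matrix.mul_diagonal, Matrix.diagonal_mul, mul_comm (G' a b), ← sub_mul,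
      norm_mul, mul_pow, ← Complex.ofReal_sub, Complex.norm_real, Real.norm_eq_abs, sq_abs]
  set v : EuclideanSpace ℂ S := WithLp.toLp 2 fun p => (s : ℂ)⁻¹ * G' p.1.1 p.1.2 with hv
  have hsumS : ∀ f : Fin n → Fin n → ℝ, ∑ p : S, f p.1.1 p.1.2 =
      ∑ a, ∑ b, if (a, b) ∈ S then f a b else 0 := fun f => by
    rw [Finset.sum_coe_sort S fun p => f p.1 p.2, ← Finset.sum_product',
      Finset.univ_product_univ, Finset.sum_ite_mem, Finset.univ_inter]
  have hvn : ‖v‖ ≤ 1 := by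
    refine abs_le_of_sq_le_sq' ?_ zero_le_one |>.2
    rw [EuclideanSpace.norm_sq_eq]
    have h1 : ∀ p : S, ‖v p‖ ^ 2 = (n : ℝ)⁻¹ * ‖G' p.1.1 p.1.2‖ ^ 2 := fun p => by
      simp only [hv, norm_mul, norm_inv, Complex.norm_real, Real.norm_eq_abs, abs_of_pos hs0,
        mul_pow, inv_pow, hs2]
    simp only [h1]
    rw [hsumS fun a b => (n : ℝ)⁻¹ * ‖G' a b‖ ^ 2]
    have h5 := pow_le_pow_left₀ (twoNorm_nonneg ntr G') hG'n 2
    refine le_trans ?_ h5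
    rw [twoNorm_ntr_sq, Finset.mul_sum]
    refine Finset.sum_le_sum fun a _ => ?_
    rw [Finset.mul_sum]
    refine Finset.sum_le_sum fun b _ => ?_
    split_ifs
    · exact le_rfl
    · positivity
  obtain ⟨w, hw, hvw⟩ := ht v hvn
  refine ⟨_, Finset.mem_image_of_mem _ hw, ?_⟩
  have h2 : G - U * emb w * star U = U * (G' - emb w) * star U := by
    rw [mul_sub, sub_mul, hG']
    simp only [mul_assoc]
    rw [hUU', mul_one, ← mul_assoc U (star U), hUU', one_mul]
  rw [h2, twoNorm_ntr_conj hn hU]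
  refine abs_le_of_sq_le_sq' ?_ (by positivity) |>.2
  have hentry : ∀ a b, ‖(G' - emb w) a b‖ ^ 2 ≤
      (if h : (a, b) ∈ S then n * ‖(v - w) ⟨(a, b), h⟩‖ ^ 2 else 0) +
        (κ ^ 2)⁻¹ * ((hD.eigenvalues b - hD.eigenvalues a) ^ 2 * ‖G' a b‖ ^ 2) := fun a b => by
    by_cases h : (a, b) ∈ S
    · rw [dif_pos h]
      refine le_add_of_le_of_nonneg (le_of_eq ?_) (by positivity)
      have h3 : (G' - emb w) a b = (s : ℂ) * (v - w) ⟨(a, b), h⟩ := by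
        have hsc : (s : ℂ) ≠ 0 := by exact_mod_cast hs0.ne'
        simp only [Matrix.sub_apply, emb, Matrix.of_apply, dif_pos h, PiLp.sub_apply, mul_sub, hv,
          mul_inv_cancel_left₀ hsc]
      rw [h3, norm_mul, mul_pow, Complex.norm_real, Real.norm_eq_abs, sq_abs, hs2]
    · rw [dif_neg h, zero_add, ← mul_assoc]
      have h3 : (G' - emb w) a b = G' a b := by
        simp only [Matrix.sub_apply, emb, Matrix.of_apply, dif_neg h, sub_zero]
      rw [h3]
      refine le_mul_of_one_le_left (by positivity) ?_
      rw [le_inv_mul_iff₀ (by positivity), mul_one, ← sq_abs (_ - _), abs_sub_comm]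
      have h4 : ¬ |hD.eigenvalues a - hD.eigenvalues b| < κ := fun h5 =>
        h (Finset.mem_filter.2 ⟨Finset.mem_univ _, h5⟩)
      exact pow_le_pow_left₀ hκ.le (not_lt.1 h4) 2
  have hfirst : ∑ a, ∑ b, (if h : (a, b) ∈ S then n * ‖(v - w) ⟨(a, b), h⟩‖ ^ 2 else 0) =
      n * ‖v - w‖ ^ 2 := by
    rw [EuclideanSpace.norm_sq_eq, Finset.mul_sum, ← Finset.sum_product', Finset.univ_product_univ,
      ← Finset.sum_subset (Finset.subset_univ S) (fun p _ hp => dif_neg hp),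
      ← Finset.sum_coe_sort S]
    exact Finset.sum_congr rfl fun p _ => dif_pos p.2
  rw [twoNorm_ntr_sq, inv_mul_le_iff₀ hn']
  calc ∑ a, ∑ b, ‖(G' - emb w) a b‖ ^ 2
      ≤ ∑ a, ∑ b, ((if h : (a, b) ∈ S then n * ‖(v - w) ⟨(a, b), h⟩‖ ^ 2 else 0) +
        (κ ^ 2)⁻¹ * ((hD.eigenvalues b - hD.eigenvalues a) ^ 2 * ‖G' a b‖ ^ 2)) :=
        Finset.sum_le_sum fun a _ => Finset.sum_le_sum fun b _ => hentry a b
    _ = n * ‖v - w‖ ^ 2 + (κ ^ 2)⁻¹ * (n * twoNorm ntr (G * D - D * G) ^ 2) := by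
        simp only [Finset.sum_add_distrib]
        rw [hfirst, hcomm, mul_inv_cancel_left₀ hn'.ne']
        simp only [Finset.mul_sum]
    _ ≤ n * ρ ^ 2 + (κ ^ 2)⁻¹ * (n * (κ * ρ) ^ 2) := by
        have h5 := pow_le_pow_left₀ (twoNorm_nonneg ntr (G * D - D * G)) hGD 2
        have h6 := pow_le_pow_left₀ (norm_nonneg (v - w)) hvw 2
        have h7 := mul_le_mul_of_nonneg_left (mul_le_mul_of_nonneg_left h5 hn'.le)
          (inv_nonneg.2 (sq_nonneg κ))
        exact add_le_add (mul_le_mul_of_nonneg_left h6 hn'.le) h7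
    _ ≤ n * (2 * ρ) ^ 2 := by
        rw [mul_pow]
        field_simp
        norm_num

/-- Basic neighborhoods for the topology of pointwise convergence. -/
theorem exists_finset_of_mem_nhds_pi {ι E : Type*} [PseudoMetricSpace E] {f₀ : ι → E}
    {U : Set (ι → E)} (hU : U ∈ 𝓝 f₀) :
    ∃ (G : Finset ι) (δ : ℝ), 0 < δ ∧
      ∀ f : ι → E, (∀ g ∈ G, dist (f g) (f₀ g) < δ) → f ∈ U := by
  rw [nhds_pi, Filter.mem_pi'] at hU
  obtain ⟨G, t, ht, hsub⟩ := hU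
  have h : ∀ᶠ δ : ℝ in 𝓝[>] 0, ∀ g ∈ G, Metric.ball (f₀ g) δ ⊆ t g := by
    rw [Filter.eventually_all_finset]
    intro g _
    obtain ⟨δ, hδ, hb⟩ := Metric.mem_nhds_iff.1 (ht g)
    filter_upwards [Ioo_mem_nhdsGT hδ] with δ' hδ'
    exact (Metric.ball_subset_ball hδ'.2.le).trans hb
  obtain ⟨δ, hδ, hδ0⟩ := (h.and self_mem_nhdsWithin).exists
  exact ⟨G, δ, hδ0, fun f hf => hsub fun g hg => hδ g hg (hf g hg)⟩

/-! ### Counting close pairs of eigenvalues -/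

/-- The value of `(ℓ ⊗ ℓ)(f(s - t))` for a functional `ℓ` on polynomials given by its moments. -/
def diffForm (f : Polynomial ℝ) (ℓ : ℕ → ℝ) : ℝ :=
  ∑ k ∈ f.support, f.coeff k *
    ∑ l ∈ Finset.range (k + 1), ℓ l * ((-1) ^ (k - l) * ℓ (k - l)) * (k.choose l : ℝ)

theorem continuous_diffForm (f : Polynomial ℝ) : Continuous (diffForm f) := by
  unfold diffForm
  fun_prop

/-- By the binomial theorem the double sum factors into moments, so finitely many moments control
the pair statistics of a spectrum. -/
theorem diffForm_eq {α : Type*} (f : Polynomial ℝ) (s : Finset α) (w v : α → ℝ) :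
    diffForm f (fun l => ∑ a ∈ s, w a * v a ^ l) =
      ∑ a ∈ s, ∑ b ∈ s, w a * w b * f.eval (v a - v b) := by
  have h : ∀ k : ℕ, ∑ l ∈ Finset.range (k + 1), (∑ a ∈ s, w a * v a ^ l) *
      ((-1) ^ (k - l) * ∑ b ∈ s, w b * v b ^ (k - l)) * (k.choose l : ℝ) =
      ∑ a ∈ s, ∑ b ∈ s, w a * w b * (v a - v b) ^ k := fun k => by
    calc _ = ∑ l ∈ Finset.range (k + 1), ∑ a ∈ s, ∑ b ∈ s,
          w a * w b * (v a ^ l * (-v b) ^ (k - l) * (k.choose l : ℝ)) := by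
          refine Finset.sum_congr rfl fun l _ => ?_
          rw [Finset.mul_sum, Finset.sum_mul_sum, Finset.sum_mul]
          refine Finset.sum_congr rfl fun a _ => ?_
          rw [Finset.sum_mul]
          refine Finset.sum_congr rfl fun b _ => ?_
          rw [neg_pow]
          ring
      _ = _ := by
          rw [Finset.sum_comm]
          refine Finset.sum_congr rfl fun a _ => ?_
          rw [Finset.sum_comm]
          refine Finset.sum_congr rfl fun b _ => ?_
          rw [← Finset.mul_sum, sub_eq_add_neg, add_pow]
  simp only [diffForm, h]
  simp only [Polynomial.eval_eq_sum, Polynomial.sum, Finset.mul_sum]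
  rw [Finset.sum_comm]
  refine Finset.sum_congr rfl fun a _ => ?_
  rw [Finset.sum_comm]
  exact Finset.sum_congr rfl fun b _ => Finset.sum_congr rfl fun k _ => by ring

/-- A Hermitian matrix whose moments are close to those of a measure with small atoms at natural
numbers has few close pairs of eigenvalues. -/
theorem exists_card_close_eigenvalues_le {m : ℕ} {w : ℕ → ℝ} {γ : ℝ} (hγ : 0 < γ)
    (hw : ∀ i ∈ Finset.range m, 0 ≤ w i ∧ w i ≤ γ) (hsum : ∑ i ∈ Finset.range m, w i = 1) :
    ∃ (κ : ℝ) (L : Finset ℕ) (δ : ℝ), 0 < κ ∧ 0 < δ ∧ ∀ n : ℕ, 0 < n → ∀ (D : Mat n)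
      (hD : D.IsHermitian),
      (∀ l ∈ L, ‖ntr (D ^ l) - ((∑ i ∈ Finset.range m, w i * (i : ℝ) ^ l : ℝ) : ℂ)‖ < δ) →
      ((Finset.univ.filter fun p : Fin n × Fin n =>
        |hD.eigenvalues p.1 - hD.eigenvalues p.2| < κ).card : ℝ) ≤ 6 * γ * (n : ℝ) ^ 2 := by
  -- For a nonzero difference `t` of atoms, `c ≤ c t² ≤ 1`, so a high power of `1 - c t²` is below
  -- `γ`, while its value at `0` is `1`. The even exponent keeps `f` nonnegative on the whole line,
  -- as needed for arbitrary eigenvalue differences.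
  set c : ℝ := 1 / ((m : ℝ) + 1) ^ 2 with hc
  have hc0 : 0 < c := by positivity
  have hc1 : c ≤ 1 := by
    rw [hc, div_le_one (by positivity)]
    nlinarith [(Nat.cast_nonneg m : (0 : ℝ) ≤ m)]
  obtain ⟨N, hN⟩ := exists_pow_lt_of_lt_one hγ (show (1 - c) < 1 by linarith)
  set f : Polynomial ℝ := (1 - Polynomial.C c * Polynomial.X ^ 2) ^ (2 * N) with hf
  have hfe : ∀ t, f.eval t = (1 - c * t ^ 2) ^ (2 * N) := fun t => by simp [hf]
  have hf0 : ∀ t, 0 ≤ f.eval t := fun t => by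
    rw [hfe, pow_mul]
    positivity
  obtain ⟨κ, hκ, hfκ⟩ : ∃ κ : ℝ, 0 < κ ∧ ∀ t, |t| < κ → 1 / 2 < f.eval t := by
    have h1 : ContinuousAt (fun t => f.eval t) 0 := f.continuous.continuousAt
    have h2 : (1 / 2 : ℝ) < f.eval 0 := by rw [hfe]; norm_num
    obtain ⟨κ, hκ, h3⟩ := Metric.eventually_nhds_iff.1 (h1.eventually (lt_mem_nhds h2))
    exact ⟨κ, hκ, fun t ht => h3 (by simpa [Real.dist_eq] using ht)⟩
  have hdiff : ∀ i ∈ Finset.range m, ∀ j ∈ Finset.range m,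
      f.eval ((i : ℝ) - j) ≤ (if i = j then 1 else 0) + γ := fun i hi j hj => by
    rw [hfe]
    rcases eq_or_ne i j with rfl | hij
    · simp [hγ.le]
    · rw [if_neg hij, zero_add]
      have hi' : (i : ℝ) ≤ m := by exact_mod_cast (Finset.mem_range.1 hi).le
      have hj' : (j : ℝ) ≤ m := by exact_mod_cast (Finset.mem_range.1 hj).le
      have hi0 : (0 : ℝ) ≤ i := Nat.cast_nonneg i
      have hj0 : (0 : ℝ) ≤ j := Nat.cast_nonneg j
      have h1 : (1 : ℝ) ≤ ((i : ℝ) - j) ^ 2 := by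
        have h2 : (i : ℤ) - j ≠ 0 := sub_ne_zero.2 (by exact_mod_cast hij)
        have h3 : 1 ≤ ((i : ℤ) - j) ^ 2 := by
          rw [← sq_abs]
          nlinarith [Int.one_le_abs h2]
        exact_mod_cast h3
      have h2 : ((i : ℝ) - j) ^ 2 ≤ ((m : ℝ) + 1) ^ 2 := by
        rw [← sq_abs]
        exact pow_le_pow_left₀ (abs_nonneg _) (abs_le.2 ⟨by linarith, by linarith⟩) 2
      have h3 : c * ((i : ℝ) - j) ^ 2 ≤ 1 := by
        rw [hc, one_div_mul_eq_div, div_le_one (by positivity)]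
        exact h2
      have h4 : 1 - c * ((i : ℝ) - j) ^ 2 ≤ 1 - c := by nlinarith
      have h5 : (1 - c * ((i : ℝ) - j) ^ 2) ^ (2 * N) ≤ (1 - c) ^ (2 * N) :=
        pow_le_pow_left₀ (by linarith) h4 _
      have h6 : (1 - c) ^ (2 * N) ≤ (1 - c) ^ N :=
        pow_le_pow_of_le_one (by linarith) (by linarith) (by omega)
      linarith
  set ℓ₀ : ℕ → ℝ := fun l => ∑ i ∈ Finset.range m, w i * (i : ℝ) ^ l with hℓ₀
  -- The diagonal gives `∑ w i² ≤ γ` and the bound `γ` on `f` gives another `γ`; the third is room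
  -- for perturbing the moments. Since `f > 1/2` on close pairs, the final count doubles `3 γ`.
  have hℓ : diffForm f ℓ₀ < 3 * γ := by
    rw [hℓ₀, diffForm_eq f (Finset.range m) w (fun i => (i : ℝ))]
    calc ∑ i ∈ Finset.range m, ∑ j ∈ Finset.range m, w i * w j * f.eval ((i : ℝ) - j)
        ≤ ∑ i ∈ Finset.range m, ∑ j ∈ Finset.range m,
            w i * w j * ((if i = j then 1 else 0) + γ) :=
          Finset.sum_le_sum fun i hi => Finset.sum_le_sum fun j hj =>
            mul_le_mul_of_nonneg_left (hdiff i hi j hj) (mul_nonneg (hw i hi).1 (hw j hj).1)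
      _ = ∑ i ∈ Finset.range m, (w i * w i + w i * γ) := by
          refine Finset.sum_congr rfl fun i hi => ?_
          simp only [mul_add, Finset.sum_add_distrib, mul_ite, mul_one, mul_zero,
            Finset.sum_ite_eq, if_pos hi]
          rw [← Finset.sum_mul, ← Finset.mul_sum, hsum, mul_one]
      _ ≤ ∑ i ∈ Finset.range m, (w i * γ + w i * γ) :=
          Finset.sum_le_sum fun i hi => add_le_add
            (mul_le_mul_of_nonneg_left (hw i hi).2 (hw i hi).1) le_rfl
      _ = 2 * γ := by
          rw [Finset.sum_add_distrib, ← Finset.sum_mul, hsum]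
          ring
      _ < 3 * γ := by linarith
  obtain ⟨L, δ, hδ, hL⟩ := exists_finset_of_mem_nhds_pi
    ((continuous_diffForm f).continuousAt.eventually (gt_mem_nhds hℓ))
  refine ⟨κ, L, δ, hκ, hδ, fun n hn D hD hmom => ?_⟩
  have hn' : (0 : ℝ) < n := by exact_mod_cast hn
  have hmom' : ∀ l, ntr (D ^ l) =
      ((∑ a : Fin n, (n : ℝ)⁻¹ * hD.eigenvalues a ^ l : ℝ) : ℂ) := fun l => by
    have := ntr_aeval hD (Polynomial.X ^ l)
    simpa only [map_pow, Polynomial.aeval_X, Polynomial.eval_pow, Polynomial.eval_X,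
      Finset.mul_sum] using this
  have h1 : diffForm f (fun l => ∑ a : Fin n, (n : ℝ)⁻¹ * hD.eigenvalues a ^ l) < 3 * γ :=
    hL _ fun l hl => by
      have := hmom l hl
      rw [hmom', ← Complex.ofReal_sub, Complex.norm_real] at this
      exact this
  rw [diffForm_eq] at h1
  set S := Finset.univ.filter fun p : Fin n × Fin n =>
    |hD.eigenvalues p.1 - hD.eigenvalues p.2| < κ
  have h2 : (S.card : ℝ) * (1 / 2) ≤
      ∑ a : Fin n, ∑ b : Fin n, f.eval (hD.eigenvalues a - hD.eigenvalues b) := by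
    rw [← Finset.sum_product', Finset.univ_product_univ]
    calc (S.card : ℝ) * (1 / 2) = ∑ p ∈ S, (1 / 2 : ℝ) := by simp
      _ ≤ ∑ p ∈ S, f.eval (hD.eigenvalues p.1 - hD.eigenvalues p.2) :=
          Finset.sum_le_sum fun p hp => (hfκ _ (Finset.mem_filter.1 hp).2).le
      _ ≤ _ := Finset.sum_le_univ_sum_of_nonneg fun p => hf0 _
  simp only [← Finset.mul_sum] at h1
  rw [mul_assoc, inv_mul_lt_iff₀ hn', inv_mul_lt_iff₀ hn'] at h1
  nlinarith

/-! ### From orbits to balls -/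

/-- Suppose the conjugates of `y ω` and `z ω` by unitaries `V ω` are determined by a label up to
small 2-distance, and `z ω` is close to a fixed Hermitian matrix with few close pairs of
eigenvalues. Then `y ω` itself is determined up to small 2-distance by a label that takes few
values. -/
theorem exists_label_of_label_conj {Ω α : Type*} {n : ℕ} (hn : 0 < n) {S : Set Ω}
    {y z V : Ω → Mat n} {D : Mat n} (hD : D.IsHermitian) {κ ρ ε η r : ℝ} (hκ : 0 < κ)
    (hρ : 0 < ρ) (hη : 3 * η ≤ κ * ρ) (T : Finset α) (lab : Ω → α) (hlab : ∀ ω ∈ S, lab ω ∈ T)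
    (hV : ∀ ω ∈ S, V ω ∈ unitary (Mat n)) (hyr : ∀ ω ∈ S, opNorm (y ω) ≤ r)
    (hy : ∀ ω ∈ S, ∀ ω' ∈ S, lab ω = lab ω' →
      twoNorm ntr (V ω * y ω * star (V ω) - V ω' * y ω' * star (V ω')) ≤ ε)
    (hz : ∀ ω ∈ S, ∀ ω' ∈ S, lab ω = lab ω' →
      twoNorm ntr (V ω * z ω * star (V ω) - V ω' * z ω' * star (V ω')) ≤ η)
    (hzD : ∀ ω ∈ S, twoNorm ntr (z ω - D) ≤ η) :
    ∃ (T' : Finset (α × Mat n)) (lab' : Ω → α × Mat n),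
      (T'.card : ℝ) ≤ T.card * (1 + 2 / ρ) ^ (2 * (Finset.univ.filter
        fun p : Fin n × Fin n => |hD.eigenvalues p.1 - hD.eigenvalues p.2| < κ).card) ∧
      (∀ ω ∈ S, lab' ω ∈ T') ∧
      ∀ ω ∈ S, ∀ ω' ∈ S, lab' ω = lab' ω' → twoNorm ntr (y ω - y ω') ≤ ε + 8 * ρ * r := by
  classical
  obtain ⟨t, htc, ht⟩ := exists_finset_cover_commutant hn hD hκ hρ
  open scoped Matrix.Norms.L2Operator in
  have hφ := isTracialState_ntr hn
  have hconj : ∀ U ∈ unitary (Mat n), ∀ A, twoNorm ntr (U * A * star U) = twoNorm ntr A :=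
    fun U hU A => twoNorm_ntr_conj hn hU A
  have hadd : ∀ A B C : Mat n,
      twoNorm ntr (A - C) ≤ twoNorm ntr (A - B) + twoNorm ntr (B - C) :=
    hφ.twoNorm_sub_le_sub_add_sub
  have hsymm : ∀ A B : Mat n, twoNorm ntr (A - B) = twoNorm ntr (B - A) := hφ.twoNorm_sub_comm
  have hleft : ∀ U ∈ unitary (Mat n), ∀ A, twoNorm ntr (U * A) = twoNorm ntr A :=
    fun U hU A => hφ.twoNorm_unitary_mul hU A
  have hright : ∀ U ∈ unitary (Mat n), ∀ A, twoNorm ntr (A * U) = twoNorm ntr A :=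
    fun U hU A => hφ.twoNorm_mul_unitary hU A
  -- A reference point chosen once for each label; the fallback `ω` is never reached for labels
  -- attained on `S`.
  let base : α → Ω → Ω := fun a ω =>
    if h : ∃ ω' ∈ S, lab ω' = a then h.choose else ω
  have hbase : ∀ ω ∈ S, base (lab ω) ω ∈ S ∧ lab (base (lab ω) ω) = lab ω := fun ω hω => by
    have h : ∃ ω' ∈ S, lab ω' = lab ω := ⟨ω, hω, rfl⟩
    simp only [base, dif_pos h]
    exact h.choose_spec
  have hbase' : ∀ ω ∈ S, ∀ ω' ∈ S, lab ω = lab ω' →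
      base (lab ω) ω = base (lab ω') ω' := fun ω hω ω' hω' h => by
    have h1 : ∃ ω'' ∈ S, lab ω'' = lab ω' := ⟨ω', hω', rfl⟩
    simp only [base, h, dif_pos h1]
  -- The commutator of `G ω` with `D` has 2-norm at most `3 η`: `D` is replaced by `z` at `ω` and at
  -- the reference point, and the two conjugates of `z` are compared by means of the common label.
  let G : Ω → Mat n := fun ω => star (V (base (lab ω) ω)) * V ω
  have hG : ∀ ω ∈ S, ∃ g ∈ t, twoNorm ntr (G ω - g) ≤ 2 * ρ := fun ω hω => by
    obtain ⟨hb, hbl⟩ := hbase ω hω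
    set ω' := base (lab ω) ω
    have hVω := hV ω hω
    have hVb := hV ω' hb
    refine ht _ ?_ ?_
    · have h1 : twoNorm ntr (G ω) = 1 := by
        have h2 := hleft _ (mul_mem (Unitary.star_mem hVb) hVω) 1
        rw [mul_one] at h2
        exact h2.trans hφ.twoNorm_one
      exact h1.le
    · have h1 : G ω * D - D * G ω =
          star (V ω') * (V ω * D * star (V ω) - V ω' * D * star (V ω')) * V ω := by
        simp only [G, mul_sub, sub_mul, mul_assoc, (Unitary.mem_iff.1 hVω).1, mul_one]
        simp only [← mul_assoc, (Unitary.mem_iff.1 hVb).1, one_mul]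
        rfl
      rw [h1, hright _ hVω, hleft _ (Unitary.star_mem hVb)]
      have h2 := hadd (V ω * D * star (V ω)) (V ω * z ω * star (V ω)) (V ω' * D * star (V ω'))
      have h3 := hadd (V ω * z ω * star (V ω)) (V ω' * z ω' * star (V ω')) (V ω' * D * star (V ω'))
      have h4 := hz ω hω ω' hb hbl.symm
      rw [← sub_mul, ← mul_sub, hconj _ hVω, hsymm D] at h2
      rw [← sub_mul (V ω' * z ω'), ← mul_sub (V ω'), hconj _ hVb] at h3
      linarith [hzD ω hω, hzD ω' hb]
  let g : Ω → Mat n := fun ω => if h : ∃ g ∈ t, twoNorm ntr (G ω - g) ≤ 2 * ρ then h.choose else 0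
  have hg : ∀ ω ∈ S, g ω ∈ t ∧ twoNorm ntr (G ω - g ω) ≤ 2 * ρ := fun ω hω => by
    simp only [g, dif_pos (hG ω hω)]
    exact (hG ω hω).choose_spec
  refine ⟨T ×ˢ t, fun ω => (lab ω, g ω), ?_, fun ω hω =>
    Finset.mem_product.2 ⟨hlab ω hω, (hg ω hω).1⟩, fun ω hω ω' hω' h => ?_⟩
  · rw [Finset.card_product, Nat.cast_mul]
    exact mul_le_mul_of_nonneg_left htc (Nat.cast_nonneg _)
  · obtain ⟨h1, h2⟩ := Prod.ext_iff.1 h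
    simp only at h1 h2
    have hVω := hV ω hω
    have hVω' := hV ω' hω'
    -- Equal labels mean the same reference unitary and the same net point within `2 ρ` of both `G
    -- ω` and `G ω'`.
    have hVV : twoNorm ntr (V ω - V ω') ≤ 4 * ρ := by
      have h3 := hadd (G ω) (g ω) (G ω')
      have h4 := (hg ω hω).2
      have h5 := (hg ω' hω').2
      rw [hsymm, ← h2] at h5
      have h6 : G ω - G ω' = star (V (base (lab ω) ω)) * (V ω - V ω') := by
        simp only [G, ← hbase' ω hω ω' hω' h1, mul_sub]
      rw [h6, hleft _ (Unitary.star_mem (hV _ (hbase ω hω).1))] at h3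
      linarith
    have hVV' : twoNorm ntr (star (V ω) - star (V ω')) ≤ 4 * ρ := by
      rw [← star_sub]
      exact (hφ.twoNorm_star _).trans_le hVV
    have h3 := hy ω hω ω' hω' h1
    have hYr : opNorm (y ω) ≤ r := hyr ω hω
    have h4 : twoNorm ntr (V ω * y ω * star (V ω) - V ω' * y ω * star (V ω')) ≤ 8 * ρ * r := by
      have h5 := hadd (V ω * y ω * star (V ω)) (V ω' * y ω * star (V ω))
        (V ω' * y ω * star (V ω'))
      rw [← sub_mul, ← sub_mul, ← mul_sub, hright _ (Unitary.star_mem hVω),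
        mul_assoc (V ω') (y ω) (star (V ω) - star (V ω')), hleft _ hVω'] at h5
      have h6 := hφ.twoNorm_mul_le' (V ω - V ω') (y ω)
      have h7 := hφ.twoNorm_mul_le (y ω) (star (V ω) - star (V ω'))
      have h0 : 0 ≤ opNorm (y ω) := norm_nonneg _
      have h8 : twoNorm ntr (V ω - V ω') * opNorm (y ω) ≤ 4 * ρ * r :=
        mul_le_mul hVV hYr h0 (by positivity)
      have h9 : opNorm (y ω) * twoNorm ntr (star (V ω) - star (V ω')) ≤ r * (4 * ρ) :=
        mul_le_mul hYr hVV' (twoNorm_nonneg _ _) (h0.trans hYr)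
      have h6' : twoNorm ntr ((V ω - V ω') * y ω) ≤ twoNorm ntr (V ω - V ω') * opNorm (y ω) := h6
      have h7' : twoNorm ntr (y ω * (star (V ω) - star (V ω'))) ≤
        opNorm (y ω) * twoNorm ntr (star (V ω) - star (V ω')) := h7
      linarith
    have h5 := hconj _ hVω' (y ω - y ω')
    rw [mul_sub, sub_mul] at h5
    rw [← h5]
    have h6 := hadd (V ω' * y ω * star (V ω')) (V ω * y ω * star (V ω))
      (V ω' * y ω' * star (V ω'))
    rw [hsymm] at h4
    linarith

/-! ### Integrals of bounded random variables -/

section Integrals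

/-- The bound `C` is used on the measurable hull of `A` and `a` elsewhere, so `A` itself may fail to
be measurable. -/
theorem integral_le_of_measure_le {Ω : Type*} [MeasurableSpace Ω] {μ : Measure Ω}
    [IsProbabilityMeasure μ] {f : Ω → ℝ} (h0 : ∀ ω, 0 ≤ f ω) {A : Set Ω}
    {a C r : ℝ} (ha : 0 ≤ a) (hC : ∀ ω, f ω ≤ C) (hA : ∀ ω, ω ∉ A → f ω ≤ a) (hr : 0 ≤ r)
    (hμ : μ A ≤ ENNReal.ofReal r) : ∫ ω, f ω ∂μ ≤ a + C * r := by
  have hC0 : 0 ≤ C := by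
    have : Nonempty Ω := by
      by_contra h
      rw [not_nonempty_iff] at h
      have h1 := measure_univ (μ := μ)
      rw [Set.eq_empty_of_isEmpty (Set.univ : Set Ω), measure_empty] at h1
      exact zero_ne_one h1
    exact (h0 (Classical.arbitrary Ω)).trans (hC _)
  set B := toMeasurable μ A
  have hB : MeasurableSet B := measurableSet_toMeasurable μ A
  have hint : Integrable (B.indicator fun _ => C) μ := (integrable_const C).indicator hB
  calc ∫ ω, f ω ∂μ ≤ ∫ ω, (a + B.indicator (fun _ => C) ω) ∂μ := by
        refine integral_mono_of_nonneg (ae_of_all _ h0) ((integrable_const a).add hint)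
          (ae_of_all _ fun ω => ?_)
        by_cases h : ω ∈ B
        · simpa [h] using (hC ω).trans (by linarith)
        · simpa [h] using hA ω fun h' => h (subset_toMeasurable μ A h')
    _ = a + μ.real B * C := by
        rw [integral_add (integrable_const a) hint, integral_indicator_const _ hB]
        simp
    _ ≤ a + C * r := by
        have h1 : μ.real B ≤ r := by
          rw [Measure.real, measure_toMeasurable]
          exact ENNReal.toReal_le_of_le_ofReal hr hμ
        nlinarith

/-- Bounded convergence in probability, for probability spaces that vary with `k`. -/
theorem tendsto_integral_of_tendsto_measure {Ω : ℕ → Type*} [∀ k, MeasurableSpace (Ω k)]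
    {μ : ∀ k, Measure (Ω k)} [∀ k, IsProbabilityMeasure (μ k)] {f : ∀ k, Ω k → ℝ} {c C : ℝ}
    (hf : ∀ k, Measurable (f k)) (hC : ∀ᶠ k in atTop, ∀ ω, |f k ω - c| ≤ C)
    (h : ∀ ε : ℝ, 0 < ε → Tendsto (fun k => μ k {ω | ε ≤ |f k ω - c|}) atTop (𝓝 0)) :
    Tendsto (fun k => ∫ ω, f k ω ∂(μ k)) atTop (𝓝 c) := by
  rw [Metric.tendsto_atTop']
  intro ε hε
  have hC1 : 0 < |C| + 1 := by positivity
  have hr : 0 < ε / 3 / (|C| + 1) := by positivity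
  have h1 := (h (ε / 3) (by positivity)).eventually_lt_const (ENNReal.ofReal_pos.2 hr)
  obtain ⟨K, hK⟩ := eventually_atTop.1 (h1.and hC)
  refine ⟨K, fun k hk => ?_⟩
  obtain ⟨h2, h3⟩ := hK k hk.le
  have hint : Integrable (f k) (μ k) := by
    refine Integrable.of_bound (hf k).aestronglyMeasurable (C + |c|) (ae_of_all _ fun ω => ?_)
    calc ‖f k ω‖ = |(f k ω - c) + c| := by simp
      _ ≤ _ := (abs_add_le _ _).trans (by linarith [h3 ω])
  have h4 : ∫ ω, f k ω ∂(μ k) - c = ∫ ω, (f k ω - c) ∂(μ k) := by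
    rw [integral_sub hint (integrable_const c)]
    simp
  rw [Real.dist_eq, h4]
  refine (abs_integral_le_integral_abs).trans_lt ?_
  refine (integral_le_of_measure_le (fun ω => abs_nonneg _) (a := ε / 3) (by positivity)
    (C := |C| + 1) (fun ω => (h3 ω).trans ((le_abs_self C).trans (by linarith)))
    (A := {ω | ε / 3 ≤ |f k ω - c|}) (fun ω hω => (not_le.1 hω).le) hr.le h2.le).trans_lt ?_
  rw [mul_div_cancel₀ _ hC1.ne']
  linarith

theorem integral_norm_sub_sq {Ω : Type*} [MeasurableSpace Ω] {μ : Measure Ω}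
    [IsProbabilityMeasure μ] {f : Ω → ℂ} (hf : Measurable f) {C : ℝ} (hC : ∀ ω, ‖f ω‖ ≤ C) (b : ℂ) :
    ∫ ω, ‖f ω - b‖ ^ 2 ∂μ = ∫ ω, ‖f ω‖ ^ 2 ∂μ - ‖∫ ω, f ω ∂μ‖ ^ 2 + ‖∫ ω, f ω ∂μ - b‖ ^ 2 := by
  have hint : Integrable f μ := Integrable.of_bound hf.aestronglyMeasurable C (ae_of_all _ hC)
  have hint2 : Integrable (fun ω => ‖f ω‖ ^ 2) μ := by
    refine Integrable.of_bound (hf.norm.pow_const 2).aestronglyMeasurable (C ^ 2)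
      (ae_of_all _ fun ω => ?_)
    rw [Real.norm_of_nonneg (by positivity)]
    gcongr
    exact hC ω
  have hi : Integrable (fun ω => 2 * ⟪f ω, b⟫_ℝ) μ := by
    refine Integrable.const_mul ?_ 2
    exact hint.inner_const b
  have h1 : ∀ ω, ‖f ω - b‖ ^ 2 = ‖f ω‖ ^ 2 - 2 * ⟪f ω, b⟫_ℝ + ‖b‖ ^ 2 :=
    fun ω => norm_sub_sq_real _ _
  have h2 : ∫ ω, ⟪f ω, b⟫_ℝ ∂μ = ⟪∫ ω, f ω ∂μ, b⟫_ℝ := by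
    simp_rw [real_inner_comm b]
    exact integral_inner hint b
  simp_rw [h1]
  have h3 : Integrable (fun ω => ‖f ω‖ ^ 2 - 2 * ⟪f ω, b⟫_ℝ) μ := hint2.sub hi
  rw [integral_add h3 (integrable_const _), integral_sub hint2 hi,
    integral_const_mul, h2, norm_sub_sq_real]
  simp only [integral_const, probReal_univ, one_smul]
  ring

end Integrals

/-! ### Random matrices -/

section RandomMatrix

instance secondCountableTopologyMat (n : ℕ) : SecondCountableTopology (Mat n) :=
  inferInstanceAs (SecondCountableTopology (Fin n → Fin n → ℂ))

theorem continuous_twoNorm_ntr (n : ℕ) : Continuous fun A : Mat n => twoNorm ntr A := by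
  have : (fun A : Mat n => twoNorm ntr A) =
      fun A : Mat n => √((n : ℝ)⁻¹ * ∑ a, ∑ b, ‖A a b‖ ^ 2) := by
    funext A
    rw [← twoNorm_ntr_sq, Real.sqrt_sq (twoNorm_nonneg _ _)]
  rw [this]
  have h (a b : Fin n) : Continuous fun A : Mat n => A a b :=
    (continuous_apply b).comp (continuous_apply a)
  fun_prop

theorem measurable_lift {Ω ι : Type*} [MeasurableSpace Ω] {n : ℕ} {X : ι → Ω → MatSA n}
    (hX : ∀ i, Measurable (X i)) (p : FreeAlgebra ℂ ι) :
    Measurable fun ω => FreeAlgebra.lift ℂ (fun i => (X i ω : Mat n)) p := by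
  induction p using FreeAlgebra.induction with
  | grade0 c => simp
  | grade1 i => simpa using (hX i).subtype_val
  | mul p q hp hq =>
    simp only [map_mul]
    exact hp.mul hq
  | add p q hp hq =>
    simp only [map_add]
    exact hp.add hq

/-- The bias–variance identity, summed over the entries. With `B` the mean it computes the variance,
and it shows that the mean minimizes the mean square distance to a constant matrix. -/
theorem integral_twoNorm_sub_sq {Ω : Type*} [MeasurableSpace Ω] {μ : Measure Ω}
    [IsProbabilityMeasure μ] {n : ℕ} {f : Ω → Mat n} (hf : Measurable f) {C : ℝ}
    (hC : ∀ ω, twoNorm ntr (f ω) ≤ C) (B : Mat n) :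
    ∫ ω, twoNorm ntr (f ω - B) ^ 2 ∂μ = ∫ ω, twoNorm ntr (f ω) ^ 2 ∂μ
      - twoNorm ntr (Matrix.of fun a b => ∫ ω, f ω a b ∂μ) ^ 2
      + twoNorm ntr ((Matrix.of fun a b => ∫ ω, f ω a b ∂μ) - B) ^ 2 := by
  have hm (a b : Fin n) : Measurable fun ω => f ω a b := by
    have h : Continuous fun A : Mat n => A a b := continuous_id.matrix_elem a b
    exact h.measurable.comp hf
  have hb (a b : Fin n) (ω : Ω) : ‖f ω a b‖ ≤ √n * C := by
    have hn : 0 < (n : ℝ) := by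
      have := a.pos
      exact_mod_cast this
    have hC0 : 0 ≤ C := (twoNorm_nonneg _ _).trans (hC ω)
    refine abs_le_of_sq_le_sq' ?_ (by positivity) |>.2
    have h1 : ‖f ω a b‖ ^ 2 ≤ ∑ a, ∑ b, ‖f ω a b‖ ^ 2 :=
      (Finset.single_le_sum (f := fun b => ‖f ω a b‖ ^ 2) (fun _ _ => by positivity)
        (Finset.mem_univ b)).trans
      (Finset.single_le_sum (f := fun a => ∑ b, ‖f ω a b‖ ^ 2) (fun _ _ => by positivity)
        (Finset.mem_univ a))
    have h2 : twoNorm ntr (f ω) ^ 2 ≤ C ^ 2 := by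
      gcongr
      · exact twoNorm_nonneg _ _
      · exact hC ω
    rw [twoNorm_ntr_sq, inv_mul_le_iff₀ hn] at h2
    rw [mul_pow, Real.sq_sqrt hn.le]
    exact h1.trans h2
  have hi (a b : Fin n) (c : ℂ) : Integrable (fun ω => ‖f ω a b - c‖ ^ 2) μ := by
    refine Integrable.of_bound (((hm a b).sub_const c).norm.pow_const 2).aestronglyMeasurable
      ((√n * C + ‖c‖) ^ 2) (ae_of_all _ fun ω => ?_)
    rw [Real.norm_of_nonneg (by positivity)]
    gcongr
    exact (norm_sub_le _ _).trans (add_le_add_left (hb a b ω) _)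
  have hi' (a b : Fin n) : Integrable (fun ω => ‖f ω a b‖ ^ 2) μ := by simpa using hi a b 0
  have h1 : ∫ ω, twoNorm ntr (f ω) ^ 2 ∂μ = (n : ℝ)⁻¹ * ∑ a, ∑ b, ∫ ω, ‖f ω a b‖ ^ 2 ∂μ := by
    simp_rw [twoNorm_ntr_sq]
    rw [integral_const_mul, integral_finsetSum _ fun a _ => integrable_finsetSum _ fun b _ => hi' a b]
    congr 1
    exact Finset.sum_congr rfl fun a _ => integral_finsetSum _ fun b _ => hi' a b
  have h2 : ∫ ω, twoNorm ntr (f ω - B) ^ 2 ∂μ =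
      (n : ℝ)⁻¹ * ∑ a, ∑ b, ∫ ω, ‖f ω a b - B a b‖ ^ 2 ∂μ := by
    simp_rw [twoNorm_ntr_sq]
    rw [integral_const_mul]
    have h3 : ∫ ω, ∑ a, ∑ b, ‖(f ω - B) a b‖ ^ 2 ∂μ = ∑ a, ∫ ω, ∑ b, ‖f ω a b - B a b‖ ^ 2 ∂μ :=
      integral_finsetSum _ fun a _ => integrable_finsetSum _ fun b _ => hi a b _
    rw [h3]
    congr 1
    exact Finset.sum_congr rfl fun a _ => integral_finsetSum _ fun b _ => hi a b _
  rw [h1, h2, twoNorm_ntr_sq, twoNorm_ntr_sq, ← mul_sub, ← mul_add, ← Finset.sum_sub_distrib,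
    ← Finset.sum_add_distrib]
  congr 1
  refine Finset.sum_congr rfl fun a _ => ?_
  rw [← Finset.sum_sub_distrib, ← Finset.sum_add_distrib]
  exact Finset.sum_congr rfl fun b _ => integral_norm_sub_sq (hm a b) (hb a b) _

end RandomMatrix

/-! ### Concentration -/

section Concentration

theorem ENNReal.lt_ofReal_exp_of_log_div_lt {a : ENNReal} {t c : ℝ} (ht : 0 < t)
    (h : ENNReal.log a / (t : EReal) < (c : EReal)) : a < ENNReal.ofReal (Real.exp (c * t)) := by
  rw [EReal.div_lt_iff (by exact_mod_cast ht) (EReal.coe_ne_top _), ← EReal.coe_mul] at h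
  rw [← ENNReal.log_lt_log_iff, ENNReal.log_ofReal_of_pos (Real.exp_pos _), Real.log_exp]
  exact h

variable {ι : Type*} {n : ℕ}

theorem isOpen_nhd [Finite ι] (F : Finset ι) (ε : ℝ) (S : Set (ι → MatSA n)) :
    IsOpen (nhd F ε S) := by
  have : nhd F ε S = ⋃ A ∈ S, ⋂ i ∈ F,
      {B | twoNorm ntr ((A i : Mat n) - (B i : Mat n)) < ε} := by
    ext B
    simp [nhd]
  rw [this]
  refine isOpen_biUnion fun A _ => isOpen_biInter_finset fun i _ => ?_
  refine isOpen_lt ((continuous_twoNorm_ntr n).comp ?_) continuous_const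
  exact continuous_const.sub (continuous_subtype_val.comp (continuous_apply i))

-- Were the neighborhood of `S` of measure below `1/2`, its complement would have measure at least
-- `1/2` with a neighborhood missing `S`, forcing `ν S` below the concentration function. So one
-- enlargement reaches measure `1/2` and the second one almost everything.
open scoped Matrix.Norms.L2Operator in
theorem measure_compl_nhd_nhd_le [Finite ι] (hn : 0 < n) (ν : Measure (ι → MatSA n))
    [IsProbabilityMeasure ν] (F : Finset ι) (ε : ℝ) {S : Set (ι → MatSA n)}
    (hS : concFun ν F ε < ν S) : ν (nhd F ε (nhd F ε S))ᶜ ≤ concFun ν F ε := by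
  have hle {T : Set (ι → MatSA n)} (hT : MeasurableSet T) (h : 1 / 2 ≤ ν T) :
      ν (nhd F ε T)ᶜ ≤ concFun ν F ε := le_iSup₂_of_le T ⟨hT, h⟩ le_rfl
  have hm : MeasurableSet (nhd F ε S) := by
    cases nonempty_fintype ι
    exact (isOpen_nhd F ε S).measurableSet
  by_cases h : 1 / 2 ≤ ν (nhd F ε S)
  · exact hle hm h
  · have hT : 1 / 2 ≤ ν (nhd F ε S)ᶜ := by
      rw [prob_compl_eq_one_sub hm]
      have h1 : ν (nhd F ε S) ≤ 1 / 2 := (not_le.1 h).le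
      calc (1 / 2 : ENNReal) = 1 - 1 / 2 := by
            rw [one_div, ENNReal.one_sub_inv_two]
        _ ≤ 1 - ν (nhd F ε S) := tsub_le_tsub_left h1 1
    refine absurd (hle hm.compl hT) (not_le.2 (hS.trans_le (measure_mono fun A hA => ?_)))
    rintro ⟨B, hB, hAB⟩
    refine hB ⟨A, hA, fun i hi => ?_⟩
    have h1 : twoNorm ntr ((A i : Mat n) - (B i : Mat n)) =
      twoNorm ntr ((B i : Mat n) - (A i : Mat n)) := (isTracialState_ntr hn).twoNorm_sub_comm _ _
    rw [h1]
    exact hAB i hi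

end Concentration

/-! ### Bounded random matrix models -/

section Model

variable {H : Type*} [NormedAddCommGroup H] [InnerProductSpace ℂ H] [CompleteSpace H]

attribute [local instance] VonNeumannAlgebra.cstarAlgebra

/-- The value of a non-commutative polynomial at a tuple of self-adjoint matrices. -/
abbrev evalMat {I : Type*} {n : ℕ} (a : I → MatSA n) (p : FreeAlgebra ℂ I) : Mat n :=
  FreeAlgebra.lift ℂ (fun i => (a i : Mat n)) p

/-- The mean of a random matrix. -/
abbrev meanMat {Ω : Type*} [MeasurableSpace Ω] (μ : Measure Ω) {n : ℕ} (f : Ω → Mat n) : Mat n :=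
  Matrix.of fun a b => ∫ ω, f ω a b ∂μ

/-- Uniformly bounded random matrix models for the tuple `x`. -/
structure IsMatrixModel {M : VonNeumannAlgebra H} (τ : M.toStarSubalgebra →ₗ[ℂ] ℂ)
    {I : Type*} (x : I → M.toStarSubalgebra) {n : ℕ → ℕ} {Ω : ℕ → Type*}
    [∀ k, MeasurableSpace (Ω k)] (μ : ∀ k, Measure (Ω k)) (X : ∀ k, I → Ω k → MatSA (n k))
    (R : I → ℝ) : Prop where
  isSelfAdjoint : ∀ i, IsSelfAdjoint (x i)
  tendsto_size : Tendsto n atTop atTop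
  measurable : ∀ k i, Measurable (X k i)
  opNorm_le : ∀ k i ω, opNorm (X k i ω : Mat (n k)) ≤ R i
  tendsto_law : ∀ p : FreeAlgebra ℂ I, ∀ ε : ℝ, 0 < ε →
      Tendsto (fun k => μ k {ω | ε ≤
        ‖ntr (FreeAlgebra.lift ℂ (fun i => (X k i ω : Mat (n k))) p) -
          τ (FreeAlgebra.lift ℂ x p)‖}) atTop (𝓝 0)

namespace IsMatrixModel

variable {M : VonNeumannAlgebra H} {τ : M.toStarSubalgebra →ₗ[ℂ] ℂ}
  (hτ : IsFaithfulNormalTracialState M τ) {I : Type*} {x : I → M.toStarSubalgebra} {n : ℕ → ℕ}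
  {Ω : ℕ → Type*} [∀ k, MeasurableSpace (Ω k)] {μ : ∀ k, Measure (Ω k)}
  {X : ∀ k, I → Ω k → MatSA (n k)} {R : I → ℝ} (h : IsMatrixModel τ x μ X R)

include h

theorem eventually_pos : ∀ᶠ k in atTop, 0 < n k := h.tendsto_size.eventually_gt_atTop 0

theorem measurable_evalMat (k : ℕ) (p : FreeAlgebra ℂ I) :
    Measurable fun ω => evalMat (fun i => X k i ω) p :=
  measurable_lift (h.measurable k) p

open scoped Matrix.Norms.L2Operator in
theorem exists_twoNorm_evalMat_le (p : FreeAlgebra ℂ I) :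
    ∃ C, 0 ≤ C ∧ ∀ k, 0 < n k → ∀ ω, twoNorm ntr (evalMat (fun i => X k i ω) p) ≤ C := by
  obtain ⟨C, F, hC, hF⟩ := exists_bound_lift_mat R p
  refine ⟨C, hC, fun k hk ω => ?_⟩
  have h1 : twoNorm ntr (evalMat (fun i => X k i ω) p) ≤ ‖evalMat (fun i => X k i ω) p‖ :=
    (isTracialState_ntr hk).twoNorm_le_norm _
  exact h1.trans (hF (n k) hk _ fun i => h.opNorm_le k i ω).1

open scoped Matrix.Norms.L2Operator in
include hτ in
theorem abs_twoNorm_sq_sub_le {k : ℕ} (hk : 0 < n k) (p : FreeAlgebra ℂ I) (ω : Ω k) :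
    |twoNorm ntr (evalMat (fun i => X k i ω) p) ^ 2 - twoNorm τ (FreeAlgebra.lift ℂ x p) ^ 2| ≤
      ‖ntr (FreeAlgebra.lift ℂ (fun i => (X k i ω : Mat (n k))) (ncStar p * p)) -
          τ (FreeAlgebra.lift ℂ x (ncStar p * p))‖ := by
  have h1 : (ntr (star (evalMat (fun i => X k i ω) p) * evalMat (fun i => X k i ω) p)).re =
      twoNorm ntr (evalMat (fun i => X k i ω) p) ^ 2 :=
    (isTracialState_ntr hk).re_map_star_mul_self _
  rw [map_mul, map_mul, lift_ncStar h.isSelfAdjoint, lift_ncStar fun i => (X k i ω).2, ← h1,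
    ← hτ.isTracialState.re_map_star_mul_self, ← Complex.sub_re]
  exact Complex.abs_re_le_norm _

-- The squared 2-norm of a polynomial is the law evaluated at `p* p`.
include hτ in
theorem tendsto_measure_twoNorm_sq (p : FreeAlgebra ℂ I) {ε : ℝ} (hε : 0 < ε) :
    Tendsto (fun k => μ k {ω | ε ≤ |twoNorm ntr (evalMat (fun i => X k i ω) p) ^ 2 -
      twoNorm τ (FreeAlgebra.lift ℂ x p) ^ 2|}) atTop (𝓝 0) := by
  refine tendsto_of_tendsto_of_tendsto_of_le_of_le' tendsto_const_nhds
    (h.tendsto_law (ncStar p * p) ε hε) (Eventually.of_forall fun k => zero_le) ?_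
  filter_upwards [h.eventually_pos] with k hk
  exact measure_mono fun ω hω => le_trans hω (h.abs_twoNorm_sq_sub_le hτ hk p ω)

variable [∀ k, IsProbabilityMeasure (μ k)]

include hτ in
theorem tendsto_integral_twoNorm_sq (p : FreeAlgebra ℂ I) :
    Tendsto (fun k => ∫ ω, twoNorm ntr (evalMat (fun i => X k i ω) p) ^ 2 ∂(μ k)) atTop
      (𝓝 (twoNorm τ (FreeAlgebra.lift ℂ x p) ^ 2)) := by
  obtain ⟨C, hC, hle⟩ := h.exists_twoNorm_evalMat_le p
  refine tendsto_integral_of_tendsto_measure (C := C ^ 2 + twoNorm τ (FreeAlgebra.lift ℂ x p) ^ 2)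
    (fun k => (((continuous_twoNorm_ntr _).measurable.comp
      (h.measurable_evalMat k p)).pow_const 2)) ?_
    fun ε hε => h.tendsto_measure_twoNorm_sq hτ p hε
  filter_upwards [h.eventually_pos] with k hk ω
  have h1 := hle k hk ω
  have h2 : twoNorm ntr (evalMat (fun i => X k i ω) p) ^ 2 ≤ C ^ 2 := by
    have := twoNorm_nonneg ntr (evalMat (fun i => X k i ω) p)
    gcongr
  rw [abs_le]
  constructor <;> nlinarith [sq_nonneg (twoNorm ntr (evalMat (fun i => X k i ω) p)),
    sq_nonneg (twoNorm τ (FreeAlgebra.lift ℂ x p)), sq_nonneg C]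

variable {P : VonNeumannAlgebra H} (hPM : P ≤ M)

-- The variance is the second moment minus the squared 2-norm of the mean. These converge to `‖a‖₂²`
-- and `‖E_P a‖₂²` for `a = p(x)`, and Pythagoras combines the limits.
include hτ hPM in
theorem tendsto_integral_twoNorm_sub_meanMat_sq {p : FreeAlgebra ℂ I}
    (hp : Tendsto (fun k => twoNorm ntr (meanMat (μ k) fun ω => evalMat (fun i => X k i ω) p)) atTop
      (𝓝 (twoNorm τ (condExpTr τ P (FreeAlgebra.lift ℂ x p))))) :
    Tendsto (fun k => ∫ ω, twoNorm ntr (evalMat (fun i => X k i ω) p -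
        meanMat (μ k) fun ω => evalMat (fun i => X k i ω) p) ^ 2 ∂(μ k)) atTop
      (𝓝 (twoNorm τ (FreeAlgebra.lift ℂ x p - condExpTr τ P (FreeAlgebra.lift ℂ x p)) ^ 2)) := by
  rw [hτ.twoNorm_sub_condExpTr_sq hPM]
  refine ((h.tendsto_integral_twoNorm_sq hτ p).sub (hp.pow 2)).congr' ?_
  obtain ⟨C, hC, hle⟩ := h.exists_twoNorm_evalMat_le p
  filter_upwards [h.eventually_pos] with k hk
  have h1 := integral_twoNorm_sub_sq (μ := μ k) (h.measurable_evalMat k p) (hle k hk)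
    (meanMat (μ k) fun ω => evalMat (fun i => X k i ω) p)
  rw [sub_self] at h1
  have h2 : twoNorm ntr (0 : Mat (n k)) = 0 := by simp [twoNorm, ntr]
  rw [h1, h2]
  simp [evalMat]

-- A ball whose probability beats the concentration function captures, after enlargement, almost all
-- mass of `p(X)`. This bounds the variance of `p(X)`, whose limit is the squared left side.
open scoped Matrix.Norms.L2Operator in
include hτ hPM in
theorem twoNorm_sub_condExpTr_le_of_ball
    (hconc : ∀ F : Finset I, HasExpConcentration (n := n)
      fun k => (μ k).map fun ω (i : F) => X k i ω)
    {p : FreeAlgebra ℂ I}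
    (hp : Tendsto (fun k => twoNorm ntr (meanMat (μ k) fun ω => evalMat (fun i => X k i ω) p)) atTop
      (𝓝 (twoNorm τ (condExpTr τ P (FreeAlgebra.lift ℂ x p)))))
    {ε : ℝ} (hε : 0 < ε)
    (hball : ∀ c : ℝ, 0 < c → ∀ᶠ k in atTop, ∃ B : Mat (n k),
      ENNReal.ofReal (Real.exp (-c * (n k : ℝ) ^ 2)) ≤
        μ k {ω | twoNorm ntr (evalMat (fun i => X k i ω) p - B) ≤ ε}) :
    twoNorm τ (FreeAlgebra.lift ℂ x p - condExpTr τ P (FreeAlgebra.lift ℂ x p)) ≤ 2 * ε := by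
  obtain ⟨C, F, hC, hF⟩ := exists_bound_lift_mat R p
  -- Two enlargements by this radius move `p(X)` by at most `ε`, since `C` is a Lipschitz constant;
  -- the point then lies within `2 ε` of `B`.
  have hε' : 0 < ε / (2 * (C + 1)) := by positivity
  obtain ⟨c, hc0, hc1⟩ := EReal.lt_iff_exists_real_btwn.1 (hconc F Finset.univ _ hε')
  have hc1' : c < 0 := by exact_mod_cast hc1
  have hev := eventually_lt_of_limsup_lt hc0
  have hlim := h.tendsto_integral_twoNorm_sub_meanMat_sq hτ hPM hp
  have hn2 : Tendsto (fun k => (n k : ℝ) ^ 2) atTop atTop :=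
    (tendsto_pow_atTop two_ne_zero).comp (tendsto_natCast_atTop_atTop.comp h.tendsto_size)
  have hexp : Tendsto (fun k => (2 * ε) ^ 2 + (2 * C + ε) ^ 2 * Real.exp (c * (n k : ℝ) ^ 2)) atTop
      (𝓝 ((2 * ε) ^ 2 + (2 * C + ε) ^ 2 * 0)) :=
    tendsto_const_nhds.add (tendsto_const_nhds.mul
      (Real.tendsto_exp_atBot.comp (hn2.const_mul_atTop_of_neg hc1')))
  rw [mul_zero, add_zero] at hexp
  refine (sq_le_sq₀ (twoNorm_nonneg _ _) (by positivity)).1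
    (le_of_tendsto_of_tendsto hlim hexp ?_)
  filter_upwards [h.eventually_pos, hev, hball (-c) (by linarith)] with k hk hlt ⟨B, hB⟩
  rw [neg_neg] at hB
  have hφ := isTracialState_ntr hk
  have hn0 : 0 < (n k : ℝ) ^ 2 := by positivity
  have hα := ENNReal.lt_ofReal_exp_of_log_div_lt hn0 hlt
  set f : Ω k → Mat (n k) := fun ω => evalMat (fun i => X k i ω) p with hf
  set S := {ω | twoNorm ntr (f ω - B) ≤ ε}
  set XF : Ω k → F → MatSA (n k) := fun ω i => X k i ω with hXF
  set δ := ε / (2 * (C + 1))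
  have hXFm : Measurable XF := measurable_pi_lambda _ fun i => h.measurable k i
  have : IsProbabilityMeasure ((μ k).map XF) := Measure.isProbabilityMeasure_map hXFm.aemeasurable
  -- The image of `S` need not be measurable; its outer measure suffices because its neighborhoods
  -- are open.
  have hS : concFun ((μ k).map XF) Finset.univ δ < (μ k).map XF (XF '' S) :=
    (hα.trans_le hB).trans_le (Measure.le_map_apply_image hXFm.aemeasurable S)
  have hbad := (Measure.le_map_apply hXFm.aemeasurable _).trans
    ((measure_compl_nhd_nhd_le hk _ _ _ hS).trans hα.le)
  have hbd : ∀ ω, twoNorm ntr (f ω) ≤ C := fun ω => by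
    have h1 : twoNorm ntr (f ω) ≤ ‖f ω‖ := hφ.twoNorm_le_norm _
    exact h1.trans (hF (n k) hk _ fun i => h.opNorm_le k i ω).1
  obtain ⟨ω₀, hω₀⟩ : S.Nonempty := by
    by_contra hne
    rw [Set.not_nonempty_iff_eq_empty] at hne
    rw [hne, measure_empty] at hB
    exact absurd hB (not_le.2 (ENNReal.ofReal_pos.2 (Real.exp_pos _)))
  have htri : ∀ a b c : Mat (n k), twoNorm ntr (a - c) ≤
      twoNorm ntr (a - b) + twoNorm ntr (b - c) := fun a b c =>
    hφ.twoNorm_sub_le_sub_add_sub a b c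
  have hcomm : ∀ a b : Mat (n k), twoNorm ntr (a - b) = twoNorm ntr (b - a) :=
    fun a b => hφ.twoNorm_sub_comm a b
  have hsub : ∀ a b : Mat (n k), twoNorm ntr (a - b) ≤ twoNorm ntr a + twoNorm ntr b :=
    fun a b => hφ.twoNorm_sub_le a b
  have hfm : Measurable f := h.measurable_evalMat k p
  have hEB : ∫ ω, twoNorm ntr (f ω - meanMat (μ k) f) ^ 2 ∂(μ k) ≤
      ∫ ω, twoNorm ntr (f ω - B) ^ 2 ∂(μ k) := by
    rw [integral_twoNorm_sub_sq hfm hbd, integral_twoNorm_sub_sq hfm hbd B, sub_self]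
    have h2 : twoNorm ntr (0 : Mat (n k)) = 0 := by simp [twoNorm, ntr]
    rw [h2]
    nlinarith [sq_nonneg (twoNorm ntr ((Matrix.of fun a b => ∫ ω, f ω a b ∂(μ k)) - B))]
  refine hEB.trans (integral_le_of_measure_le (fun ω => sq_nonneg _) (by positivity) ?_ ?_
    (Real.exp_pos _).le hbad)
  · intro ω
    have h1 := htri (f ω) (f ω₀) B
    have h2 := hsub (f ω) (f ω₀)
    have h3 : twoNorm ntr (f ω₀ - B) ≤ ε := hω₀
    have h4 := twoNorm_nonneg ntr (f ω - B)
    have h5 := hbd ω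
    have h6 := hbd ω₀
    gcongr
    linarith
  · intro ω hω
    obtain ⟨A, ⟨A', ⟨ω₁, hω₁, rfl⟩, hA'⟩, hA⟩ := not_not.1 hω
    have h1 : twoNorm ntr (f ω₁ - f ω) ≤ C * (2 * δ) := by
      refine (hF (n k) hk _ fun i => h.opNorm_le k i ω₁).2 _ (fun i => h.opNorm_le k i ω) _
        (by positivity) fun i hi => ?_
      have h2 := htri (X k i ω₁) (A ⟨i, hi⟩) (X k i ω)
      have h3 := hA' ⟨i, hi⟩ (Finset.mem_univ _)
      have h4 := hA ⟨i, hi⟩ (Finset.mem_univ _)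
      simp only [hXF] at h3 h4
      linarith
    have h2 : C * (2 * δ) ≤ ε := by
      have : δ * (2 * (C + 1)) = ε := div_mul_cancel₀ _ (by positivity)
      nlinarith
    have h3 := htri (f ω) (f ω₁) B
    rw [hcomm] at h1
    have h4 : twoNorm ntr (f ω₁ - B) ≤ ε := hω₁
    have h5 := twoNorm_nonneg ntr (f ω - B)
    gcongr
    linarith

end IsMatrixModel

end Model

/-! ### Polynomial approximations of generators yield microstates -/

section Microstates

variable {H : Type*} [NormedAddCommGroup H] [InnerProductSpace ℂ H] [CompleteSpace H]

attribute [local instance] VonNeumannAlgebra.cstarAlgebra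

theorem lift_aeval_map {ι A : Type*} [Ring A] [Algebra ℂ A] [Algebra ℝ A] [IsScalarTower ℝ ℂ A]
    (a : ι → A) (q : Polynomial ℝ) (p : FreeAlgebra ℂ ι) :
    FreeAlgebra.lift ℂ a (Polynomial.aeval p (q.map (algebraMap ℝ ℂ))) =
      Polynomial.aeval (FreeAlgebra.lift ℂ a p) q := by
  rw [← Polynomial.aeval_algHom_apply, Polynomial.aeval_map_algebraMap]

theorem lift_joint {A I J K : Type*} [Ring A] [Algebra ℂ A] (a : K → A) (p : I → FreeAlgebra ℂ K)
    (q : J → FreeAlgebra ℂ K) (r : FreeAlgebra ℂ K) (g : FreeAlgebra ℂ (I ⊕ J ⊕ Unit)) :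
    FreeAlgebra.lift ℂ a (FreeAlgebra.lift ℂ (joint p q r) g) =
      FreeAlgebra.lift ℂ (joint (fun i => FreeAlgebra.lift ℂ a (p i))
        (fun j => FreeAlgebra.lift ℂ a (q j)) (FreeAlgebra.lift ℂ a r)) g := by
  rw [lift_lift]
  congr 2
  funext i
  rcases i with i | i | i <;> rfl

theorem ntr_conj {n : ℕ} {V : Mat n} (hV : V ∈ unitary (Mat n)) (A : Mat n) :
    ntr (V * A * star V) = ntr A := by
  rw [ntr, ntr, Matrix.trace_mul_comm, ← mul_assoc, (Unitary.mem_iff.1 hV).1, one_mul]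

open scoped Matrix.Norms.L2Operator in
theorem opNorm_conj {n : ℕ} {V : Mat n} (hV : V ∈ unitary (Mat n)) (A : Mat n) :
    opNorm (V * A * star V) = opNorm A :=
  (CStarRing.norm_mul_mem_unitary (V * A) (Unitary.star_mem hV)).trans
    (CStarRing.norm_mem_unitary_mul A hV)

theorem lift_conj {ι : Type*} {n : ℕ} {V : Mat n} (hV : V ∈ unitary (Mat n)) (a : ι → Mat n)
    (g : FreeAlgebra ℂ ι) :
    FreeAlgebra.lift ℂ (fun i => V * a i * star V) g = V * FreeAlgebra.lift ℂ a g * star V :=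
  (map_lift (Unitary.conjStarAlgAut ℂ (Mat n) ⟨V, hV⟩).toAlgEquiv.toAlgHom a g).symm

open scoped Matrix.Norms.L2Operator in
/-- Common Lipschitz constants for finitely many non-commutative polynomials. -/
theorem exists_lipschitz {M : VonNeumannAlgebra H} {τ : M.toStarSubalgebra →ₗ[ℂ] ℂ}
    (hτ : IsFaithfulNormalTracialState M τ) {ι : Type*} (R : ι → ℝ)
    (G : Finset (FreeAlgebra ℂ ι)) :
    ∃ K : ℝ, 0 < K ∧ ∀ g ∈ G,
      (∀ a b : ι → M.toStarSubalgebra, (∀ i, ‖a i‖ ≤ R i) → (∀ i, ‖b i‖ ≤ R i) → ∀ ε : ℝ, 0 ≤ ε →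
        (∀ i, twoNorm τ (a i - b i) ≤ ε) →
        twoNorm τ (FreeAlgebra.lift ℂ a g - FreeAlgebra.lift ℂ b g) ≤ K * ε) ∧
      ∀ n : ℕ, 0 < n → ∀ a b : ι → Mat n, (∀ i, opNorm (a i) ≤ R i) →
        (∀ i, opNorm (b i) ≤ R i) → ∀ ε : ℝ, 0 ≤ ε → (∀ i, twoNorm ntr (a i - b i) ≤ ε) →
        twoNorm ntr (FreeAlgebra.lift ℂ a g - FreeAlgebra.lift ℂ b g) ≤ K * ε := by
  classical
  choose C F hC hF using exists_bound_lift_mat R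
  choose C' F' hC' hF' using exists_bound_lift (κ := Unit) (A := fun _ => M.toStarSubalgebra)
    (φ := fun _ => τ) (fun _ => hτ.isTracialState) R
  have h0 : 0 ≤ ∑ g ∈ G, (C g + C' g) := Finset.sum_nonneg fun g _ => add_nonneg (hC g) (hC' g)
  refine ⟨∑ g ∈ G, (C g + C' g) + 1, by linarith, fun g hg => ?_⟩
  have h1 : C g + C' g ≤ ∑ g ∈ G, (C g + C' g) :=
    Finset.single_le_sum (f := fun g => C g + C' g) (fun g _ => add_nonneg (hC g) (hC' g)) hg
  refine ⟨fun a b ha hb ε hε h => ?_, fun n hn a b ha hb ε hε h => ?_⟩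
  · refine ((hF' g () a ha).2 b hb ε hε fun i _ => h i).trans ?_
    exact mul_le_mul_of_nonneg_right (by linarith [hC g]) hε
  · refine ((hF g n hn a ha).2 b hb ε hε fun i _ => h i).trans ?_
    exact mul_le_mul_of_nonneg_right (by linarith [hC' g]) hε

variable {M : VonNeumannAlgebra H} {τ : M.toStarSubalgebra →ₗ[ℂ] ℂ}
  (hτ : IsFaithfulNormalTracialState M τ) {N : VonNeumannAlgebra H} {I I' J : Type*}

include hτ in
theorem EntropyData.exists_polynomials_microstates (D : EntropyData M τ N I' J)
    {U : Set (FreeAlgebra ℂ (I' ⊕ J ⊕ Unit) → ℂ)} (hU : U ∈ 𝓝 (ncLaw τ (joint D.x D.y D.z)))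
    {x : I → M.toStarSubalgebra} (hx : Generates (fun i => (x i : H →L[ℂ] H)) M) {R : I → ℝ}
    (hR : ∀ i, ‖x i‖ ≤ R i) {ε : ℝ} (hε : 0 < ε) :
    ∃ (q : J → FreeAlgebra ℂ I) (T : Finset (FreeAlgebra ℂ I)) (δ : ℝ), 0 < δ ∧
      (∀ j, twoNorm τ (FreeAlgebra.lift ℂ x (q j) - D.y j) < ε) ∧
      (∀ j, ‖FreeAlgebra.lift ℂ x (q j)‖ ≤ D.Ry j) ∧
      ∀ᶠ n in atTop, ∀ a : I → MatSA n, (∀ i, opNorm (a i : Mat n) ≤ R i) →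
        (∀ j, opNorm (evalMat a (q j)) ≤ D.Ry j) ∧
        ((∀ p ∈ T, ‖ntr (evalMat a p) - τ (FreeAlgebra.lift ℂ x p)‖ < δ) →
        ∃ V ∈ unitary (Mat n), ∃ B ∈ microstates D.Rx D.Ry (D.C n) U,
          ∀ j, (B j : Mat n) = V * evalMat a (q j) * star V) := by
  classical
  have hφ := hτ.isTracialState
  obtain ⟨G, εU, hεU, hG⟩ := exists_finset_of_mem_nhds_pi hU
  set Rall : I' ⊕ J ⊕ Unit → ℝ := Sum.elim D.Rx (Sum.elim D.Ry fun _ => D.Rz) with hRall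
  obtain ⟨K, hK, hGK⟩ := exists_lipschitz hτ Rall G
  obtain ⟨Q, δQ, hδQ, hQ⟩ := exists_polynomials_unitary_conj D.Rz (ε := εU / (4 * K))
    (by positivity)
  set comp : Polynomial ℝ → FreeAlgebra ℂ Unit := fun f =>
    Polynomial.aeval (FreeAlgebra.ι ℂ ()) (f.map (algebraMap ℝ ℂ)) with hcomp
  obtain ⟨L, hL, hQL⟩ := exists_lipschitz hτ (fun _ : Unit => D.Rz) (Q.image comp)
  -- Each of the tolerances `εU` and `δQ` is spent in quarters: one on approximating by polynomials,
  -- one on the tests in `T`, one on `C`, through conjugation for `εU` and through its moments for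
  -- `δQ`.
  set ε₁ := min ε (min (εU / (4 * K)) (δQ / (4 * L))) with hε₁
  have hε₁0 : 0 < ε₁ := by positivity
  have hε₁a : ε₁ ≤ ε := min_le_left _ _
  have hε₁b : K * ε₁ ≤ εU / 4 := by
    have : ε₁ ≤ εU / (4 * K) := (min_le_right _ _).trans (min_le_left _ _)
    rw [le_div_iff₀ (by positivity)] at this
    linarith
  have hε₁c : L * ε₁ ≤ δQ / 4 := by
    have : ε₁ ≤ δQ / (4 * L) := (min_le_right _ _).trans (min_le_right _ _)
    rw [le_div_iff₀ (by positivity)] at this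
    linarith
  choose p hp1 hp2 hp3 hp4 using fun i => hτ.exists_bounded_lift_twoNorm_sub_lt hx hR
    (D.x i).2 (Subtype.ext (D.generates_x.1 i)) (D.norm_x_lt i) hε₁0
  choose q hq1 hq2 hq3 hq4 using fun j => hτ.exists_bounded_lift_twoNorm_sub_lt hx hR
    (D.y j).2 (Subtype.ext (D.generates_y.1 j)) (D.norm_y_lt j) hε₁0
  obtain ⟨r, hr1, hr2, hr3, hr4⟩ := hτ.exists_bounded_lift_twoNorm_sub_lt hx hR
    D.z.2 D.z_selfAdjoint D.norm_z_lt hε₁0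
  set T : Finset (FreeAlgebra ℂ I) := (G.image fun g => FreeAlgebra.lift ℂ (joint p q r) g) ∪
    Q.image fun f => Polynomial.aeval r (f.map (algebraMap ℝ ℂ)) with hT
  refine ⟨q, T, min (εU / 4) (δQ / 4), by positivity, fun j => (hq1 j).trans_le hε₁a, hq3, ?_⟩
  have hC : ∀ᶠ n in atTop, ∀ f ∈ Q, ‖ntr (Polynomial.aeval (D.C n : Mat n) f) -
      τ (Polynomial.aeval D.z f)‖ < δQ / 4 := by
    refine (Finset.eventually_all Q).2 fun f _ => ?_
    have h1 := (tendsto_pi_nhds.1 D.tendsto_C) (comp f)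
    have h2 := (Metric.tendsto_nhds.1 h1) (δQ / 4) (by positivity)
    filter_upwards [h2] with n hn
    simpa only [ncLaw, hcomp, lift_aeval_map, FreeAlgebra.lift_ι_apply, dist_eq_norm] using hn
  filter_upwards [hC, eventually_gt_atTop 0] with n hCn hn a ha
  refine ⟨fun j => (hq4 j n hn _ (fun i => (a i).2) ha).2, fun hTa => ?_⟩
  have hp4' := fun i => hp4 i n hn _ (fun i => (a i).2) ha
  have hq4' := fun i => hq4 i n hn _ (fun i => (a i).2) ha
  have hr4' := hr4 n hn _ (fun i => (a i).2) ha
  -- Both `r(a)` and `D.C n` have nearly the spectral distribution of `D.z`, so a unitary moves one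
  -- close to the other. The conjugated tuple is then a microstate relative to `D.C n` itself.
  obtain ⟨V, hV, hVC⟩ := hQ n hn (evalMat a r) (D.C n) hr4'.1 (D.C n).2 hr4'.2 (D.norm_C_le n)
    fun f hf => by
      have h1 := hCn f hf
      have h2 := hTa _ (Finset.mem_union_right _ (Finset.mem_image_of_mem _ hf))
      rw [evalMat, lift_aeval_map, lift_aeval_map] at h2
      have h3 := (hQL _ (Finset.mem_image_of_mem comp hf)).1 (fun _ => FreeAlgebra.lift ℂ x r)
        (fun _ => D.z) (fun _ => hr3) (fun _ => D.norm_z_lt.le) ε₁ hε₁0.le fun _ => hr1.le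
      simp only [hcomp, lift_aeval_map, FreeAlgebra.lift_ι_apply] at h3
      have h4 := hφ.norm_map_le (Polynomial.aeval (FreeAlgebra.lift ℂ x r) f -
        Polynomial.aeval D.z f)
      rw [map_sub] at h4
      have h5 := h2.trans_le (min_le_right _ _)
      have h6 := norm_sub_le_norm_sub_add_norm_sub (ntr (Polynomial.aeval (evalMat a r) f))
        (τ (Polynomial.aeval (FreeAlgebra.lift ℂ x r) f)) (ntr (Polynomial.aeval (D.C n : Mat n) f))
      have h7 := norm_sub_le_norm_sub_add_norm_sub (τ (Polynomial.aeval (FreeAlgebra.lift ℂ x r) f))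
        (τ (Polynomial.aeval D.z f)) (ntr (Polynomial.aeval (D.C n : Mat n) f))
      rw [norm_sub_rev (ntr (Polynomial.aeval (D.C n : Mat n) f))] at h1
      linarith
  have hsa : ∀ A : Mat n, IsSelfAdjoint A → IsSelfAdjoint (V * A * star V) := fun A hA =>
    hA.conjugate V
  refine ⟨V, hV, fun j => ⟨V * evalMat a (q j) * star V, hsa _ (hq4' j).1⟩, ?_, fun j => rfl⟩
  refine ⟨fun i => ⟨V * evalMat a (p i) * star V, hsa _ (hp4' i).1⟩,
    fun i => (opNorm_conj hV _).trans_le (hp4' i).2,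
    fun j => (opNorm_conj hV _).trans_le (hq4' j).2, hG _ fun g hg => ?_⟩
  obtain ⟨hg1, hg2⟩ := hGK g hg
  set b : I' ⊕ J ⊕ Unit → Mat n :=
    joint (fun i => evalMat a (p i)) (fun j => evalMat a (q j)) (evalMat a r) with hb
  have hb1 : ∀ i, opNorm (V * b i * star V) ≤ Rall i := fun i => by
    rw [opNorm_conj hV]
    rcases i with i | i | i
    · exact (hp4' i).2
    · exact (hq4' i).2
    · exact hr4'.2
  have h1 := hg2 n hn (joint (fun i => V * evalMat a (p i) * star V)
      (fun j => V * evalMat a (q j) * star V) (D.C n : Mat n)) (fun i => V * b i * star V) (fun i => by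
        rcases i with i | i | i
        · exact hb1 (Sum.inl i)
        · exact hb1 (Sum.inr (Sum.inl i))
        · exact D.norm_C_le n) hb1 (εU / (4 * K)) (by positivity) (fun i => by
        have h0 : twoNorm ntr (0 : Mat n) = 0 := by simp [twoNorm, ntr]
        rcases i with i | i | i
        · simp only [joint, hb, Sum.elim_inl, sub_self, h0]
          positivity
        · simp only [joint, hb, Sum.elim_inl, Sum.elim_inr, sub_self, h0]
          positivity
        · open scoped Matrix.Norms.L2Operator in
          exact ((isTracialState_ntr hn).twoNorm_sub_comm _ _).trans_le hVC)
  have h2 := hg1 (joint (fun i => FreeAlgebra.lift ℂ x (p i))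
      (fun j => FreeAlgebra.lift ℂ x (q j)) (FreeAlgebra.lift ℂ x r)) (joint D.x D.y D.z) (fun i => by
        rcases i with i | i | i
        · exact hp3 i
        · exact hq3 i
        · exact hr3) (fun i => by
        rcases i with i | i | i
        · exact (D.norm_x_lt i).le
        · exact (D.norm_y_lt i).le
        · exact D.norm_z_lt.le) ε₁ hε₁0.le (fun i => by
        rcases i with i | i | i
        · exact (hp1 i).le
        · exact (hq1 i).le
        · exact hr1.le)
  have h3 := hTa _ (Finset.mem_union_left _ (Finset.mem_image_of_mem _ hg))
  rw [evalMat, lift_joint, lift_joint] at h3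
  have h3' := h3.trans_le (min_le_left _ _)
  rw [lift_conj hV] at h1
  have h4 : ∀ A B : Mat n, ‖ntr A - ntr B‖ ≤ twoNorm ntr (A - B) := fun A B => by
    open scoped Matrix.Norms.L2Operator in
    have := (isTracialState_ntr hn).norm_map_le (A - B)
    rw [map_sub] at this
    exact this
  have h5 := (h4 _ _).trans h1
  rw [ntr_conj hV] at h5
  have h6 : K * (εU / (4 * K)) = εU / 4 := by field_simp
  have h7 := hφ.norm_map_le (FreeAlgebra.lift ℂ (joint (fun i => FreeAlgebra.lift ℂ x (p i))
      (fun j => FreeAlgebra.lift ℂ x (q j)) (FreeAlgebra.lift ℂ x r)) g -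
      FreeAlgebra.lift ℂ (joint D.x D.y D.z) g)
  rw [map_sub] at h7
  rw [dist_eq_norm]
  have h8 := norm_sub_le_norm_sub_add_norm_sub
    (ntr (FreeAlgebra.lift ℂ (joint (fun i => V * evalMat a (p i) * star V)
      (fun j => V * evalMat a (q j) * star V) (D.C n : Mat n)) g))
    (ntr (FreeAlgebra.lift ℂ b g)) (τ (FreeAlgebra.lift ℂ (joint D.x D.y D.z) g))
  have h9 := norm_sub_le_norm_sub_add_norm_sub (ntr (FreeAlgebra.lift ℂ b g))
    (τ (FreeAlgebra.lift ℂ (joint (fun i => FreeAlgebra.lift ℂ x (p i))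
      (fun j => FreeAlgebra.lift ℂ x (q j)) (FreeAlgebra.lift ℂ x r)) g))
    (τ (FreeAlgebra.lift ℂ (joint D.x D.y D.z) g))
  refine lt_of_le_of_lt h8 ?_
  linarith

end Microstates

/-! ### Vanishing entropy yields few labels -/

section Labels

variable {H : Type*} [NormedAddCommGroup H] [InnerProductSpace ℂ H] [CompleteSpace H]

attribute [local instance] VonNeumannAlgebra.cstarAlgebra

variable {M : VonNeumannAlgebra H} {τ : M.toStarSubalgebra →ₗ[ℂ] ℂ}
  {N P : VonNeumannAlgebra H} {I I' J : Type*}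

theorem exists_finset_of_coverNum_lt {ι : Type*} {n : ℕ} {F : Finset ι} {ε : ℝ}
    {S : Set (ι → MatSA n)} {b : ℝ} (hb : 0 < b)
    (h : (coverNum F ε S : ENNReal) < ENNReal.ofReal b) :
    ∃ T : Finset (ι → MatSA n), (T.card : ℝ) ≤ b ∧
      ∀ B ∈ S, ∃ A ∈ T, ∀ i ∈ F, twoNorm ntr ((A i : Mat n) - (B i : Mat n)) < ε := by
  have hfin : coverNum F ε S ≠ ⊤ := by
    intro htop
    rw [htop] at h
    simp at h
  obtain ⟨m, hm⟩ := ENat.ne_top_iff_exists.1 hfin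
  have h1 : coverNum F ε S < ((m + 1 : ℕ) : ℕ∞) := by
    rw [← hm]
    exact_mod_cast Nat.lt_succ_self m
  simp only [coverNum, iInf_lt_iff] at h1
  obtain ⟨S₀, ⟨-, hS₀⟩, hcard⟩ := h1
  have hS₀f : S₀.Finite := Set.encard_lt_top_iff.1 (hcard.trans (ENat.natCast_lt_top _))
  refine ⟨hS₀f.toFinset, ?_, fun B hB => ?_⟩
  · rw [hS₀f.encard_eq_coe_toFinset_card] at hcard
    have h2 : hS₀f.toFinset.card ≤ m := Nat.lt_succ_iff.1 (by exact_mod_cast hcard)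
    rw [← hm] at h
    have h3 : (m : ENNReal) < ENNReal.ofReal b := by simpa using h
    rw [← ENNReal.ofReal_natCast, ENNReal.ofReal_lt_ofReal_iff hb] at h3
    exact (Nat.cast_le.2 h2).trans h3.le
  · obtain ⟨A, hA, hAB⟩ := hS₀ hB
    exact ⟨A, hS₀f.mem_toFinset.2 hA, hAB⟩

theorem EntropyData.exists_finset_cover (D : EntropyData M τ N I' J) (hh : D.h = 0)
    (F : Finset J) {ε : ℝ} (hε : 0 < ε) {c : ℝ} (hc : 0 < c) :
    ∃ U ∈ 𝓝 (ncLaw τ (joint D.x D.y D.z)), ∀ᶠ n in atTop, ∃ T : Finset (J → MatSA n),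
      (T.card : ℝ) ≤ Real.exp (c * (n : ℝ) ^ 2) ∧
      ∀ B ∈ microstates D.Rx D.Ry (D.C n) U,
        ∃ A ∈ T, ∀ j ∈ F, twoNorm ntr ((A j : Mat n) - (B j : Mat n)) < ε := by
  have h1 : (⨅ U ∈ 𝓝 (ncLaw τ (joint D.x D.y D.z)), limsup (fun n : ℕ =>
        ENNReal.log (coverNum F ε (microstates D.Rx D.Ry (D.C n) U) : ENNReal) /
          (((n : ℝ) ^ 2 : ℝ) : EReal)) atTop) < (c : EReal) := by
    refine lt_of_le_of_lt ?_ (EReal.coe_pos.2 hc)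
    rw [← hh]
    exact le_iSup_of_le F (le_iSup₂_of_le ε hε le_rfl)
  simp only [iInf_lt_iff] at h1
  obtain ⟨U, hU, hlim⟩ := h1
  refine ⟨U, hU, ?_⟩
  filter_upwards [eventually_lt_of_limsup_lt hlim, eventually_gt_atTop 0] with n hn hn0
  have hn2 : 0 < (n : ℝ) ^ 2 := by positivity
  exact exists_finset_of_coverNum_lt (Real.exp_pos _) (ENNReal.lt_ofReal_exp_of_log_div_lt hn2 hn)

open scoped Matrix.Norms.L2Operator in
set_option maxHeartbeats 800000 in
/-- For generators of an algebra with vanishing entropy: on tuples of matrices whose laws are close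
to the law of `x`, and on which a polynomial approximating an element of `N ∩ P` is almost constant,
a polynomial approximating `D.y j` is determined up to small 2-distance by few labels. -/
theorem EntropyData.exists_tests_label (hτ : IsFaithfulNormalTracialState M τ) (hPM : P ≤ M)
    (hdiff : IsDiffuse ((N : Set (H →L[ℂ] H)) ∩ P)) (D : EntropyData M τ N I' J) (hh : D.h = 0)
    {x : I → M.toStarSubalgebra} (hx : Generates (fun i => (x i : H →L[ℂ] H)) M) {R : I → ℝ}
    (hR : ∀ i, ‖x i‖ ≤ R i) (j : J) {ε : ℝ} (hε : 0 < ε) {c : ℝ} (hc : 0 < c) :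
    ∃ (q t : FreeAlgebra ℂ I) (T : Finset (FreeAlgebra ℂ I)) (δ θ : ℝ) (z : M.toStarSubalgebra),
      0 < δ ∧ 0 < θ ∧ twoNorm τ (FreeAlgebra.lift ℂ x q - D.y j) < ε ∧ (z : H →L[ℂ] H) ∈ P ∧
      twoNorm τ (FreeAlgebra.lift ℂ x t - z) < θ ∧
      ∀ᶠ n in atTop, ∀ S : Set (I → MatSA n), (∀ a ∈ S, ∀ i, opNorm (a i : Mat n) ≤ R i) →
        (∀ a ∈ S, ∀ p ∈ T, ‖ntr (evalMat a p) - τ (FreeAlgebra.lift ℂ x p)‖ < δ) →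
        (∀ a ∈ S, ∀ a' ∈ S, twoNorm ntr (evalMat a t - evalMat a' t) ≤ 4 * θ) →
        ∃ (K : ℕ) (lab : (I → MatSA n) → ℕ), (K : ℝ) ≤ Real.exp (c * (n : ℝ) ^ 2) ∧
          (∀ a ∈ S, lab a < K) ∧ ∀ a ∈ S, ∀ a' ∈ S, lab a = lab a' →
            twoNorm ntr (evalMat a q - evalMat a' q) ≤ 2 * ε := by
  classical
  have hφ := hτ.isTracialState
  have hxs : ∀ i, IsSelfAdjoint (x i) := fun i => Subtype.ext (hx.1 i)
  have hRy : 0 < D.Ry j := (norm_nonneg _).trans_lt (D.norm_y_lt j)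
  -- Makes the error `8 ρ r` of `exists_label_of_label_conj` equal to `ε`.
  set ρ := ε / (8 * D.Ry j) with hρd
  have hρ : 0 < ρ := by positivity
  have hlog : 0 < Real.log (1 + 2 / ρ) := Real.log_pos (by linarith [div_pos two_pos hρ])
  -- With at most `6 γ n²` close pairs the net of the approximate commutant has size at most `exp(c
  -- n² / 2)`; the other half of `c` pays for the entropy cover.
  set γ := c / (24 * Real.log (1 + 2 / ρ)) with hγd
  have hγ : 0 < γ := by positivity
  obtain ⟨z, m, w, hzs, hzN, hzP, hw, hw1, hzmom⟩ := exists_small_atoms hτ hPM hdiff hγ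
  obtain ⟨κ, L, δκ, hκ, hδκ, hband⟩ := exists_card_close_eigenvalues_le hγ hw hw1
  set θ' := κ * ρ / 24 with hθ'd
  have hθ' : 0 < θ' := by positivity
  set pw : ℕ → FreeAlgebra ℂ Unit := fun l => FreeAlgebra.ι ℂ () ^ l with hpw
  obtain ⟨K₁, hK₁, hpow⟩ := exists_lipschitz hτ (fun _ : Unit => ‖z‖ + 1) (L.image pw)
  set θ := min θ' (δκ / (4 * K₁)) with hθd
  have hθ : 0 < θ := by positivity
  have hθ1 : θ ≤ θ' := min_le_left _ _
  have hθ2 : K₁ * θ ≤ δκ / 4 := by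
    have : θ ≤ δκ / (4 * K₁) := min_le_right _ _
    rw [le_div_iff₀ (by positivity)] at this
    linarith
  obtain ⟨t, ht1, ht2, ht3, ht4⟩ := hτ.exists_bounded_lift_twoNorm_sub_lt hx hR z.2 hzs
    (lt_add_one ‖z‖) hθ
  -- The element `z` gets two polynomial descriptions: `t` in the generators of `M`, for evaluation
  -- on the matrix models, and `r` in those of `N`, which the labels control.
  obtain ⟨r, hr⟩ := hτ.exists_lift_twoNorm_sub_lt D.generates_y hzN hθ
  obtain ⟨K₂, hK₂, hrM⟩ := exists_lipschitz hτ D.Ry {r}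
  obtain ⟨C, F, hC, hrmat⟩ := exists_bound_lift_mat D.Ry r
  set ε' := min (ε / 2) (4 * θ / (C + 1)) with hε'd
  have hε' : 0 < ε' := by positivity
  have hε'1 : 2 * ε' ≤ ε := by linarith [min_le_left (ε / 2) (4 * θ / (C + 1))]
  have hε'2 : C * (2 * ε') ≤ 8 * θ := by
    have h1 : ε' ≤ 4 * θ / (C + 1) := min_le_right _ _
    rw [le_div_iff₀ (by positivity)] at h1
    nlinarith
  obtain ⟨U, hU, hcov⟩ := D.exists_finset_cover hh (insert j F) hε' (half_pos hc)
  have hεq : 0 < min ε (θ / K₂) := by positivity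
  obtain ⟨q, T, δ, hδ, hq1, hq2, hq3⟩ := D.exists_polynomials_microstates hτ hU hx hR hεq
  set f : FreeAlgebra ℂ I := FreeAlgebra.lift ℂ q r - t with hf
  have hfx : twoNorm τ (FreeAlgebra.lift ℂ x f) ≤ 3 * θ := by
    rw [hf, map_sub, lift_lift]
    have h1 := (hrM r (Finset.mem_singleton_self r)).1 (fun j => FreeAlgebra.lift ℂ x (q j)) D.y
      hq2 (fun j => (D.norm_y_lt j).le) (min ε (θ / K₂)) hεq.le fun j => (hq1 j).le
    have h2 : K₂ * min ε (θ / K₂) ≤ θ := by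
      have h3 : min ε (θ / K₂) ≤ θ / K₂ := min_le_right _ _
      rw [le_div_iff₀ hK₂] at h3
      linarith
    have h3 := hφ.twoNorm_sub_le_sub_add_sub
      (FreeAlgebra.lift ℂ (fun j => FreeAlgebra.lift ℂ x (q j)) r) (FreeAlgebra.lift ℂ D.y r)
      (FreeAlgebra.lift ℂ x t)
    have h4 := hφ.twoNorm_sub_le_sub_add_sub (FreeAlgebra.lift ℂ D.y r) z (FreeAlgebra.lift ℂ x t)
    have h5 := hφ.twoNorm_sub_comm z (FreeAlgebra.lift ℂ x t)
    linarith
  -- The test polynomial `f* f` forces the two descriptions of `z` to agree on matrices: `(3 θ)² + 7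
  -- θ² = (4 θ)²`. The powers of `t` control the moments of the reference matrix.
  refine ⟨q j, t, insert (ncStar f * f) (T ∪ L.image fun l => t ^ l),
    min δ (min (7 * θ ^ 2) (δκ / 4)), θ, z, by positivity, hθ,
    (hq1 j).trans_le (min_le_left _ _), hzP, ht1, ?_⟩
  filter_upwards [hcov, hq3, eventually_gt_atTop 0] with n ⟨T₀, hT₀, hT₀c⟩ hq3 hn S hSR hST hSt
  rcases S.eq_empty_or_nonempty with rfl | ⟨a₀, ha₀⟩
  · exact ⟨0, fun _ => 0, by simpa using (Real.exp_pos _).le, by simp, by simp⟩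
  have hφn := isTracialState_ntr hn
  -- Any member of `S` serves as reference, since `t` is almost constant on `S`.
  set Dm : Mat n := evalMat a₀ t with hDm
  have hD : Dm.IsHermitian := (ht4 n hn _ (fun i => (a₀ i).2) (hSR a₀ ha₀)).1
  have hmom : ∀ l ∈ L, ‖ntr (Dm ^ l) -
      ((∑ i ∈ Finset.range m, w i * (i : ℝ) ^ l : ℝ) : ℂ)‖ < δκ := fun l hl => by
    have h1 := hST a₀ ha₀ (t ^ l) (Finset.mem_insert_of_mem
      (Finset.mem_union_right _ (Finset.mem_image_of_mem _ hl)))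
    have h2 := (hpow _ (Finset.mem_image_of_mem pw hl)).1 (fun _ => FreeAlgebra.lift ℂ x t)
      (fun _ => z) (fun _ => ht3) (fun _ => by linarith) θ hθ.le fun _ => ht1.le
    simp only [hpw, map_pow, FreeAlgebra.lift_ι_apply] at h2
    have h3 := hφ.norm_map_le (FreeAlgebra.lift ℂ x t ^ l - z ^ l)
    rw [map_sub] at h3
    rw [evalMat, map_pow, map_pow] at h1
    have h4 := h1.trans_le ((min_le_right _ _).trans (min_le_right _ _))
    have h5 := norm_sub_le_norm_sub_add_norm_sub (ntr (Dm ^ l)) (τ (FreeAlgebra.lift ℂ x t ^ l))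
      (τ (z ^ l))
    rw [← hzmom]
    linarith
  have hcard := hband n hn Dm hD hmom
  have hV : ∀ a, ∃ V B, a ∈ S → V ∈ unitary (Mat n) ∧ B ∈ microstates D.Rx D.Ry (D.C n) U ∧
      ∀ j, (B j : Mat n) = V * evalMat a (q j) * star V := fun a => by
    by_cases ha : a ∈ S
    · obtain ⟨V, hV, B, hB, hVB⟩ := (hq3 a (hSR a ha)).2 fun p hp =>
        (hST a ha p (Finset.mem_insert_of_mem (Finset.mem_union_left _ hp))).trans_le
          (min_le_left _ _)
      exact ⟨V, B, fun _ => ⟨hV, hB, hVB⟩⟩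
    · exact ⟨0, 0, fun h => absurd h ha⟩
  choose V B hVB using hV
  have hlab : ∀ a, ∃ A : J → MatSA n, a ∈ S → A ∈ T₀ ∧
      ∀ i ∈ insert j F, twoNorm ntr ((A i : Mat n) - (B a i : Mat n)) < ε' := fun a => by
    by_cases ha : a ∈ S
    · obtain ⟨A, hA, hAB⟩ := hT₀c (B a) (hVB a ha).2.1
      exact ⟨A, fun _ => ⟨hA, hAB⟩⟩
    · exact ⟨0, fun h => absurd h ha⟩
  choose lab hlab using hlab
  have hBB : ∀ a ∈ S, ∀ a' ∈ S, lab a = lab a' → ∀ i ∈ insert j F,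
      twoNorm ntr ((B a i : Mat n) - (B a' i : Mat n)) ≤ 2 * ε' := fun a ha a' ha' h i hi => by
    have h1 := (hlab a ha).2 i hi
    have h2 := (hlab a' ha').2 i hi
    rw [← h] at h2
    have h3 : twoNorm ntr ((B a i : Mat n) - (B a' i : Mat n)) ≤
      twoNorm ntr ((B a i : Mat n) - (lab a i : Mat n)) +
        twoNorm ntr ((lab a i : Mat n) - (B a' i : Mat n)) := hφn.twoNorm_sub_le_sub_add_sub _ _ _
    have h4 : twoNorm ntr ((B a i : Mat n) - (lab a i : Mat n)) =
      twoNorm ntr ((lab a i : Mat n) - (B a i : Mat n)) := hφn.twoNorm_sub_comm _ _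
    linarith
  set zz : (I → MatSA n) → Mat n := fun a =>
    FreeAlgebra.lift ℂ (fun j => evalMat a (q j)) r with hzz
  have hzt : ∀ a ∈ S, twoNorm ntr (zz a - evalMat a t) ≤ 4 * θ := fun a ha => by
    have h1 := hST a ha _ (Finset.mem_insert_self _ _)
    rw [evalMat, map_mul, map_mul, lift_ncStar fun i => (a i).2,
      lift_ncStar hxs] at h1
    have h2 := h1.trans_le ((min_le_right _ _).trans (min_le_left _ _))
    have h3 : (ntr (star (evalMat a f) * evalMat a f)).re = twoNorm ntr (evalMat a f) ^ 2 :=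
      hφn.re_map_star_mul_self _
    have h4 := hφ.re_map_star_mul_self (FreeAlgebra.lift ℂ x f)
    have h5 := (Complex.abs_re_le_norm _).trans_lt h2
    rw [Complex.sub_re, h3, h4] at h5
    have h6 : zz a - evalMat a t = evalMat a f := by
      rw [hzz, evalMat, evalMat, hf, map_sub, lift_lift]
    rw [h6]
    refine abs_le_of_sq_le_sq' ?_ (by positivity) |>.2
    have h7 : twoNorm τ (FreeAlgebra.lift ℂ x f) ^ 2 ≤ (3 * θ) ^ 2 := by
      have := twoNorm_nonneg τ (FreeAlgebra.lift ℂ x f)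
      gcongr
    nlinarith [(abs_lt.1 h5).2]
  have h8 : 8 * θ ≤ κ * ρ / 3 := by linarith
  obtain ⟨T', lab', hT', hlab'T, hlab'⟩ := exists_label_of_label_conj hn (S := S)
    (y := fun a => evalMat a (q j)) (z := zz) (V := V) hD hκ hρ (ε := 2 * ε') (η := κ * ρ / 3)
    (r := D.Ry j) (by linarith) T₀ lab (fun a ha => (hlab a ha).1) (fun a ha => (hVB a ha).1)
    (fun a ha => (hq3 a (hSR a ha)).1 j)
    (fun a ha a' ha' h => by
      have h1 := hBB a ha a' ha' h j (Finset.mem_insert_self _ _)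
      rwa [(hVB a ha).2.2, (hVB a' ha').2.2] at h1)
    (fun a ha a' ha' h => by
      rw [hzz, ← lift_conj (hVB a ha).1, ← lift_conj (hVB a' ha').1]
      simp only [← (hVB a ha).2.2, ← (hVB a' ha').2.2]
      obtain ⟨_, _, hBR, _⟩ := (hVB a ha).2.1
      obtain ⟨_, _, hBR', _⟩ := (hVB a' ha').2.1
      exact ((hrmat n hn _ hBR).2 _ hBR' (2 * ε') (by positivity) fun i hi =>
        hBB a ha a' ha' h i (Finset.mem_insert_of_mem hi)).trans (hε'2.trans h8))
    (fun a ha => by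
      have h1 : twoNorm ntr (zz a - Dm) ≤
        twoNorm ntr (zz a - evalMat a t) + twoNorm ntr (evalMat a t - Dm) :=
        hφn.twoNorm_sub_le_sub_add_sub _ _ _
      linarith [hzt a ha, hSt a ha a₀ ha₀])
  refine ⟨T'.card, fun a => if h : lab' a ∈ T' then T'.equivFin ⟨lab' a, h⟩ else 0, ?_, ?_, ?_⟩
  · refine hT'.trans ?_
    have h1 : (1 + 2 / ρ) ^ (2 * (Finset.univ.filter fun p : Fin n × Fin n =>
        |hD.eigenvalues p.1 - hD.eigenvalues p.2| < κ).card) ≤ Real.exp (c / 2 * (n : ℝ) ^ 2) := by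
      rw [← Real.exp_log (show 0 < 1 + 2 / ρ by positivity), ← Real.exp_nat_mul]
      refine Real.exp_le_exp.2 ?_
      push_cast
      have h2 : 12 * γ * Real.log (1 + 2 / ρ) = c / 2 := by
        have h3 := hlog.ne'
        rw [hγd]
        generalize Real.log (1 + 2 / ρ) = y at h3
        field_simp
        norm_num
      calc _ ≤ 2 * (6 * γ * (n : ℝ) ^ 2) * Real.log (1 + 2 / ρ) := by gcongr
        _ = 12 * γ * Real.log (1 + 2 / ρ) * (n : ℝ) ^ 2 := by ring
        _ = _ := by rw [h2]
    calc _ ≤ Real.exp (c / 2 * (n : ℝ) ^ 2) * Real.exp (c / 2 * (n : ℝ) ^ 2) := by gcongr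
      _ = _ := by
        rw [← Real.exp_add]
        congr 1
        ring
  · intro a ha
    simp only [dif_pos (hlab'T a ha)]
    exact (T'.equivFin _).2
  · intro a ha a' ha' h
    simp only [dif_pos (hlab'T a ha), dif_pos (hlab'T a' ha')] at h
    have h1 := congrArg Subtype.val (T'.equivFin.injective (Fin.ext h))
    refine (hlab' a ha a' ha' h1).trans ?_
    have h2 : 8 * ρ * D.Ry j = ε := by
      rw [hρd]
      field_simp
    linarith

end Labels

/-! ### Subalgebras of vanishing entropy are absorbed -/

section Absorption

variable {H : Type*} [NormedAddCommGroup H] [InnerProductSpace ℂ H] [CompleteSpace H]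

attribute [local instance] VonNeumannAlgebra.cstarAlgebra

/-- Pigeonhole by subadditivity of outer measure; the labels need not be measurable. -/
theorem exists_label_measure_ge {Ω : Type*} [MeasurableSpace Ω] (μ : Measure Ω) {S : Set Ω}
    {K : ℕ} {lab : Ω → ℕ} (hlab : ∀ ω ∈ S, lab ω < K) {b : ENNReal} (hb : K * b < μ S) :
    ∃ l, b ≤ μ {ω | ω ∈ S ∧ lab ω = l} := by
  by_contra! h
  refine absurd hb (not_lt.2 ?_)
  calc μ S ≤ μ (⋃ l ∈ Finset.range K, {ω | ω ∈ S ∧ lab ω = l}) := measure_mono fun ω hω => by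
        simp only [Set.mem_iUnion, Finset.mem_range]
        exact ⟨lab ω, hlab ω hω, hω, rfl⟩
    _ ≤ ∑ l ∈ Finset.range K, μ {ω | ω ∈ S ∧ lab ω = l} := measure_biUnion_finset_le _ _
    _ ≤ ∑ l ∈ Finset.range K, b := Finset.sum_le_sum fun l _ => (h l).le
    _ = K * b := by simp

theorem measure_ge_le_integral_div {Ω : Type*} [MeasurableSpace Ω] {μ : Measure Ω} {f : Ω → ℝ}
    (h0 : ∀ ω, 0 ≤ f ω) (hf : Integrable f μ) {a : ℝ} (ha : 0 < a) :
    μ {ω | a ≤ f ω} ≤ ENNReal.ofReal ((∫ ω, f ω ∂μ) / a) := by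
  have h1 := mul_meas_ge_le_integral_of_nonneg (ae_of_all _ h0) hf a
  have hfin : μ {ω | a ≤ f ω} ≠ ⊤ := (hf.measure_ge_lt_top ha).ne
  rw [← ENNReal.ofReal_toReal hfin]
  refine ENNReal.ofReal_le_ofReal ?_
  rw [le_div_iff₀ ha, mul_comm]
  exact h1

open scoped Matrix.Norms.L2Operator in
set_option maxHeartbeats 800000 in
/-- Small balls of exponentially large measure exist for elements of a subalgebra with vanishing
entropy. -/
theorem IsMatrixModel.exists_ball {M P N : VonNeumannAlgebra H}
    {τ : M.toStarSubalgebra →ₗ[ℂ] ℂ} (hτ : IsFaithfulNormalTracialState M τ) (hPM : P ≤ M)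
    {I I' J : Type*} {x : I → M.toStarSubalgebra}
    (hx : Generates (fun i => (x i : H →L[ℂ] H)) M) {n : ℕ → ℕ}
    {Ω : ℕ → Type*} [∀ k, MeasurableSpace (Ω k)] {μ : ∀ k, Measure (Ω k)}
    [∀ k, IsProbabilityMeasure (μ k)]
    {X : ∀ k, I → Ω k → MatSA (n k)} {R : I → ℝ} (h : IsMatrixModel τ x μ X R)
    (hR : ∀ i, ‖x i‖ ≤ R i)
    (hEAP : ∀ p : FreeAlgebra ℂ I,
      Tendsto (fun k => twoNorm ntr (meanMat (μ k) fun ω => evalMat (fun i => X k i ω) p)) atTop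
      (𝓝 (twoNorm τ (condExpTr τ P (FreeAlgebra.lift ℂ x p)))))
    (hdiff : IsDiffuse ((N : Set (H →L[ℂ] H)) ∩ P)) (D : EntropyData M τ N I' J) (hh : D.h = 0)
    (j : J) {ε : ℝ} (hε : 0 < ε) {s : FreeAlgebra ℂ I}
    (hs : twoNorm τ (FreeAlgebra.lift ℂ x s - D.y j) < ε) {c : ℝ} (hc : 0 < c) :
    ∀ᶠ k in atTop, ∃ B : Mat (n k), ENNReal.ofReal (Real.exp (-c * (n k : ℝ) ^ 2)) ≤
        μ k {ω | twoNorm ntr (evalMat (fun i => X k i ω) s - B) ≤ 8 * ε} := by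
  classical
  have hφ := hτ.isTracialState
  obtain ⟨q, t, T, δ, θ, z, hδ, hθ, hq, hzP, htz, hlab⟩ :=
    D.exists_tests_label hτ hPM hdiff hh hx hR j hε (half_pos hc)
  -- The exceptional events: a law test fails, `s(X)` and `q(X)` are farther apart than in the
  -- limit, or `t(X)` is far from its mean. The first two become negligible; Markov's inequality
  -- bounds the third by `1/4`.
  set bad1 : ∀ k, Set (Ω k) := fun k => ⋃ p ∈ T, {ω | δ ≤
    ‖ntr (FreeAlgebra.lift ℂ (fun i => (X k i ω : Mat (n k))) p) - τ (FreeAlgebra.lift ℂ x p)‖}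
    with hbad1
  set bad2 : ∀ k, Set (Ω k) := fun k => {ω | ε ^ 2 ≤
    |twoNorm ntr (evalMat (fun i => X k i ω) (s - q)) ^ 2 -
      twoNorm τ (FreeAlgebra.lift ℂ x (s - q)) ^ 2|} with hbad2
  set bad3 : ∀ k, Set (Ω k) := fun k => {ω | (2 * θ) ^ 2 ≤
    twoNorm ntr (evalMat (fun i => X k i ω) t -
      meanMat (μ k) fun ω => evalMat (fun i => X k i ω) t) ^ 2} with hbad3
  have hlim1 : Tendsto (fun k => μ k (bad1 k)) atTop (𝓝 0) := by
    have h1 : Tendsto (fun k => ∑ p ∈ T, μ k {ω | δ ≤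
        ‖ntr (FreeAlgebra.lift ℂ (fun i => (X k i ω : Mat (n k))) p) -
          τ (FreeAlgebra.lift ℂ x p)‖}) atTop (𝓝 (∑ p ∈ T, 0)) :=
      tendsto_finsetSum _ fun p _ => h.tendsto_law p δ hδ
    rw [Finset.sum_const_zero] at h1
    exact tendsto_of_tendsto_of_tendsto_of_le_of_le tendsto_const_nhds h1 (fun k => zero_le)
      fun k => measure_biUnion_finset_le _ _
  have hlim2 : Tendsto (fun k => μ k (bad2 k)) atTop (𝓝 0) :=
    h.tendsto_measure_twoNorm_sq hτ _ (by positivity)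
  have hvar := h.tendsto_integral_twoNorm_sub_meanMat_sq hτ hPM (hEAP t)
  -- Here `z ∈ P` is used: the conditional expectation is the nearest point of `P`, so it is at
  -- least as close to `t(x)` as `z` is.
  have hvar_lt : twoNorm τ (FreeAlgebra.lift ℂ x t - condExpTr τ P (FreeAlgebra.lift ℂ x t)) ^ 2 <
      θ ^ 2 := by
    have h1 := (hτ.twoNorm_sub_condExpTr_le hPM (FreeAlgebra.lift ℂ x t) hzP).trans_lt htz
    have h2 := twoNorm_nonneg τ (FreeAlgebra.lift ℂ x t - condExpTr τ P (FreeAlgebra.lift ℂ x t))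
    gcongr
  have hn2 : Tendsto (fun k => (n k : ℝ) ^ 2) atTop atTop :=
    (tendsto_pow_atTop two_ne_zero).comp (tendsto_natCast_atTop_atTop.comp h.tendsto_size)
  have hexp : Tendsto (fun k => Real.exp (-(c / 2) * (n k : ℝ) ^ 2)) atTop (𝓝 0) :=
    Real.tendsto_exp_atBot.comp (hn2.const_mul_atTop_of_neg (by linarith))
  have h16 : (0 : ENNReal) < 1 / 16 := by norm_num
  filter_upwards [h.eventually_pos, h.tendsto_size.eventually hlab,
    hlim1.eventually_lt_const h16, hlim2.eventually_lt_const h16, hvar.eventually_lt_const hvar_lt,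
    hexp.eventually_lt_const (show (0 : ℝ) < 1 / 2 by norm_num)]
    with k hk hlab hb1 hb2 hb3 hexp
  have hφn := isTracialState_ntr hk
  obtain ⟨C, hC, hCle⟩ := h.exists_twoNorm_evalMat_le t
  set E := meanMat (μ k) fun ω => evalMat (fun i => X k i ω) t with hE
  have htri : ∀ a b c : Mat (n k), twoNorm ntr (a - c) ≤
      twoNorm ntr (a - b) + twoNorm ntr (b - c) := fun a b c =>
    hφn.twoNorm_sub_le_sub_add_sub a b c
  have hcomm : ∀ a b : Mat (n k), twoNorm ntr (a - b) = twoNorm ntr (b - a) :=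
    fun a b => hφn.twoNorm_sub_comm a b
  have hint : Integrable (fun ω => twoNorm ntr (evalMat (fun i => X k i ω) t - E) ^ 2) (μ k) := by
    refine Integrable.of_bound (((continuous_twoNorm_ntr _).measurable.comp
      ((h.measurable_evalMat k t).sub_const E)).pow_const 2).aestronglyMeasurable
      ((C + twoNorm ntr E) ^ 2) (ae_of_all _ fun ω => ?_)
    rw [Real.norm_of_nonneg (by positivity)]
    have h1 : twoNorm ntr (evalMat (fun i => X k i ω) t - E) ≤
      twoNorm ntr (evalMat (fun i => X k i ω) t) + twoNorm ntr E := hφn.twoNorm_sub_le _ _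
    have h2 := hCle k hk ω
    have h3 := twoNorm_nonneg ntr (evalMat (fun i => X k i ω) t - E)
    gcongr
    linarith
  have hb3' : μ k (bad3 k) ≤ 1 / 4 := by
    refine (measure_ge_le_integral_div (fun ω => sq_nonneg _) hint (by positivity)).trans ?_
    have h1 : (∫ ω, twoNorm ntr (evalMat (fun i => X k i ω) t - E) ^ 2 ∂(μ k)) / (2 * θ) ^ 2 ≤
        1 / 4 := by
      rw [div_le_iff₀ (by positivity)]
      linarith
    refine (ENNReal.ofReal_le_ofReal h1).trans (le_of_eq ?_)
    rw [ENNReal.ofReal_div_of_pos (by norm_num)]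
    norm_num
  set good := (bad1 k ∪ bad2 k ∪ bad3 k)ᶜ with hgood
  have hgoodm : 1 / 2 ≤ μ k good := by
    have h1 : (1 : ENNReal) ≤ μ k good + (1 / 16 + 1 / 16 + 1 / 4) := by
      calc (1 : ENNReal) = μ k Set.univ := measure_univ.symm
        _ = μ k (good ∪ (bad1 k ∪ bad2 k ∪ bad3 k)) := by rw [hgood, Set.compl_union_self]
        _ ≤ μ k good + μ k (bad1 k ∪ bad2 k ∪ bad3 k) := measure_union_le _ _
        _ ≤ _ := by
          gcongr
          exact (measure_union_le _ _).trans (add_le_add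
            ((measure_union_le _ _).trans (add_le_add hb1.le hb2.le)) hb3')
    by_contra hlt
    have h2 := h1.trans_lt (ENNReal.add_lt_add_of_lt_of_le (by norm_num) (not_le.1 hlt) le_rfl)
    have h3 : (1 / 2 + (1 / 16 + 1 / 16 + 1 / 4) : ENNReal) ≤ 1 := by
      have h4 : ((1 / 2 + (1 / 16 + 1 / 16 + 1 / 4) : NNReal) : ENNReal) ≤ ((1 : NNReal) : ENNReal) :=
        ENNReal.coe_le_coe.2 (by
          rw [← NNReal.coe_le_coe]
          norm_num)
      push_cast at h4
      simpa using h4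
    exact absurd h2 (not_lt.2 h3)
  have hg1 : ∀ ω ∈ good, ∀ p ∈ T, ‖ntr (evalMat (fun i => X k i ω) p) -
      τ (FreeAlgebra.lift ℂ x p)‖ < δ := fun ω hω p hp => by
    by_contra hcon
    refine hω (Or.inl (Or.inl ?_))
    simp only [hbad1, Set.mem_iUnion]
    exact ⟨p, hp, not_lt.1 hcon⟩
  have hg2 : ∀ ω ∈ good, twoNorm ntr (evalMat (fun i => X k i ω) s -
      evalMat (fun i => X k i ω) q) ≤ 3 * ε := fun ω hω => by
    have h1 : ¬ _ := fun hcon => hω (Or.inl (Or.inr hcon))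
    simp only [hbad2, Set.mem_ofPred_eq, not_le] at h1
    have h2 := hφ.twoNorm_sub_le_sub_add_sub (FreeAlgebra.lift ℂ x s) (D.y j)
      (FreeAlgebra.lift ℂ x q)
    rw [hφ.twoNorm_sub_comm (D.y j)] at h2
    rw [evalMat, map_sub, map_sub] at h1
    have h3 : twoNorm τ (FreeAlgebra.lift ℂ x s - FreeAlgebra.lift ℂ x q) ^ 2 ≤ (2 * ε) ^ 2 := by
      have := twoNorm_nonneg τ (FreeAlgebra.lift ℂ x s - FreeAlgebra.lift ℂ x q)
      gcongr
      linarith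
    refine abs_le_of_sq_le_sq' ?_ (by positivity) |>.2
    nlinarith [(abs_lt.1 h1).2]
  have hg3 : ∀ ω ∈ good, twoNorm ntr (evalMat (fun i => X k i ω) t - E) ≤ 2 * θ := fun ω hω => by
    have h1 : ¬ _ := fun hcon => hω (Or.inr hcon)
    simp only [hbad3, Set.mem_ofPred_eq, not_le] at h1
    exact (abs_le_of_sq_le_sq' h1.le (by positivity)).2
  obtain ⟨K, lab, hK, hlab1, hlab2⟩ := hlab ((fun ω i => X k i ω) '' good)
    (by
      rintro _ ⟨ω, -, rfl⟩ i
      exact h.opNorm_le k i ω)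
    (by
      rintro _ ⟨ω, hω, rfl⟩ p hp
      exact hg1 ω hω p hp)
    (by
      rintro _ ⟨ω, hω, rfl⟩ _ ⟨ω', hω', rfl⟩
      have h1 := htri (evalMat (fun i => X k i ω) t) E (evalMat (fun i => X k i ω') t)
      rw [hcomm E] at h1
      linarith [hg3 ω hω, hg3 ω' hω'])
  -- At most `exp(c n² / 2)` classes of measure below `exp(-c n²)` cannot fill half of the space.
  have hb : (K : ENNReal) * ENNReal.ofReal (Real.exp (-c * (n k : ℝ) ^ 2)) < μ k good := by
    refine lt_of_lt_of_le ?_ hgoodm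
    rw [← ENNReal.ofReal_natCast, ← ENNReal.ofReal_mul (Nat.cast_nonneg _)]
    have h1 : (K : ℝ) * Real.exp (-c * (n k : ℝ) ^ 2) ≤ Real.exp (-(c / 2) * (n k : ℝ) ^ 2) := by
      calc _ ≤ Real.exp (c / 2 * (n k : ℝ) ^ 2) * Real.exp (-c * (n k : ℝ) ^ 2) := by gcongr
        _ = _ := by
          rw [← Real.exp_add]
          congr 1
          ring
    have h2 : (1 / 2 : ENNReal) = ENNReal.ofReal (1 / 2) := by
      rw [ENNReal.ofReal_div_of_pos (by norm_num)]
      norm_num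
    rw [h2]
    exact (ENNReal.ofReal_lt_ofReal_iff (by norm_num)).2 (h1.trans_lt hexp)
  obtain ⟨l, hl⟩ := exists_label_measure_ge (μ k) (S := good) (lab := fun ω => lab fun i => X k i ω)
    (fun ω hω => hlab1 _ ⟨ω, hω, rfl⟩) hb
  obtain ⟨ω₀, hω₀, hlω₀⟩ : {ω | ω ∈ good ∧ (lab fun i => X k i ω) = l}.Nonempty := by
    by_contra hne
    rw [Set.not_nonempty_iff_eq_empty] at hne
    rw [hne, measure_empty] at hl
    exact absurd hl (not_le.2 (ENNReal.ofReal_pos.2 (Real.exp_pos _)))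
  -- The radius is `3 ε + 2 ε + 3 ε`: from `s` to `q`, within the label class, and back to `s`.
  refine ⟨evalMat (fun i => X k i ω₀) s, hl.trans (measure_mono fun ω hω => ?_)⟩
  have h1 := hlab2 _ ⟨ω, hω.1, rfl⟩ _ ⟨ω₀, hω₀, rfl⟩ (hω.2.trans hlω₀.symm)
  have h2 := hg2 ω hω.1
  have h3 := hg2 ω₀ hω₀
  have h4 := htri (evalMat (fun i => X k i ω) s) (evalMat (fun i => X k i ω) q)
    (evalMat (fun i => X k i ω₀) s)
  have h5 := htri (evalMat (fun i => X k i ω) q) (evalMat (fun i => X k i ω₀) q)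
    (evalMat (fun i => X k i ω₀) s)
  rw [hcomm (evalMat (fun i => X k i ω₀) q)] at h5
  simp only [Set.mem_ofPred_eq]
  linarith

theorem IsMatrixModel.le_of_entropy_eq_zero {M P N : VonNeumannAlgebra H}
    {τ : M.toStarSubalgebra →ₗ[ℂ] ℂ} (hτ : IsFaithfulNormalTracialState M τ) (hPM : P ≤ M)
    {I I' J : Type*} {x : I → M.toStarSubalgebra}
    (hx : Generates (fun i => (x i : H →L[ℂ] H)) M) {n : ℕ → ℕ}
    {Ω : ℕ → Type*} [∀ k, MeasurableSpace (Ω k)] {μ : ∀ k, Measure (Ω k)}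
    [∀ k, IsProbabilityMeasure (μ k)]
    {X : ∀ k, I → Ω k → MatSA (n k)} {R : I → ℝ} (h : IsMatrixModel τ x μ X R)
    (hR : ∀ i, ‖x i‖ ≤ R i)
    (hconc : ∀ F : Finset I, HasExpConcentration (n := n)
      fun k => (μ k).map fun ω (i : F) => X k i ω)
    (hEAP : ∀ p : FreeAlgebra ℂ I,
      Tendsto (fun k => twoNorm ntr (meanMat (μ k) fun ω => evalMat (fun i => X k i ω) p)) atTop
      (𝓝 (twoNorm τ (condExpTr τ P (FreeAlgebra.lift ℂ x p)))))
    (hdiff : IsDiffuse ((N : Set (H →L[ℂ] H)) ∩ P)) (D : EntropyData M τ N I' J) (hh : D.h = 0) :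
    N ≤ P := by
  have hφ := hτ.isTracialState
  have hy : ∀ j, (D.y j : H →L[ℂ] H) ∈ P := fun j => by
    refine hτ.mem_of_forall_twoNorm_sub_le hPM (D.y j) fun ε hε => ?_
    -- Balls of radius `8 ε / 17` give distance at most `16 ε / 17` from `s(x)` to `P`, and `s(x)`
    -- is within `ε / 17` of the generator.
    have hε' : 0 < ε / 17 := by positivity
    obtain ⟨s, hs⟩ := hτ.exists_lift_twoNorm_sub_lt hx (D.y j).2 hε'
    have h1 := h.twoNorm_sub_condExpTr_le_of_ball hτ hPM hconc (hEAP s)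
      (ε := 8 * (ε / 17)) (by positivity)
      fun c hc => h.exists_ball hτ hPM hx hR hEAP hdiff D hh j hε' hs hc
    refine ⟨condExpTr τ P (FreeAlgebra.lift ℂ x s), hτ.condExpTr_mem hPM _, ?_⟩
    have h2 := hφ.twoNorm_sub_le_sub_add_sub (D.y j) (FreeAlgebra.lift ℂ x s)
      (condExpTr τ P (FreeAlgebra.lift ℂ x s))
    rw [hφ.twoNorm_sub_comm (D.y j) (FreeAlgebra.lift ℂ x s)] at h2
    linarith
  intro T hT
  have hT' : T ∈ Set.centralizer (Set.centralizer (Set.range fun j => (D.y j : H →L[ℂ] H))) := by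
    rw [D.generates_y.2]
    exact hT
  have hsub : Set.range (fun j => (D.y j : H →L[ℂ] H)) ⊆ (P : Set (H →L[ℂ] H)) := by
    rintro _ ⟨j, rfl⟩
    exact hy j
  have h1 := Set.centralizer_subset (Set.centralizer_subset hsub) hT'
  rw [P.centralizer_centralizer] at h1
  exact h1

end Absorption

/-! ### Truncation -/

section Truncation

open scoped Matrix.Norms.L2Operator in
theorem continuous_opNorm (n : ℕ) : Continuous fun A : Mat n => opNorm A :=
  continuous_norm (E := Mat n)

theorem opNorm_zero {n : ℕ} : opNorm (0 : Mat n) = 0 := by simp [opNorm]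

open Classical in
/-- The cut-off of a self-adjoint matrix at operator norm `r`. -/
def truncate {n : ℕ} (r : ℝ) (A : MatSA n) : MatSA n := if opNorm (A : Mat n) ≤ r then A else 0

theorem opNorm_truncate_le {n : ℕ} {r : ℝ} (hr : 0 ≤ r) (A : MatSA n) :
    opNorm (truncate r A : Mat n) ≤ r := by
  unfold truncate
  split_ifs with h
  · exact h
  · simpa [opNorm_zero] using hr

theorem measurable_truncate {n : ℕ} (r : ℝ) : Measurable (truncate r : MatSA n → MatSA n) := by
  refine Measurable.ite ?_ measurable_id measurable_const
  exact measurableSet_le ((continuous_opNorm n).measurable.comp measurable_subtype_coe)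
    measurable_const

theorem evalMat_ae_eq {Ω I : Type*} [MeasurableSpace Ω] {μ : Measure Ω} {n : ℕ}
    {X Y : I → Ω → MatSA n} (h : ∀ i, ∀ᵐ ω ∂μ, X i ω = Y i ω) (p : FreeAlgebra ℂ I) :
    ∀ᵐ ω ∂μ, evalMat (fun i => X i ω) p = evalMat (fun i => Y i ω) p := by
  induction p using FreeAlgebra.induction with
  | grade0 c => simp
  | grade1 i =>
    filter_upwards [h i] with ω hω
    simp [hω]
  | mul p q hp hq =>
    filter_upwards [hp, hq] with ω h1 h2
    simp only [evalMat] at h1 h2 ⊢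
    rw [map_mul, map_mul, h1, h2]
  | add p q hp hq =>
    filter_upwards [hp, hq] with ω h1 h2
    simp only [evalMat] at h1 h2 ⊢
    rw [map_add, map_add, h1, h2]

end Truncation

end

theorem theoremB
    {H : Type*} [NormedAddCommGroup H] [InnerProductSpace ℂ H] [CompleteSpace H]
    -- an inclusion `P ⊆ M` of tracial von Neumann algebras
    (M P : VonNeumannAlgebra H) (τ : M.toStarSubalgebra →ₗ[ℂ] ℂ)
    (hτ : IsFaithfulNormalTracialState M τ) (hPM : P ≤ M)
    -- self-adjoint generators of `M`
    {I : Type*} (x : I → M.toStarSubalgebra)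
    (hx : Generates (fun i => (x i : H →L[ℂ] H)) M)
    -- tuples of random self-adjoint matrices of size `n k`
    (n : ℕ → ℕ) (hn : Tendsto n atTop atTop)
    {Ω : ℕ → Type*} [∀ k, MeasurableSpace (Ω k)] (μ : ∀ k, Measure (Ω k))
    [∀ k, IsProbabilityMeasure (μ k)]
    (X : ∀ k, I → Ω k → MatSA (n k)) (hX : ∀ k i, Measurable (X k i))
    -- (1) operator norm bounds
    (R : I → ℝ) (hR : ∀ k i, ∀ᵐ ω ∂(μ k), opNorm (X k i ω : Mat (n k)) ≤ R i)
    -- (2) convergence of the laws in probability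
    (hlaw : ∀ p : FreeAlgebra ℂ I, ∀ ε : ℝ, 0 < ε →
      Tendsto (fun k => μ k {ω | ε ≤
        ‖ntr (FreeAlgebra.lift ℂ (fun i => (X k i ω : Mat (n k))) p) -
          τ (FreeAlgebra.lift ℂ x p)‖}) atTop (𝓝 0))
    -- (3) exponential concentration of the distributions of all finite subtuples
    (hconc : ∀ F : Finset I, HasExpConcentration (n := n)
      fun k => (μ k).map fun ω (i : F) => X k i ω)
    -- (4) external averaging property; the expectation is taken entrywise
    (hEAP : ∀ p : FreeAlgebra ℂ I,
      Tendsto (fun k => twoNorm ntr (Matrix.of fun a b =>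
        ∫ ω, FreeAlgebra.lift ℂ (fun i => (X k i ω : Mat (n k))) p a b ∂(μ k))) atTop
        (𝓝 (twoNorm τ (condExpTr τ P (FreeAlgebra.lift ℂ x p)))))
    -- a von Neumann subalgebra `N` with `N ∩ P` diffuse and `h(N : M) = 0`
    (N : VonNeumannAlgebra H) (hNM : N ≤ M)
    (hdiffuse : IsDiffuse ((N : Set (H →L[ℂ] H)) ∩ P))
    {I' J : Type*} (D : EntropyData M τ N I' J) (hh : D.h = 0) :
    N ≤ P := by
  -- Truncation turns the almost sure norm bounds into pointwise ones without changing distributions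
  -- or expectations. The cut-off also dominates `‖x i‖`, so that the same polynomial bounds apply
  -- to `x` and to the matrices.
  have hae : ∀ k i, ∀ᵐ ω ∂(μ k), truncate (max (R i) ‖x i‖) (X k i ω) = X k i ω := fun k i => by
    filter_upwards [hR k i] with ω hω
    exact if_pos (hω.trans (le_max_left _ _))
  have hmodel : IsMatrixModel τ x μ (fun k i ω => truncate (max (R i) ‖x i‖) (X k i ω))
      fun i => max (R i) ‖x i‖ :=
    { isSelfAdjoint := fun i => Subtype.ext (hx.1 i)
      tendsto_size := hn
      measurable := fun k i => (measurable_truncate _).comp (hX k i)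
      opNorm_le := fun k i ω => opNorm_truncate_le ((norm_nonneg _).trans (le_max_right _ _)) _
      tendsto_law := fun p ε hε => (hlaw p ε hε).congr fun k => by
        refine measure_congr (Filter.eventuallyEq_set.2 ?_)
        filter_upwards [evalMat_ae_eq (hae k) p] with ω hω
        simp only [evalMat] at hω
        simp only [hω] }
  refine hmodel.le_of_entropy_eq_zero hτ hPM hx (fun i => le_max_right _ _) (fun F => ?_)
    (fun p => (hEAP p).congr fun k => ?_) hdiffuse D hh
  · have h1 : (fun k => (μ k).map fun ω (i : F) => truncate (max (R i) ‖x i‖) (X k i ω)) =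
        fun k => (μ k).map fun ω (i : F) => X k i ω := by
      funext k
      refine Measure.map_congr ?_
      filter_upwards [ae_all_iff.2 fun i : F => hae k i] with ω hω
      funext i
      exact hω i
    rw [h1]
    exact hconc F
  · congr 1
    ext a b
    refine integral_congr_ae ?_
    filter_upwards [evalMat_ae_eq (hae k) p] with ω hω
    exact (congrFun (congrFun hω a) b).symm
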